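/- There are universal constants $C,c>0$ with the following property. Let $(p_n)_{n\ge 1}$ be a sequence of numbers in $[0,1]$ such that $n^{-1/2}(\log n)^{C}\le p_n\le c$ for all sufficiently large $n$, and for each $n$ let $\Gamma_n$ be the $G(n,p_n)$ random graph on $\{1,\dots,n\}$ (every pair of vertices is an edge with probability $p_n$, independently of the other pairs). Then, with probability at least $1-n^{-\omega(1)}$ (that is, at least $1-n^{-\omega_n}$ for all large $n$, for some $\omega_n\to\infty$), $\Gamma_n$ is reconstructable from its $1$-neighborhoods: every graph on $n$ vertices with the same multiset of isomorphism classes of $1$-neighborhoods as $\Gamma_n$ is isomorphic to $\Gamma_n$. Here the $1$-neighborhood of a vertex $v$ of a graph is the subgraph induced by $v$ and all its neighbors, considered up to isomorphism without marking $v$, and the multiset contains one class for each of the $n$ vertices. -/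

import Mathlib

/-- Isomorphism of graphs, as an equivalence relation on the labeled graphs with vertex set `V`. -/
def graphIsoSetoid (V : Type*) : Setoid (SimpleGraph V) where
  r G H := Nonempty (G ≃g H)
  iseqv :=
    { refl := fun _ => ⟨RelIso.refl _⟩
      symm := fun ⟨f⟩ => ⟨f.symm⟩
      trans := fun ⟨f⟩ ⟨g⟩ => ⟨f.trans g⟩ }

/-- An unlabeled graph on `n` vertices: an isomorphism class of graphs on `n` labeled vertices. -/
def UnlabeledGraph (n : ℕ) : Type := Quotient (graphIsoSetoid (Fin n))

/-- The unlabeled graph represented by a labeled graph. -/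
def UnlabeledGraph.mk {n : ℕ} (G : SimpleGraph (Fin n)) : UnlabeledGraph n :=
  Quotient.mk (graphIsoSetoid (Fin n)) G

/-- Isomorphism as an equivalence relation on labeled finite graphs of arbitrary size. -/
def finGraphIsoSetoid : Setoid (Σ k : ℕ, SimpleGraph (Fin k)) where
  r G H := Nonempty (G.2 ≃g H.2)
  iseqv :=
    { refl := fun _ => ⟨RelIso.refl _⟩
      symm := fun ⟨f⟩ => ⟨f.symm⟩
      trans := fun ⟨f⟩ ⟨g⟩ => ⟨f.trans g⟩ }

/-- Isomorphism classes of finite graphs of arbitrary size. -/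
def FinGraphClass : Type := Quotient finGraphIsoSetoid

/-- The isomorphism class of a graph on an arbitrary finite vertex set
(the vertices are enumerated in some way; see `graphClass_eq_iff`). -/
noncomputable def graphClass {V : Type*} [Finite V] (G : SimpleGraph V) : FinGraphClass :=
  Quotient.mk finGraphIsoSetoid ⟨Nat.card V, G.comap (Finite.equivFin V).symm⟩

/-- Two finite graphs have the same class if and only if they are isomorphic. -/
theorem graphClass_eq_iff {V W : Type*} [Finite V] [Finite W]
    (G : SimpleGraph V) (H : SimpleGraph W) :
    graphClass G = graphClass H ↔ Nonempty (G ≃g H) := by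
  have e₁ : G.comap (Finite.equivFin V).symm ≃g G :=
    SimpleGraph.Iso.comap (Finite.equivFin V).symm G
  have e₂ : H.comap (Finite.equivFin W).symm ≃g H :=
    SimpleGraph.Iso.comap (Finite.equivFin W).symm H
  constructor
  · intro h
    obtain ⟨f⟩ := Quotient.exact h
    exact ⟨(e₁.symm.trans f).trans e₂⟩
  · rintro ⟨f⟩
    exact Quotient.sound ⟨(e₁.trans f).trans e₂.symm⟩

/-- The set of vertices at graph distance at most `r` from `v`
(vertices of other components are at distance `⊤`). -/
def nbhdSet {V : Type*} (G : SimpleGraph V) (r : ℕ) (v : V) : Set V :=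
  {w | G.edist v w ≤ r}

/-- The `r`-neighborhood of `v`: the subgraph induced by the vertices at distance at most `r`. -/
def nbhdGraph {V : Type*} (G : SimpleGraph V) (r : ℕ) (v : V) : SimpleGraph (nbhdSet G r v) :=
  G.induce (nbhdSet G r v)

/-- A graph isomorphism does not increase distances. -/
theorem edist_iso_le {V W : Type*} {G : SimpleGraph V} {H : SimpleGraph W}
    (f : G ≃g H) (v w : V) : H.edist (f v) (f w) ≤ G.edist v w := by
  refine le_iInf fun p => ?_
  have h := SimpleGraph.Walk.edist_le (p.map f.toHom)
  rw [SimpleGraph.Walk.length_map] at h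
  exact h

/-- A graph isomorphism preserves distances. -/
theorem edist_iso_eq {V W : Type*} {G : SimpleGraph V} {H : SimpleGraph W}
    (f : G ≃g H) (v w : V) : H.edist (f v) (f w) = G.edist v w := by
  refine le_antisymm (edist_iso_le f v w) ?_
  simpa using edist_iso_le f.symm (f v) (f w)

/-- A graph isomorphism restricts to isomorphisms of `r`-neighborhoods. -/
theorem nbhdGraph_iso {V W : Type*} {G : SimpleGraph V} {H : SimpleGraph W}
    (f : G ≃g H) (r : ℕ) (v : V) : Nonempty (nbhdGraph G r v ≃g nbhdGraph H r (f v)) := by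
  refine ⟨⟨f.toEquiv.subtypeEquiv fun w => ?_, ?_⟩⟩
  · change G.edist v w ≤ r ↔ H.edist (f v) (f w) ≤ r
    rw [edist_iso_eq]
  · intro a b
    exact f.map_adj_iff

/-- The multiset of the isomorphism classes of all vertex `r`-neighborhoods of a labeled graph. -/
noncomputable def labeledNbhds {n : ℕ} (r : ℕ) (G : SimpleGraph (Fin n)) :
    Multiset FinGraphClass :=
  (Finset.univ : Finset (Fin n)).val.map fun v => graphClass (nbhdGraph G r v)

/-- The multiset of `r`-neighborhoods does not depend on the labeling. -/
theorem labeledNbhds_congr {n : ℕ} (r : ℕ) (G H : SimpleGraph (Fin n))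
    (h : Nonempty (G ≃g H)) : labeledNbhds r G = labeledNbhds r H := by
  obtain ⟨f⟩ := h
  have h₁ : labeledNbhds r G = (Finset.univ : Finset (Fin n)).val.map
      fun v => graphClass (nbhdGraph H r (f.toEquiv v)) :=
    Multiset.map_congr rfl fun v _ => (graphClass_eq_iff _ _).2 (nbhdGraph_iso f r v)
  rw [h₁]
  have h₂ : (Finset.univ : Finset (Fin n)).val.map f.toEquiv = Finset.univ.val :=
    congrArg Finset.val (Finset.map_univ_equiv f.toEquiv)
  unfold labeledNbhds
  conv_rhs => rw [← h₂]
  rw [Multiset.map_map]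
  rfl

namespace UnlabeledGraph

/-- The `n`-multiset of vertex `r`-neighborhoods of an unlabeled graph on `n` vertices. -/
noncomputable def nbhds {n : ℕ} (r : ℕ) (G : UnlabeledGraph n) : Multiset FinGraphClass :=
  Quotient.lift (labeledNbhds r) (fun G H h => labeledNbhds_congr r G H h) G

/-- An unlabeled graph on `n` vertices is reconstructable from its `r`-neighborhoods if it is the
only unlabeled graph on `n` vertices with its multiset of `r`-neighborhoods. -/
def IsReconstructable {n : ℕ} (r : ℕ) (G : UnlabeledGraph n) : Prop :=
  ∀ H : UnlabeledGraph n, H.nbhds r = G.nbhds r → H = G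

end UnlabeledGraph

/-- The probability that the unlabeled `G(n, p)` graph is reconstructable from its
`r`-neighborhoods. -/
noncomputable def reconstructionProb (n r : ℕ) (p : unitInterval) : ℝ :=
  (SimpleGraph.binomialRandom (Fin n) p).real
    {G : SimpleGraph (Fin n) | (UnlabeledGraph.mk G).IsReconstructable r}

/-!
Let `H` have the same `1`-neighborhoods as the random graph `G`. Exchanging dominating vertices,
one may assume that the isomorphisms between neighborhoods preserve the centers, so there are a
permutation `π` and, for each vertex `v`, an embedding `φ v` of the graph on the neighbors of `v`
in `G` into the graph on the neighbors of `π v` in `H` (`exists_nbrEmbedding`). The vertex `φ v y`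
of `H` is called the name of `y` at `v`. A pair of neighbors of `v` gets a pair of names, and the
adjacency of the pair in `G` can be read off from its name in `H`; hence the namings are
consistent: two pairs that share a name, possibly at different vertices, are both edges or both
non-edges of `G`. It remains to show that with high probability every consistent system of namings
comes from one permutation `ψ`, because then `ψ` is an isomorphism: all pairs of vertices have
common neighbors.

The probabilistic part is a first moment argument. Call a dart `(v, y)` bad if `φ v y ≠ ψ y`. For a
fixed set `S` of vertices, expose the edges that meet `S`, and let `N` be the number of pairs
outside `S` that share a name with another pair at vertices of `S`. Consistency forces the state of
at least half of these pairs, which has probability at most `exp (-p * N / 2)`, whereas the naming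
on `S` is determined by its bad darts, each of which costs a factor `n ^ 3` in the union bound. So
`N` is at most `B`, of order `(log n) ^ 2 / p`, times the number of bad darts at `S`
(`collisionFailure_prob_le`). Averaging over random sets `S` of density `1 / (n * p ^ 2)`, on which
an impure name (a name that several vertices give to other pairs) has a constant chance to be
detected, bounds the number of impure names in terms of the number of bad darts, for all
`φ` and `ψ` simultaneously (`sum_impureSeers_le`). This is where `n * p ^ 2` has to exceed a power
of `log n`.

The rest is deterministic and uses only the regularity of degrees, codegrees and edge densities of
`G` (`Typical`). As few names are impure, counting shows that nearly all pairs have one name at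
nearly all vertices that see them; hence most neighbors of most vertices `y` agree on the name of
`y`, which defines `ψ` with few bad darts (`NamingSystem.exists_perm`). Now suppose that there are
bad darts. The bound on impure names is relative to their number, so nearly all pairs of names
that a bad dart spoils belong to pairs that are given one and the same wrong name by nearly all
vertices that see them (`NamingSystem.le_card_shiftedPairs`). For such a pair `s(y, z)`, the
vertex `z` or `y` has unusually many neighbors in the set of those who give the other one a
certain wrong name; the edge densities of `G` permit too few such pairs
(`NamingSystem.exists_global_name`).
-/

/-! ### Random subsets of a finite set -/

section BernoulliSubset

variable {α : Type*} [DecidableEq α]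

/-- The expectation of `f S` for the random subset `S` of `u` that contains each element of `u`
independently with probability `p`. -/
noncomputable def subsetExp (p : ℝ) (u : Finset α) (f : Finset α → ℝ) : ℝ :=
  ∑ S ∈ u.powerset, p ^ S.card * (1 - p) ^ (u \ S).card * f S

theorem subsetExp_empty (p : ℝ) (f : Finset α → ℝ) : subsetExp p ∅ f = f ∅ := by
  simp [subsetExp]

theorem subsetExp_insert (p : ℝ) {u : Finset α} {a : α} (ha : a ∉ u) (f : Finset α → ℝ) :
    subsetExp p (insert a u) f =
      (1 - p) * subsetExp p u f + p * subsetExp p u (fun S => f (insert a S)) := by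
  unfold subsetExp
  rw [Finset.sum_powerset_insert ha, Finset.mul_sum, Finset.mul_sum]
  congr 1
  · refine Finset.sum_congr rfl fun S hS => ?_
    have hS' := Finset.mem_powerset.1 hS
    rw [Finset.insert_sdiff_of_notMem _ (fun h => ha (hS' h)),
      Finset.card_insert_of_notMem (fun h => ha (Finset.mem_sdiff.1 h).1), pow_succ]
    ring
  · refine Finset.sum_congr rfl fun S hS => ?_
    have hS' := Finset.mem_powerset.1 hS
    have h1 : insert a u \ insert a S = u \ S := by
      ext b; simp only [Finset.mem_sdiff, Finset.mem_insert]
      constructor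
      · rintro ⟨h | h, h'⟩ <;> tauto
      · rintro ⟨h, h'⟩
        exact ⟨Or.inr h, fun hh => hh.elim (fun e => ha (e ▸ h)) h'⟩
    rw [h1, Finset.card_insert_of_notMem (fun h => ha (hS' h)), pow_succ]
    ring

theorem subsetExp_congr {p : ℝ} {u : Finset α} {f g : Finset α → ℝ}
    (h : ∀ S ⊆ u, f S = g S) : subsetExp p u f = subsetExp p u g :=
  Finset.sum_congr rfl fun S hS => by rw [h S (Finset.mem_powerset.1 hS)]

theorem subsetExp_mono {p : ℝ} (h0 : 0 ≤ p) (h1 : p ≤ 1) {u : Finset α} {f g : Finset α → ℝ}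
    (h : ∀ S ⊆ u, f S ≤ g S) : subsetExp p u f ≤ subsetExp p u g :=
  Finset.sum_le_sum fun S hS => mul_le_mul_of_nonneg_left (h S (Finset.mem_powerset.1 hS))
    (mul_nonneg (pow_nonneg h0 _) (pow_nonneg (by linarith) _))

theorem subsetExp_add (p : ℝ) (u : Finset α) (f g : Finset α → ℝ) :
    subsetExp p u (fun S => f S + g S) = subsetExp p u f + subsetExp p u g := by
  simp [subsetExp, mul_add, Finset.sum_add_distrib]

theorem subsetExp_const_mul (p : ℝ) (u : Finset α) (c : ℝ) (f : Finset α → ℝ) :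
    subsetExp p u (fun S => c * f S) = c * subsetExp p u f := by
  simp only [subsetExp, Finset.mul_sum]
  exact Finset.sum_congr rfl fun S _ => by ring

theorem subsetExp_sum (p : ℝ) (u : Finset α) {ι : Type*} (s : Finset ι)
    (f : ι → Finset α → ℝ) :
    subsetExp p u (fun S => ∑ i ∈ s, f i S) = ∑ i ∈ s, subsetExp p u (f i) := by
  simp only [subsetExp, Finset.mul_sum]
  exact Finset.sum_comm

theorem subsetExp_comm {β : Type*} [DecidableEq β] (p q : ℝ) (u : Finset α) (w : Finset β)
    (f : Finset α → Finset β → ℝ) :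
    subsetExp p u (fun S => subsetExp q w (fun T => f S T)) =
      subsetExp q w (fun T => subsetExp p u (fun S => f S T)) := by
  simp only [subsetExp, Finset.mul_sum]
  rw [Finset.sum_comm]
  exact Finset.sum_congr rfl fun S _ => Finset.sum_congr rfl fun T _ => by ring

theorem subsetExp_const (p : ℝ) (u : Finset α) (c : ℝ) : subsetExp p u (fun _ => c) = c := by
  induction u using Finset.induction_on with
  | empty => exact subsetExp_empty _ _
  | insert a u ha ih => rw [subsetExp_insert p ha, ih]; ring

theorem subsetExp_nonneg {p : ℝ} (h0 : 0 ≤ p) (h1 : p ≤ 1) {u : Finset α} {f : Finset α → ℝ}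
    (h : ∀ S ⊆ u, 0 ≤ f S) : 0 ≤ subsetExp p u f := by
  rw [← subsetExp_const p u 0]
  exact subsetExp_mono h0 h1 h

theorem subsetExp_union (p : ℝ) {u w : Finset α} (h : Disjoint u w) (f : Finset α → ℝ) :
    subsetExp p (u ∪ w) f = subsetExp p u (fun S => subsetExp p w (fun T => f (S ∪ T))) := by
  induction u using Finset.induction_on generalizing f with
  | empty => simp [subsetExp_empty]
  | insert a u ha ih =>
    rw [Finset.disjoint_insert_left] at h
    rw [Finset.insert_union, subsetExp_insert p (by simp [ha, h.1]), subsetExp_insert p ha,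
      ih h.2, ih h.2]
    simp only [Finset.insert_union]

theorem subsetExp_prod (p : ℝ) (u : Finset α) (f g : α → ℝ) :
    subsetExp p u (fun S => (∏ a ∈ S, f a) * ∏ a ∈ u \ S, g a) =
      ∏ a ∈ u, (p * f a + (1 - p) * g a) := by
  rw [Finset.prod_add]
  refine Finset.sum_congr rfl fun S _ => ?_
  rw [Finset.prod_mul_distrib, Finset.prod_mul_distrib, Finset.prod_const, Finset.prod_const]
  ring

/-- The indicator of a proposition, as a real number. -/
noncomputable def ind (P : Prop) : ℝ := by
  classical exact if P then 1 else 0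

theorem ind_true {P : Prop} (h : P) : ind P = 1 := by simp [ind, h]

theorem ind_false {P : Prop} (h : ¬P) : ind P = 0 := by simp [ind, h]

theorem ind_nonneg (P : Prop) : 0 ≤ ind P := by
  by_cases h : P <;> simp [ind, h]

theorem ind_le_one (P : Prop) : ind P ≤ 1 := by
  by_cases h : P <;> simp [ind, h]

theorem ind_mono {P Q : Prop} (h : P → Q) : ind P ≤ ind Q := by
  by_cases hP : P
  · rw [ind_true hP, ind_true (h hP)]
  · rw [ind_false hP]; exact ind_nonneg Q

theorem ind_not (P : Prop) : ind (¬P) = 1 - ind P := by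
  by_cases h : P <;> simp [ind, h]

theorem ind_or_le (P Q : Prop) : ind (P ∨ Q) ≤ ind P + ind Q := by
  by_cases h : P <;> by_cases h' : Q <;> simp [ind, h, h']

theorem ind_and (P Q : Prop) : ind (P ∧ Q) = ind P * ind Q := by
  by_cases h : P <;> by_cases h' : Q <;> simp [ind, h, h']

theorem ind_exists_le {ι : Type*} (s : Finset ι) (P : ι → Prop) :
    ind (∃ i ∈ s, P i) ≤ ∑ i ∈ s, ind (P i) := by
  by_cases h : ∃ i ∈ s, P i
  · obtain ⟨i, hi, hP⟩ := h
    rw [ind_true ⟨i, hi, hP⟩, ← ind_true hP]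
    exact Finset.single_le_sum (f := fun i => ind (P i)) (fun j _ => ind_nonneg _) hi
  · rw [ind_false h]; exact Finset.sum_nonneg fun j _ => ind_nonneg _

theorem sum_ind {ι : Type*} (s : Finset ι) (P : ι → Prop) [DecidablePred P] :
    ∑ i ∈ s, ind (P i) = ((s.filter P).card : ℝ) := by
  rw [Finset.card_filter]
  push_cast
  exact Finset.sum_congr rfl fun i _ => by by_cases h : P i <;> simp [ind, h]

theorem subsetExp_markov {p : ℝ} (h0 : 0 ≤ p) (h1 : p ≤ 1) (u : Finset α) (f : Finset α → ℝ)
    (hf : ∀ S ⊆ u, 0 ≤ f S) {c : ℝ} (hc : 0 < c) :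
    subsetExp p u (fun S => ind (c < f S)) ≤ subsetExp p u f / c := by
  rw [le_div_iff₀ hc, mul_comm, ← subsetExp_const_mul]
  refine subsetExp_mono h0 h1 fun S hS => ?_
  by_cases h : c < f S
  · rw [ind_true h]; linarith
  · rw [ind_false h]; simpa using hf S hS

/-- The probability that the random subset avoids `A`. -/
theorem subsetExp_disjoint (p : ℝ) {u A : Finset α} (hA : A ⊆ u) :
    subsetExp p u (fun S => ind (Disjoint A S)) = (1 - p) ^ A.card := by
  have h := subsetExp_prod p u (fun a => if a ∈ A then 0 else 1) (fun _ => 1)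
  have h2 : ∀ S ⊆ u, ind (Disjoint A S) =
      (∏ a ∈ S, (if a ∈ A then (0 : ℝ) else 1)) * ∏ a ∈ u \ S, (1 : ℝ) := by
    intro S _
    rw [Finset.prod_const_one, mul_one]
    by_cases hd : Disjoint A S
    · rw [ind_true hd, Finset.prod_eq_one]
      intro a ha
      rw [if_neg (fun h' => (Finset.disjoint_left.1 hd h') ha)]
    · rw [ind_false hd]
      obtain ⟨a, ha, ha'⟩ := Finset.not_disjoint_iff.1 hd
      exact (Finset.prod_eq_zero ha' (by simp [ha])).symm
  rw [subsetExp_congr h2, h, ← Finset.prod_subset hA]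
  · rw [Finset.prod_congr rfl (g := fun _ => 1 - p) (fun a ha => by simp [ha]), Finset.prod_const]
  · intro a _ ha; simp [ha]

theorem subsetExp_mem (p : ℝ) {u : Finset α} {a : α} (ha : a ∈ u) :
    subsetExp p u (fun S => ind (a ∈ S)) = p := by
  have h := subsetExp_disjoint p (u := u) (A := {a}) (by simpa using ha)
  have h2 : ∀ S ⊆ u, ind (a ∈ S) = 1 + (-1) * ind (Disjoint {a} S) := by
    intro S _
    rw [Finset.disjoint_singleton_left, ind_not]; ring
  rw [subsetExp_congr h2, subsetExp_add, subsetExp_const_mul, h, subsetExp_const]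
  simp

/-- The probability that the random subset avoids `B` and meets `A`, for disjoint `A`, `B`. -/
theorem subsetExp_avoid_meet (p : ℝ) {u A B : Finset α} (hA : A ⊆ u) (hB : B ⊆ u)
    (hAB : Disjoint A B) :
    subsetExp p u (fun S => ind (Disjoint B S ∧ ¬Disjoint A S)) =
      (1 - p) ^ B.card * (1 - (1 - p) ^ A.card) := by
  have h2 : ∀ S ⊆ u, ind (Disjoint B S ∧ ¬Disjoint A S) =
      ind (Disjoint B S) + (-1) * ind (Disjoint (A ∪ B) S) := by
    intro S _
    rw [Finset.disjoint_union_left]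
    by_cases h1 : Disjoint B S <;> by_cases h2 : Disjoint A S <;> simp [ind, h1, h2]
  rw [subsetExp_congr h2, subsetExp_add, subsetExp_const_mul, subsetExp_disjoint p hB,
    subsetExp_disjoint p (Finset.union_subset hA hB), Finset.card_union_of_disjoint hAB, pow_add]
  ring

/-- If, on the event `A`, membership of the elements of `X` is determined by the remaining
elements, then `A` has small conditional probability given any event `B` that does not depend
on `X`. -/
theorem subsetExp_forced_le {p : ℝ} (h0 : 0 ≤ p) (h1 : p ≤ 1 / 2) {u X : Finset α} (hX : X ⊆ u)
    (A B : Finset α → Prop) (t : Finset α → α → Prop)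
    (hAB : ∀ S ⊆ u, A S → B (S \ X))
    (hforce : ∀ S ⊆ u, A S → ∀ e ∈ X, (e ∈ S ↔ t (S \ X) e)) :
    subsetExp p u (fun S => ind (A S)) ≤
      (1 - p) ^ X.card * subsetExp p u (fun S => ind (B (S \ X))) := by
  classical
  have hu : u = (u \ X) ∪ X := (Finset.sdiff_union_of_subset hX).symm
  have hd : Disjoint (u \ X) X := Finset.sdiff_disjoint
  rw [hu, subsetExp_union p hd, subsetExp_union p hd, ← subsetExp_const_mul]
  refine subsetExp_mono h0 (by linarith) fun S hS => ?_
  have hSX : ∀ T ⊆ X, (S ∪ T) \ X = S := by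
    intro T hT
    ext a
    have h3 : a ∈ S → a ∉ X := fun h => (Finset.mem_sdiff.1 (hS h)).2
    have h4 : a ∈ T → a ∈ X := fun h => hT h
    simp only [Finset.mem_sdiff, Finset.mem_union]
    tauto
  have hSu : ∀ T ⊆ X, S ∪ T ⊆ u := fun T hT =>
    Finset.union_subset (hS.trans Finset.sdiff_subset) (hT.trans hX)
  have hR : subsetExp p X (fun T => ind (B ((S ∪ T) \ X))) = ind (B S) := by
    rw [subsetExp_congr (g := fun _ => ind (B S)) (fun T hT => by rw [hSX T hT]), subsetExp_const]
  rw [hR]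
  by_cases hB : B S
  · rw [ind_true hB, mul_one]
    set T0 := X.filter (t S) with hT0
    have hb : ∀ T ⊆ X, ind (A (S ∪ T)) ≤ if T = T0 then 1 else 0 := by
      intro T hT
      by_cases hA : A (S ∪ T)
      · have hTT : T = T0 := by
          ext e
          rw [hT0, Finset.mem_filter]
          constructor
          · intro he
            refine ⟨hT he, ?_⟩
            have := (hforce _ (hSu T hT) hA e (hT he)).1 (Finset.mem_union_right _ he)
            rwa [hSX T hT] at this
          · rintro ⟨he, hte⟩
            have := (hforce _ (hSu T hT) hA e he).2 (by rwa [hSX T hT])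
            rcases Finset.mem_union.1 this with h | h
            · exact absurd he (Finset.mem_sdiff.1 (hS h)).2
            · exact h
        rw [if_pos hTT]; exact ind_le_one _
      · rw [ind_false hA]; split_ifs <;> norm_num
    refine (subsetExp_mono h0 (by linarith) hb).trans ?_
    unfold subsetExp
    have hT0X : T0 ∈ X.powerset := Finset.mem_powerset.2 (Finset.filter_subset _ _)
    simp only [mul_ite, mul_one, mul_zero]
    rw [Finset.sum_ite_eq' X.powerset T0, if_pos hT0X]
    have hc : X.card = T0.card + (X \ T0).card := by
      rw [add_comm, Finset.card_sdiff_add_card_eq_card (Finset.mem_powerset.1 hT0X)]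
    rw [hc, pow_add]
    exact mul_le_mul_of_nonneg_right (pow_le_pow_left₀ h0 (by linarith) _)
      (pow_nonneg (by linarith) _)
  · have hz : ∀ T ⊆ X, ind (A (S ∪ T)) = 0 := by
      intro T hT
      refine ind_false fun hA => hB ?_
      have := hAB _ (hSu T hT) hA
      rwa [hSX T hT] at this
    rw [subsetExp_congr hz, subsetExp_const, ind_false hB, mul_zero]

/-- The version of `subsetExp_forced_le` for a random set `X S` of forced elements: `X S` may
depend on `S`, but not on the membership of the elements of `X S` itself. -/
theorem subsetExp_forced_le_pow {p : ℝ} (h0 : 0 ≤ p) (h1 : p ≤ 1 / 2) {u : Finset α}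
    (A : Finset α → Prop) (X : Finset α → Finset α) (t : Finset α → Finset α → α → Prop) (k : ℕ)
    (hX : ∀ S ⊆ u, X S ⊆ u)
    (hk : ∀ S ⊆ u, A S → k ≤ (X S).card)
    (hforce : ∀ S ⊆ u, A S → ∀ e ∈ X S, (e ∈ S ↔ t (X S) (S \ X S) e))
    (hXinv : ∀ S ⊆ u, ∀ S' ⊆ u, S \ X S = S' \ X S → X S' = X S) :
    subsetExp p u (fun S => ind (A S)) ≤ (1 - p) ^ k := by
  classical
  have hXS : ∀ S ⊆ u, X (S \ X S) = X S := fun S hS =>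
    hXinv S hS _ (Finset.sdiff_subset.trans hS) (by ext a; simp)
  have hstep : ∀ Y ∈ u.powerset, subsetExp p u (fun S => ind (A S ∧ X S = Y)) ≤
      (1 - p) ^ k * subsetExp p u (fun S => ind (X S = Y)) := by
    intro Y hY
    have hYu := Finset.mem_powerset.1 hY
    by_cases hkY : k ≤ Y.card
    · refine (subsetExp_forced_le h0 h1 hYu _ (fun S => X S = Y) (t Y) ?_ ?_).trans ?_
      · rintro S hS ⟨-, h⟩
        have := hXS S hS
        rw [h] at this
        exact this
      · rintro S hS ⟨hA, h⟩ e he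
        have := hforce S hS hA e (by rw [h]; exact he)
        rwa [h] at this
      · refine mul_le_mul (pow_le_pow_of_le_one (by linarith) (by linarith) hkY) ?_
          (subsetExp_nonneg h0 (by linarith) fun S _ => ind_nonneg _) (pow_nonneg (by linarith) _)
        refine subsetExp_mono h0 (by linarith) fun S hS => ind_mono fun h => ?_
        have hs : S \ Y ⊆ u := Finset.sdiff_subset.trans hS
        have := hXinv (S \ Y) hs S hS (by rw [h]; ext a; simp)
        rw [this, h]
    · have : ∀ S ⊆ u, ind (A S ∧ X S = Y) = 0 := by
        intro S hS
        refine ind_false ?_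
        rintro ⟨hA, h⟩
        exact hkY (h ▸ hk S hS hA)
      rw [subsetExp_congr this, subsetExp_const]
      exact mul_nonneg (pow_nonneg (by linarith) _)
        (subsetExp_nonneg h0 (by linarith) fun S _ => ind_nonneg _)
  have hsum : ∀ S ⊆ u, ∑ Y ∈ u.powerset, ind (X S = Y) = 1 := by
    intro S hS
    rw [Finset.sum_eq_single (X S)]
    · exact ind_true rfl
    · intro Y _ hne; exact ind_false fun h => hne h.symm
    · intro h; exact absurd (Finset.mem_powerset.2 (hX S hS)) h
  calc subsetExp p u (fun S => ind (A S))
      = subsetExp p u (fun S => ∑ Y ∈ u.powerset, ind (A S ∧ X S = Y)) := by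
        refine subsetExp_congr fun S hS => ?_
        simp_rw [ind_and]
        rw [← Finset.mul_sum, hsum S hS, mul_one]
    _ = ∑ Y ∈ u.powerset, subsetExp p u (fun S => ind (A S ∧ X S = Y)) := subsetExp_sum _ _ _ _
    _ ≤ ∑ Y ∈ u.powerset, (1 - p) ^ k * subsetExp p u (fun S => ind (X S = Y)) :=
        Finset.sum_le_sum hstep
    _ = (1 - p) ^ k := by
        rw [← Finset.mul_sum, ← subsetExp_sum, subsetExp_congr hsum, subsetExp_const, mul_one]

/-- Moment generating function of a weighted count of the elements of the random subset. -/
theorem subsetExp_exp (p : ℝ) (u : Finset α) (w : α → ℝ) :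
    subsetExp p u (fun S => Real.exp (∑ a ∈ S, w a)) =
      ∏ a ∈ u, (1 + p * (Real.exp (w a) - 1)) := by
  have h := subsetExp_prod p u (fun a => Real.exp (w a)) (fun _ => 1)
  rw [subsetExp_congr (g := fun S => (∏ a ∈ S, Real.exp (w a)) * ∏ a ∈ u \ S, (1 : ℝ))
    (fun S _ => by rw [Real.exp_sum]; simp), h]
  exact Finset.prod_congr rfl fun a _ => by ring

/-- Exponential Markov inequality for a weighted count of the elements of the random subset. -/
theorem subsetExp_chernoff {p : ℝ} (h0 : 0 ≤ p) (h1 : p ≤ 1) (u : Finset α) (w : α → ℝ)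
    (hw : ∀ a ∈ u, |w a| ≤ 1) (t : ℝ) :
    subsetExp p u (fun S => ind (t ≤ ∑ a ∈ S, w a)) ≤
      Real.exp (p * ∑ a ∈ u, (w a + w a ^ 2) - t) := by
  have hstep : subsetExp p u (fun S => ind (t ≤ ∑ a ∈ S, w a)) ≤
      Real.exp (-t) * subsetExp p u (fun S => Real.exp (∑ a ∈ S, w a)) := by
    rw [← subsetExp_const_mul]
    refine subsetExp_mono h0 h1 fun S _ => ?_
    rw [← Real.exp_add]
    by_cases h : t ≤ ∑ a ∈ S, w a
    · rw [ind_true h]; exact Real.one_le_exp (by linarith)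
    · rw [ind_false h]; exact (Real.exp_pos _).le
  refine hstep.trans ?_
  rw [subsetExp_exp, sub_eq_add_neg, add_comm, Real.exp_add, Finset.mul_sum, Real.exp_sum]
  refine mul_le_mul_of_nonneg_left ?_ (Real.exp_pos _).le
  have hb : ∀ a ∈ u, Real.exp (w a) - 1 ≤ w a + w a ^ 2 := by
    intro a ha
    have := Real.abs_exp_sub_one_sub_id_le (hw a ha)
    have := (abs_le.1 this).2
    linarith
  refine Finset.prod_le_prod (fun a ha => ?_) (fun a ha => ?_)
  · nlinarith [Real.exp_pos (w a)]
  · refine le_trans ?_ (Real.add_one_le_exp _)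
    nlinarith [mul_le_mul_of_nonneg_left (hb a ha) h0]

end BernoulliSubset

/-! ### Random graphs as random edge sets -/

section RandomGraph

open Classical in
/-- The neighbors of `v`. -/
noncomputable def nbr {V : Type*} [Fintype V] (G : SimpleGraph V) (v : V) : Finset V :=
  Finset.univ.filter fun w => G.Adj v w

@[simp] theorem mem_nbr {V : Type*} [Fintype V] {G : SimpleGraph V} {v w : V} :
    w ∈ nbr G v ↔ G.Adj v w := by simp [nbr]

variable {V : Type*}

/-- The graph with the given edges. -/
def edgeGraph (S : Finset (Sym2 V)) : SimpleGraph V := SimpleGraph.fromEdgeSet (S : Set (Sym2 V))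

theorem edgeGraph_adj {S : Finset (Sym2 V)} {v w : V} :
    (edgeGraph S).Adj v w ↔ s(v, w) ∈ S ∧ v ≠ w := by
  simp [edgeGraph]

theorem card_filter_mk_le_two [DecidableEq V] (C : Finset (V × V)) (e : Sym2 V) :
    (C.filter fun q => s(q.1, q.2) = e).card ≤ 2 := by
  induction e using Sym2.ind with
  | _ a b =>
    refine (Finset.card_le_card (t := {(a, b), (b, a)}) ?_).trans Finset.card_le_two
    rintro ⟨c, d⟩ h
    have := (Finset.mem_filter.1 h).2
    rw [Sym2.eq_iff] at this
    simp only [Finset.mem_insert, Finset.mem_singleton, Prod.mk.injEq]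
    exact this

variable [Fintype V] [DecidableEq V]

/-- All possible edges of a graph on `V`. -/
def allPairs (V : Type*) [Fintype V] [DecidableEq V] : Finset (Sym2 V) :=
  Finset.univ.filter fun e => ¬e.IsDiag

@[simp] theorem mem_allPairs {e : Sym2 V} : e ∈ allPairs V ↔ ¬e.IsDiag := by simp [allPairs]

theorem mem_edgeSet_edgeGraph {S : Finset (Sym2 V)} (hS : S ⊆ allPairs V) {e : Sym2 V} :
    e ∈ (edgeGraph S).edgeSet ↔ e ∈ S := by
  rw [edgeGraph, SimpleGraph.edgeSet_fromEdgeSet]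
  simp only [Set.mem_sdiff, Finset.mem_coe]
  constructor
  · exact fun h => h.1
  · exact fun h => ⟨h, by simpa using mem_allPairs.1 (hS h)⟩

theorem binomialRandom_real_eq (p : unitInterval) (A : Set (SimpleGraph V)) :
    (SimpleGraph.binomialRandom V p).real A =
      subsetExp (p : ℝ) (allPairs V) (fun S => ind (edgeGraph S ∈ A)) := by
  classical
  have : MeasurableSingletonClass (SimpleGraph V) := ⟨fun G => by
    have h : ({G} : Set (SimpleGraph V)) = SimpleGraph.edgeSet ⁻¹' {G.edgeSet} := by
      ext H; simp
    rw [h]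
    exact SimpleGraph.measurable_edgeSet (measurableSet_singleton _)⟩
  have hA : A = ((Finset.univ.filter (· ∈ A) : Finset (SimpleGraph V)) : Set _) := by simp
  have h1 : (SimpleGraph.binomialRandom V p).real A =
      ∑ G : SimpleGraph V, (SimpleGraph.binomialRandom V p).real {G} * ind (G ∈ A) := by
    conv_lhs => rw [hA, ← MeasureTheory.sum_measureReal_singleton]
    rw [Finset.sum_filter]
    refine Finset.sum_congr rfl fun G _ => ?_
    by_cases h : G ∈ A <;> simp [ind, h]
  rw [h1]
  unfold subsetExp
  symm
  refine Finset.sum_bij' (fun S _ => edgeGraph S)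
    (fun G _ => (Finset.univ.filter fun e => e ∈ G.edgeSet)) ?_ ?_ ?_ ?_ ?_
  · intros; simp
  · intro G _
    rw [Finset.mem_powerset]
    intro e he
    rw [mem_allPairs]
    exact G.not_isDiag_of_mem_edgeSet (by simpa using he)
  · intro S hS
    ext e
    simpa using mem_edgeSet_edgeGraph (Finset.mem_powerset.1 hS)
  · intro G _
    ext v w
    rw [edgeGraph_adj]
    simp only [Finset.mem_filter, Finset.mem_univ, true_and, SimpleGraph.mem_edgeSet]
    exact ⟨fun h => h.1, fun h => ⟨h, h.ne⟩⟩
  · intro S hS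
    have hS' := Finset.mem_powerset.1 hS
    have hes : (edgeGraph S).edgeSet = (S : Set (Sym2 V)) := by
      ext e; simpa using mem_edgeSet_edgeGraph hS'
    have hcard : (allPairs V).card = (Nat.card V).choose 2 := by
      rw [Nat.card_eq_fintype_card, ← Sym2.card_subtype_not_diag, Fintype.card_subtype]
      rfl
    rw [MeasureTheory.measureReal_def, SimpleGraph.binomialRandom_singleton, hes,
      Set.ncard_coe_finset, ← hcard, ← Finset.card_sdiff_of_subset hS']
    simp

/-- The number of edges between `A` and `B`, with the edges inside `A ∩ B` counted twice, as a
weighted count of random edges. -/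
theorem sum_nbr_eq (S : Finset (Sym2 V)) (hS : S ⊆ allPairs V) (A B : Finset V) :
    ((∑ b ∈ B, ((nbr (edgeGraph S) b) ∩ A).card : ℕ) : ℝ) =
      ∑ e ∈ S, (((A ×ˢ B).filter fun q => s(q.1, q.2) = e).card : ℝ) := by
  classical
  norm_cast
  have h1 : ∑ e ∈ S, ((A ×ˢ B).filter fun q => s(q.1, q.2) = e).card =
      ((A ×ˢ B).filter fun q => s(q.1, q.2) ∈ S).card :=
    Finset.sum_card_fiberwise_eq_card_filter _ _ _
  rw [h1, ← Finset.card_sigma]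
  refine Finset.card_bij' (fun q _ => (q.2, q.1)) (fun q _ => ⟨q.2, q.1⟩) ?_ ?_ ?_ ?_
  · rintro ⟨b, a⟩ h
    simp only [Finset.mem_sigma, Finset.mem_inter, mem_nbr, edgeGraph_adj] at h
    simp only [Finset.mem_filter, Finset.mem_product]
    exact ⟨⟨h.2.2, h.1⟩, by rw [Sym2.eq_swap]; exact h.2.1.1⟩
  · rintro ⟨a, b⟩ h
    simp only [Finset.mem_filter, Finset.mem_product] at h
    simp only [Finset.mem_sigma, Finset.mem_inter, mem_nbr, edgeGraph_adj]
    refine ⟨h.1.2, ⟨by rw [Sym2.eq_swap]; exact h.2, ?_⟩, h.1.1⟩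
    intro hab
    have := mem_allPairs.1 (hS h.2)
    exact this (by simp [hab])
  · intros; rfl
  · intros; rfl

theorem edge_count_tail {p : ℝ} (h0 : 0 ≤ p) (h1 : p ≤ 1) (A B : Finset V) (K : ℝ) :
    subsetExp p (allPairs V) (fun S => ind (1.2 * p * A.card * B.card + 10 * K ≤
      ((∑ b ∈ B, ((nbr (edgeGraph S) b) ∩ A).card : ℕ) : ℝ))) ≤ Real.exp (-K) := by
  set w : Sym2 V → ℝ := fun e => (((A ×ˢ B).filter fun q => s(q.1, q.2) = e).card : ℝ) with hw
  have hw0 : ∀ e, 0 ≤ w e := fun e => Nat.cast_nonneg _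
  have hw2 : ∀ e, w e ≤ 2 := fun e => by
    simp only [hw]; exact_mod_cast card_filter_mk_le_two (A ×ˢ B) e
  have h := subsetExp_chernoff h0 h1 (allPairs V) (fun e => 0.1 * w e)
    (fun e _ => by
      rw [abs_of_nonneg (by nlinarith [hw0 e])]; nlinarith [hw2 e])
    (0.1 * (1.2 * p * A.card * B.card + 10 * K))
  have hsumw : ∑ e ∈ allPairs V, w e ≤ A.card * B.card := by
    have : ∑ e ∈ allPairs V, ((A ×ˢ B).filter fun q => s(q.1, q.2) = e).card ≤
        (A ×ˢ B).card := by
      rw [Finset.sum_card_fiberwise_eq_card_filter]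
      exact Finset.card_filter_le _ _
    rw [Finset.card_product] at this
    simp only [hw]
    exact_mod_cast this
  refine le_trans (le_of_eq ?_) (h.trans (Real.exp_le_exp.2 ?_))
  · refine subsetExp_congr fun S hS => ?_
    rw [sum_nbr_eq S hS, ← Finset.mul_sum]
    congr 1
    apply propext
    exact (mul_le_mul_iff_right₀ (by norm_num)).symm
  · have h3 : ∑ e ∈ allPairs V, (0.1 * w e + (0.1 * w e) ^ 2) ≤ (0.12 : ℝ) * (A.card * B.card) := by
      calc ∑ e ∈ allPairs V, (0.1 * w e + (0.1 * w e) ^ 2)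
          ≤ ∑ e ∈ allPairs V, 0.12 * w e :=
            Finset.sum_le_sum fun e _ => by nlinarith [hw0 e, hw2 e]
        _ = 0.12 * ∑ e ∈ allPairs V, w e := by rw [Finset.mul_sum]
        _ ≤ _ := by nlinarith
    nlinarith [mul_le_mul_of_nonneg_left h3 h0]

theorem degree_tail {p : ℝ} (h0 : 0 ≤ p) (h1 : p ≤ 1) (v : V) {s : ℝ} (hs : |s| ≤ 1) (t : ℝ) :
    subsetExp p (allPairs V) (fun S => ind (t ≤ s * ((nbr (edgeGraph S) v).card : ℝ))) ≤
      Real.exp ((Fintype.card V - 1 : ℝ) * p * (s + s ^ 2) - t) := by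
  set F : Finset (Sym2 V) := (Finset.univ.erase v).image fun w => s(v, w) with hF
  have hinj : Set.InjOn (fun w => s(v, w)) ((Finset.univ.erase v : Finset V) : Set V) := by
    intro a _ b _ h
    exact Sym2.congr_right.1 h
  have hFc : (F.card : ℝ) = Fintype.card V - 1 := by
    rw [hF, Finset.card_image_of_injOn hinj, Finset.card_erase_of_mem (Finset.mem_univ _),
      Nat.cast_sub (by rw [Finset.card_univ]; exact Fintype.card_pos_iff.2 ⟨v⟩), Finset.card_univ]
    simp
  have hFsub : F ⊆ allPairs V := by
    intro e he
    obtain ⟨w, hw, rfl⟩ := Finset.mem_image.1 he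
    simpa using (Finset.ne_of_mem_erase hw).symm
  have h := subsetExp_chernoff h0 h1 (allPairs V) (fun e => if e ∈ F then s else 0)
    (fun e _ => by split_ifs <;> simp [hs]) t
  refine le_trans (le_of_eq ?_) (h.trans (Real.exp_le_exp.2 (le_of_eq ?_)))
  · refine subsetExp_congr fun S hS => ?_
    rw [← Finset.sum_filter, Finset.sum_const, nsmul_eq_mul, mul_comm s]
    congr 4
    refine Finset.card_bij (fun w _ => s(v, w)) ?_ ?_ ?_
    · intro w hw
      rw [mem_nbr, edgeGraph_adj] at hw
      exact Finset.mem_filter.2 ⟨hw.1, Finset.mem_image.2 ⟨w, by simp [hw.2.symm], rfl⟩⟩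
    · intro a _ b _ hab
      exact Sym2.congr_right.1 hab
    · intro e he
      obtain ⟨he, he'⟩ := Finset.mem_filter.1 he
      obtain ⟨w, hw, rfl⟩ := Finset.mem_image.1 he'
      exact ⟨w, by rw [mem_nbr, edgeGraph_adj]; exact ⟨he, (Finset.ne_of_mem_erase hw).symm⟩, rfl⟩
  · have : ∑ e ∈ allPairs V, ((if e ∈ F then s else 0) + (if e ∈ F then s else 0) ^ 2) =
        (Fintype.card V - 1 : ℝ) * (s + s ^ 2) := by
      rw [← Finset.sum_subset hFsub, Finset.sum_congr rfl (g := fun _ => s + s ^ 2)]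
      · rw [Finset.sum_const, nsmul_eq_mul, hFc]
      · intro e he; simp [he]
      · intro e _ he; simp [he]
    rw [this]; ring

theorem codegree_tail {p : ℝ} (h0 : 0 ≤ p) (h1 : p ≤ 1) {x y : V} (hxy : x ≠ y) {s : ℝ}
    (hs : |s| ≤ 1 / 2) (t : ℝ) :
    subsetExp p (allPairs V)
      (fun S => ind (t ≤ s * ((nbr (edgeGraph S) x ∩ nbr (edgeGraph S) y).card : ℝ))) ≤
      Real.exp ((Fintype.card V - 2 : ℝ) * p ^ 2 * (s + 4 * s ^ 2) - t) := by
  set W : Finset V := (Finset.univ.erase x).erase y with hW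
  have hWc : (W.card : ℝ) = Fintype.card V - 2 := by
    have h2 : 1 < (Finset.univ : Finset V).card :=
      Finset.one_lt_card.2 ⟨x, Finset.mem_univ _, y, Finset.mem_univ _, hxy⟩
    rw [hW, Finset.card_erase_of_mem (by simp [hxy.symm]), Finset.card_erase_of_mem
      (Finset.mem_univ _), Nat.sub_sub, Nat.cast_sub (by omega), Finset.card_univ]
    norm_num
  have hWm : ∀ w, w ∈ W ↔ w ≠ y ∧ w ≠ x := by intro w; simp [hW]
  -- Expose the edges at `x` first.
  set E1 : Finset (Sym2 V) := (allPairs V).filter fun e => x ∈ e with hE1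
  set E2 : Finset (Sym2 V) := (allPairs V).filter fun e => ¬x ∈ e with hE2
  have hE : allPairs V = E1 ∪ E2 := (Finset.filter_union_filter_not_eq _ _).symm
  have hd : Disjoint E1 E2 := Finset.disjoint_filter_filter_not _ _ _
  have hcod : ∀ S ⊆ E1, ∀ T ⊆ E2,
      (nbr (edgeGraph (S ∪ T)) x ∩ nbr (edgeGraph (S ∪ T)) y) =
        W.filter fun w => s(x, w) ∈ S ∧ s(y, w) ∈ T := by
    intro S hS T hT
    ext w
    simp only [Finset.mem_inter, mem_nbr, edgeGraph_adj, Finset.mem_union, Finset.mem_filter, hWm]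
    constructor
    · rintro ⟨⟨h1, h2⟩, h3, h4⟩
      refine ⟨⟨h4.symm, h2.symm⟩, ?_, ?_⟩
      · refine h1.resolve_right fun h => ?_
        exact (Finset.mem_filter.1 (hT h)).2 (by simp)
      · refine h3.resolve_left fun h => ?_
        have := (Finset.mem_filter.1 (hS h)).2
        simp only [Sym2.mem_iff] at this
        tauto
    · rintro ⟨⟨h1, h2⟩, h3, h4⟩
      exact ⟨⟨Or.inl h3, h2.symm⟩, Or.inr h4, h1.symm⟩
  have hin2 : ∀ w ∈ W, s(y, w) ∈ E2 := by
    intro w hw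
    rw [hWm] at hw
    simp only [hE2, Finset.mem_filter, mem_allPairs, Sym2.mk_isDiag_iff, Sym2.mem_iff]
    exact ⟨hw.1.symm, fun h => h.elim hxy (fun h => hw.2 h.symm)⟩
  have hin1 : ∀ w ∈ W, s(x, w) ∈ E1 := by
    intro w hw
    rw [hWm] at hw
    simp only [hE1, Finset.mem_filter, mem_allPairs, Sym2.mk_isDiag_iff, Sym2.mem_iff]
    exact ⟨hw.2.symm, by simp⟩
  have hs' := abs_le.1 hs
  have hs1 : |s| ≤ 1 := hs.trans (by norm_num)
  set r := p * (s + s ^ 2) with hr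
  -- The conditional bound, given the edges at `x`.
  have hcond : ∀ S ⊆ E1, subsetExp p E2 (fun T => ind (t ≤ s *
      ((nbr (edgeGraph (S ∪ T)) x ∩ nbr (edgeGraph (S ∪ T)) y).card : ℝ))) ≤
      Real.exp (-t) * Real.exp (∑ e ∈ S, if e ∈ W.image (fun w => s(x, w)) then r else 0) := by
    intro S hS
    set F := (W.filter fun w => s(x, w) ∈ S).image fun w => s(y, w) with hF
    have hFsub : F ⊆ E2 := by
      intro e he
      obtain ⟨w, hw, rfl⟩ := Finset.mem_image.1 he
      exact hin2 w (Finset.mem_filter.1 hw).1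
    have h := subsetExp_chernoff h0 h1 E2 (fun e => if e ∈ F then s else 0)
      (fun e _ => by split_ifs <;> simp [hs1]) t
    refine le_trans (le_of_eq ?_) (h.trans ?_)
    · refine subsetExp_congr fun T hT => ?_
      rw [hcod S hS T hT, ← Finset.sum_filter, Finset.sum_const, nsmul_eq_mul, mul_comm s]
      congr 4
      refine Finset.card_bij (fun w _ => s(y, w)) ?_ ?_ ?_
      · intro w hw
        obtain ⟨hw1, hw2, hw3⟩ := Finset.mem_filter.1 hw
        exact Finset.mem_filter.2 ⟨hw3, Finset.mem_image.2
          ⟨w, Finset.mem_filter.2 ⟨hw1, hw2⟩, rfl⟩⟩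
      · intro a _ b _ hab
        exact Sym2.congr_right.1 hab
      · intro e he
        obtain ⟨he, he'⟩ := Finset.mem_filter.1 he
        obtain ⟨w, hw, rfl⟩ := Finset.mem_image.1 he'
        obtain ⟨hw1, hw2⟩ := Finset.mem_filter.1 hw
        exact ⟨w, Finset.mem_filter.2 ⟨hw1, hw2, he⟩, rfl⟩
    · rw [← Real.exp_add]
      refine Real.exp_le_exp.2 (le_of_eq ?_)
      have e1 : ∑ e ∈ E2, ((if e ∈ F then s else 0) + (if e ∈ F then s else 0) ^ 2) =
          F.card * (s + s ^ 2) := by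
        rw [← Finset.sum_subset hFsub, Finset.sum_congr rfl (g := fun _ => s + s ^ 2)]
        · rw [Finset.sum_const, nsmul_eq_mul]
        · intro e he; simp [he]
        · intro e _ he; simp [he]
      have e2 : F.card = (S.filter fun e => e ∈ W.image fun w => s(x, w)).card := by
        rw [hF, Finset.card_image_of_injOn (fun a _ b _ h => Sym2.congr_right.1 h)]
        refine Finset.card_bij (fun w _ => s(x, w)) ?_ ?_ ?_
        · intro w hw
          obtain ⟨hw1, hw2⟩ := Finset.mem_filter.1 hw
          exact Finset.mem_filter.2 ⟨hw2, Finset.mem_image_of_mem _ hw1⟩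
        · intro a _ b _ hab
          exact Sym2.congr_right.1 hab
        · intro e he
          obtain ⟨he, he'⟩ := Finset.mem_filter.1 he
          obtain ⟨w, hw, rfl⟩ := Finset.mem_image.1 he'
          exact ⟨w, Finset.mem_filter.2 ⟨hw, he⟩, rfl⟩
      rw [e1, ← Finset.sum_filter, Finset.sum_const, nsmul_eq_mul, e2, hr]
      ring
  rw [hE, subsetExp_union p hd]
  refine (subsetExp_mono h0 h1 hcond).trans ?_
  rw [subsetExp_const_mul, subsetExp_exp, sub_eq_add_neg, add_comm _ (-t), Real.exp_add]
  refine mul_le_mul_of_nonneg_left ?_ (Real.exp_pos _).le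
  have hsub : W.image (fun w => s(x, w)) ⊆ E1 := by
    intro e he
    obtain ⟨w, hw, rfl⟩ := Finset.mem_image.1 he
    exact hin1 w hw
  rw [← Finset.prod_subset hsub (fun e _ he => by simp [he]),
    Finset.prod_congr rfl (g := fun _ => 1 + p * (Real.exp r - 1)) (fun e he => by rw [if_pos he]),
    Finset.prod_const, Finset.card_image_of_injOn (fun a _ b _ h => Sym2.congr_right.1 h)]
  have hrabs : |r| ≤ 1 := by
    rw [hr, abs_mul, abs_of_nonneg h0]
    have : |s + s ^ 2| ≤ 1 := abs_le.2 ⟨by nlinarith, by nlinarith⟩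
    nlinarith [abs_nonneg (s + s ^ 2)]
  have hexp : Real.exp r - 1 ≤ r + r ^ 2 := by
    have := (abs_le.1 (Real.abs_exp_sub_one_sub_id_le hrabs)).2
    linarith
  have hr2 : r + r ^ 2 ≤ p * (s + 4 * s ^ 2) := by
    have h3 : (s + s ^ 2) ^ 2 ≤ 3 * s ^ 2 := by
      have : (1 + s) ^ 2 ≤ 3 := by nlinarith
      nlinarith [sq_nonneg s]
    have h4 : r ^ 2 ≤ p * (3 * s ^ 2) := by
      rw [hr, mul_pow]
      have : p ^ 2 ≤ p := by nlinarith
      nlinarith [sq_nonneg s, sq_nonneg (s + s ^ 2), sq_nonneg p]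
    rw [hr] at *
    nlinarith
  have hbase : 1 + p * (Real.exp r - 1) ≤ Real.exp (p ^ 2 * (s + 4 * s ^ 2)) := by
    refine le_trans ?_ (Real.add_one_le_exp _)
    nlinarith [mul_le_mul_of_nonneg_left (hexp.trans hr2) h0]
  refine (pow_le_pow_left₀ ?_ hbase _).trans (le_of_eq ?_)
  · nlinarith [Real.exp_pos r]
  · rw [← Real.exp_nat_mul, hWc]; ring_nf

/-- The regularity of degrees, codegrees and edge densities of a binomial random graph with edge
probability `p` that the reconstruction argument uses. -/
structure Typical (G : SimpleGraph V) (p η κ : ℝ) : Prop where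
  deg_le : ∀ v, ((nbr G v).card : ℝ) ≤ (1 + η) * (Fintype.card V * p)
  le_deg : ∀ v, (1 - η) * (Fintype.card V * p) ≤ (nbr G v).card
  codeg_le : ∀ v w, v ≠ w → ((nbr G v ∩ nbr G w).card : ℝ) ≤ (1 + η) * (Fintype.card V * p ^ 2)
  le_codeg : ∀ v w, v ≠ w → (1 - η) * (Fintype.card V * p ^ 2) ≤ ((nbr G v ∩ nbr G w).card : ℝ)
  edges_le : ∀ A B : Finset V, ((∑ b ∈ B, (nbr G b ∩ A).card : ℕ) : ℝ) ≤
    1.2 * p * A.card * B.card + κ * (A.card + B.card)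

theorem degree_fail {p η : ℝ} (h0 : 0 ≤ p) (h1 : p ≤ 1) (hη : 0 < η) (hη1 : η ≤ 1)
    (hn : 8 ≤ η * Fintype.card V) (v : V) :
    subsetExp p (allPairs V) (fun S => ind (¬(((nbr (edgeGraph S) v).card : ℝ) ≤
      (1 + η) * (Fintype.card V * p) ∧ (1 - η) * (Fintype.card V * p) ≤
        (nbr (edgeGraph S) v).card))) ≤
      2 * Real.exp (-(Fintype.card V * p ^ 2 * η ^ 2 / 32)) := by
  set n : ℝ := (Fintype.card V : ℝ)
  have hnp : 0 ≤ n * p := by positivity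
  have hp2 : n * p ^ 2 ≤ n * p := by nlinarith [mul_le_mul_of_nonneg_left h1 hnp]
  have hs : |η / 16| ≤ 1 := by rw [abs_of_pos (by linarith)]; linarith
  have hs' : |-(η / 16)| ≤ 1 := by rwa [abs_neg]
  have u1 := degree_tail h0 h1 v hs (η / 16 * ((1 + η) * (n * p)))
  have u2 := degree_tail h0 h1 v hs' (-(η / 16) * ((1 - η) * (n * p)))
  have hlast : ∀ y : ℝ, y ≤ -(n * p ^ 2 * η ^ 2 / 32) →
      Real.exp y ≤ Real.exp (-(n * p ^ 2 * η ^ 2 / 32)) := fun y hy => Real.exp_le_exp.2 hy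
  have b1 := u1.trans (hlast _ (by
    change (n - 1) * p * _ - _ ≤ _
    have e1 : 0 ≤ p * (η / 16 + (η / 16) ^ 2) := by positivity
    have e2 : 0 ≤ n * p * η ^ 2 := by positivity
    have e3 := mul_le_mul_of_nonneg_right hp2 (sq_nonneg η)
    nlinarith))
  have b2 := u2.trans (hlast _ (by
    change (n - 1) * p * _ - _ ≤ _
    have e0 : (1 - η / 4) * n ≤ n - 1 := by nlinarith
    have e1 : 0 ≤ p * (η / 16) * (1 - η / 16) := by
      apply mul_nonneg; positivity; linarith
    have e2 : 0 ≤ n * p * η ^ 2 := by positivity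
    have e3 := mul_le_mul_of_nonneg_right hp2 (sq_nonneg η)
    have e4 : 0 ≤ n * p * η ^ 3 := by positivity
    nlinarith [mul_le_mul_of_nonneg_right e0 e1]))
  rw [two_mul]
  refine le_trans ?_ (add_le_add b1 b2)
  rw [← subsetExp_add]
  refine subsetExp_mono h0 h1 fun S _ => ?_
  refine le_trans (ind_mono fun h => ?_) (ind_or_le _ _)
  rw [not_and_or, not_le, not_le] at h
  rcases h with h | h
  · exact Or.inl (mul_le_mul_of_nonneg_left h.le (by linarith))
  · exact Or.inr (by nlinarith)

theorem codegree_fail {p η : ℝ} (h0 : 0 ≤ p) (h1 : p ≤ 1) (hη : 0 < η) (hη1 : η ≤ 1)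
    (hn : 8 ≤ η * Fintype.card V) {v w : V} (hvw : v ≠ w) :
    subsetExp p (allPairs V) (fun S => ind (¬(((nbr (edgeGraph S) v ∩ nbr (edgeGraph S) w).card
      : ℝ) ≤ (1 + η) * (Fintype.card V * p ^ 2) ∧ (1 - η) * (Fintype.card V * p ^ 2) ≤
        (nbr (edgeGraph S) v ∩ nbr (edgeGraph S) w).card))) ≤
      2 * Real.exp (-(Fintype.card V * p ^ 2 * η ^ 2 / 32)) := by
  set n : ℝ := (Fintype.card V : ℝ)
  have hnp : 0 ≤ n * p ^ 2 := by positivity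
  have hs : |η / 16| ≤ 1 / 2 := by rw [abs_of_pos (by linarith)]; linarith
  have hs' : |-(η / 16)| ≤ 1 / 2 := by rwa [abs_neg]
  have u1 := codegree_tail h0 h1 hvw hs (η / 16 * ((1 + η) * (n * p ^ 2)))
  have u2 := codegree_tail h0 h1 hvw hs' (-(η / 16) * ((1 - η) * (n * p ^ 2)))
  have hlast : ∀ y : ℝ, y ≤ -(n * p ^ 2 * η ^ 2 / 32) →
      Real.exp y ≤ Real.exp (-(n * p ^ 2 * η ^ 2 / 32)) := fun y hy => Real.exp_le_exp.2 hy
  have b1 := u1.trans (hlast _ (by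
    change (n - 2) * p ^ 2 * _ - _ ≤ _
    have e1 : 0 ≤ p ^ 2 * (η / 16 + 4 * (η / 16) ^ 2) := by positivity
    have e2 : 0 ≤ n * p ^ 2 * η ^ 2 := by positivity
    nlinarith))
  have b2 := u2.trans (hlast _ (by
    change (n - 2) * p ^ 2 * _ - _ ≤ _
    have e0 : (1 - η / 4) * n ≤ n - 2 := by nlinarith
    have e1 : 0 ≤ p ^ 2 * (η / 16) * (1 - η / 4) := by
      apply mul_nonneg; positivity; linarith
    have e2 : 0 ≤ n * p ^ 2 * η ^ 2 := by positivity
    have e4 : 0 ≤ n * p ^ 2 * η ^ 3 := by positivity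
    nlinarith [mul_le_mul_of_nonneg_right e0 e1]))
  rw [two_mul]
  refine le_trans ?_ (add_le_add b1 b2)
  rw [← subsetExp_add]
  refine subsetExp_mono h0 h1 fun S _ => ?_
  refine le_trans (ind_mono fun h => ?_) (ind_or_le _ _)
  rw [not_and_or, not_le, not_le] at h
  rcases h with h | h
  · exact Or.inl (mul_le_mul_of_nonneg_left h.le (by linarith))
  · exact Or.inr (by nlinarith)

theorem sum_pow_card_eq {β : Type*} [Fintype β] [DecidableEq β] (t : ℝ) :
    ∑ A : Finset β, t ^ A.card = (1 + t) ^ Fintype.card β := by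
  have h := Finset.sum_pow_mul_eq_add_pow t 1 (Finset.univ : Finset β)
  simp only [one_pow, mul_one, Finset.powerset_univ, Finset.card_univ] at h
  rw [h, add_comm]

theorem one_add_pow_sub_one_le {t : ℝ} (ht : 0 ≤ t) (m : ℕ) (h : m * t ≤ 1) :
    (1 + t) ^ m - 1 ≤ 2 * (m * t) := by
  have h1 : (1 + t) ^ m ≤ Real.exp (m * t) := by
    rw [Real.exp_nat_mul]
    exact pow_le_pow_left₀ (by linarith) (by rw [add_comm]; exact Real.add_one_le_exp t) _
  have hm : 0 ≤ m * t := by positivity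
  have h2 := (abs_le.1 (Real.abs_exp_sub_one_sub_id_le (x := m * t)
    (by rwa [abs_of_nonneg hm]))).2
  nlinarith

theorem edges_fail {p κ : ℝ} (h0 : 0 ≤ p) (h1 : p ≤ 1)
    (hκ : 2 * Fintype.card V * Real.exp (-(κ / 10)) ≤ 1) :
    subsetExp p (allPairs V) (fun S => ind (¬∀ A B : Finset V,
      ((∑ b ∈ B, (nbr (edgeGraph S) b ∩ A).card : ℕ) : ℝ) ≤
        1.2 * p * A.card * B.card + κ * (A.card + B.card))) ≤
      4 * Fintype.card V * Real.exp (-(κ / 10)) := by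
  set t := Real.exp (-(κ / 10)) with ht
  have ht0 : 0 < t := Real.exp_pos _
  set P : Finset (Finset V × Finset V) := Finset.univ.erase (∅, ∅) with hP
  have hb : ∀ q ∈ P, subsetExp p (allPairs V) (fun S => ind (¬
      ((∑ b ∈ q.2, (nbr (edgeGraph S) b ∩ q.1).card : ℕ) : ℝ) ≤
        1.2 * p * q.1.card * q.2.card + κ * (q.1.card + q.2.card))) ≤
        t ^ q.1.card * t ^ q.2.card := by
    intro q _
    refine le_trans (subsetExp_mono h0 h1 fun S _ => ind_mono fun h => ?_)
      ((edge_count_tail h0 h1 q.1 q.2 (κ / 10 * (q.1.card + q.2.card))).trans (le_of_eq ?_))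
    · rw [not_le] at h
      refine le_trans (le_of_eq ?_) h.le
      ring
    · rw [ht, ← pow_add, ← Real.exp_nat_mul]
      congr 1
      push_cast
      ring
  calc _ ≤ subsetExp p (allPairs V) (fun S => ∑ q ∈ P, ind (¬
      ((∑ b ∈ q.2, (nbr (edgeGraph S) b ∩ q.1).card : ℕ) : ℝ) ≤
        1.2 * p * q.1.card * q.2.card + κ * (q.1.card + q.2.card))) := by
        refine subsetExp_mono h0 h1 fun S _ => ?_
        refine le_trans (ind_mono fun h => ?_) (ind_exists_le P _)
        push Not at h
        obtain ⟨A, B, h⟩ := h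
        refine ⟨(A, B), ?_, not_le.2 h⟩
        rw [hP]
        refine Finset.mem_erase.2 ⟨?_, Finset.mem_univ _⟩
        rintro ⟨⟩
        simp at h
    _ ≤ ∑ q ∈ P, t ^ q.1.card * t ^ q.2.card := by
        rw [subsetExp_sum]; exact Finset.sum_le_sum hb
    _ = (1 + t) ^ (2 * Fintype.card V) - 1 := by
        have h2 : ∑ q : Finset V × Finset V, t ^ q.1.card * t ^ q.2.card =
            (1 + t) ^ (2 * Fintype.card V) := by
          rw [Fintype.sum_prod_type]
          simp only [← Finset.mul_sum, sum_pow_card_eq]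
          rw [← Finset.sum_mul, sum_pow_card_eq]; ring
        rw [hP, ← h2, ← Finset.add_sum_erase Finset.univ _ (Finset.mem_univ (∅, ∅))]
        simp
    _ ≤ 2 * ((2 * Fintype.card V : ℕ) * t) :=
        one_add_pow_sub_one_le ht0.le _ (by push_cast; exact hκ)
    _ = _ := by push_cast; ring

theorem typical_fail {p η κ : ℝ} (h0 : 0 ≤ p) (h1 : p ≤ 1) (hη : 0 < η) (hη1 : η ≤ 1)
    (hn : 8 ≤ η * Fintype.card V) (hκ : 2 * Fintype.card V * Real.exp (-(κ / 10)) ≤ 1) :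
    subsetExp p (allPairs V) (fun S => ind (¬Typical (edgeGraph S) p η κ)) ≤
      4 * (Fintype.card V : ℝ) ^ 2 * Real.exp (-(Fintype.card V * p ^ 2 * η ^ 2 / 32)) +
        4 * Fintype.card V * Real.exp (-(κ / 10)) := by
  set n : ℝ := (Fintype.card V : ℝ) with hnn
  set t := Real.exp (-(n * p ^ 2 * η ^ 2 / 32)) with ht
  have ht0 : 0 < t := Real.exp_pos _
  have hn1 : 1 ≤ n := by nlinarith
  calc _ ≤ subsetExp p (allPairs V) (fun S =>
        (∑ v : V, ind (¬(((nbr (edgeGraph S) v).card : ℝ) ≤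
          (1 + η) * (Fintype.card V * p) ∧ (1 - η) * (Fintype.card V * p) ≤
          (nbr (edgeGraph S) v).card)) +
        ∑ q ∈ (Finset.univ : Finset V).offDiag,
          ind (¬(((nbr (edgeGraph S) q.1 ∩ nbr (edgeGraph S) q.2).card
          : ℝ) ≤ (1 + η) * (Fintype.card V * p ^ 2) ∧ (1 - η) * (Fintype.card V * p ^ 2) ≤
          (nbr (edgeGraph S) q.1 ∩ nbr (edgeGraph S) q.2).card))) +
        ind (¬∀ A B : Finset V, ((∑ b ∈ B, (nbr (edgeGraph S) b ∩ A).card : ℕ) : ℝ) ≤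
          1.2 * p * A.card * B.card + κ * (A.card + B.card))) := by
        refine subsetExp_mono h0 h1 fun S _ => ?_
        refine le_trans (ind_mono fun h => ?_) ((ind_or_le _ _).trans
          (add_le_add_left ((ind_or_le _ _).trans (add_le_add
            (ind_exists_le Finset.univ _) (ind_exists_le Finset.univ.offDiag _))) _))
        by_contra hc
        push Not at hc
        obtain ⟨⟨hc1, hc2⟩, hc3⟩ := hc
        refine h ⟨fun v => (hc1 v (Finset.mem_univ _)).1, fun v => (hc1 v (Finset.mem_univ _)).2,
          fun v w hvw => ?_, fun v w hvw => ?_, hc3⟩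
        · exact (hc2 (v, w) (by simpa using hvw)).1
        · exact (hc2 (v, w) (by simpa using hvw)).2
    _ ≤ (∑ v : V, 2 * t + ∑ q ∈ (Finset.univ : Finset V).offDiag, 2 * t) +
          4 * n * Real.exp (-(κ / 10)) := by
        rw [subsetExp_add, subsetExp_add, subsetExp_sum, subsetExp_sum]
        refine add_le_add (add_le_add (Finset.sum_le_sum fun v _ => ?_)
          (Finset.sum_le_sum fun q hq => ?_)) (edges_fail h0 h1 hκ)
        · exact degree_fail h0 h1 hη hη1 hn v
        · exact codegree_fail h0 h1 hη hη1 hn (by simpa using hq)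
    _ ≤ _ := by
        have hoff : ((Finset.univ : Finset V).offDiag.card : ℝ) ≤ n ^ 2 := by
          rw [Finset.offDiag_card, hnn, Finset.card_univ]
          have := Nat.sub_le (Fintype.card V * Fintype.card V) (Fintype.card V)
          rw [sq]; exact_mod_cast this
        rw [Finset.sum_const, Finset.sum_const, nsmul_eq_mul, nsmul_eq_mul, Finset.card_univ]
        nlinarith [mul_le_mul_of_nonneg_right hoff ht0.le,
          mul_nonneg (mul_nonneg (by linarith : 0 ≤ n) (by linarith : 0 ≤ n - 1)) ht0.le]

end RandomGraph

/-! ### Pairs seen by a vertex and their names -/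

section Names

variable {V : Type*}

/-- The vertex `v` sees the pair `x` if both elements of the pair `x` are neighbors of `v`. -/
def Sees (G : SimpleGraph V) (v : V) (x : Sym2 V) : Prop := ¬x.IsDiag ∧ ∀ y ∈ x, G.Adj v y

theorem sees_mk {G : SimpleGraph V} {v y z : V} :
    Sees G v s(y, z) ↔ y ≠ z ∧ G.Adj v y ∧ G.Adj v z := by
  simp [Sees]

/-- A system of namings `φ v` of the neighbors of `v`, one for each vertex `v`, is consistent on
`S` if two pairs that get the same name from vertices of `S` are either both edges or both
non-edges of `G`. -/
def Consistent (G : SimpleGraph V) (S : Set V) (φ : V → V → V) : Prop :=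
  ∀ v ∈ S, ∀ v' ∈ S, ∀ x x', Sees G v x → Sees G v' x' → x.map (φ v) = x'.map (φ v') →
    (x ∈ G.edgeSet ↔ x' ∈ G.edgeSet)

/-- Two distinct pairs collide on `S` if they get the same name from some vertices of `S`. -/
def Collide (G : SimpleGraph V) (S : Set V) (φ : V → V → V) (x x' : Sym2 V) : Prop :=
  x' ≠ x ∧ ∃ v ∈ S, ∃ v' ∈ S, Sees G v x ∧ Sees G v' x' ∧ x.map (φ v) = x'.map (φ v')

theorem Collide.symm {G : SimpleGraph V} {S : Set V} {φ : V → V → V} {x x' : Sym2 V}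
    (h : Collide G S φ x x') : Collide G S φ x' x := by
  obtain ⟨h0, v, hv, v', hv', h1, h2, h3⟩ := h
  exact ⟨h0.symm, v', hv', v, hv, h2, h1, h3.symm⟩

theorem collide_congr {G : SimpleGraph V} {S : Set V} {φ φ' : V → V → V}
    (h : ∀ v ∈ S, ∀ y, G.Adj v y → φ v y = φ' v y) {x x' : Sym2 V}
    (hc : Collide G S φ x x') : Collide G S φ' x x' := by
  obtain ⟨h0, v, hv, v', hv', h1, h2, h3⟩ := hc
  refine ⟨h0, v, hv, v', hv', h1, h2, ?_⟩
  rw [← Sym2.map_congr fun y hy => h v hv y (h1.2 y hy),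
    ← Sym2.map_congr fun y hy => h v' hv' y (h2.2 y hy)]
  exact h3

theorem consistent_congr {G : SimpleGraph V} {S : Set V} {φ φ' : V → V → V}
    (h : ∀ v ∈ S, ∀ y, G.Adj v y → φ v y = φ' v y) (hc : Consistent G S φ) :
    Consistent G S φ' := by
  intro v hv v' hv' x x' h1 h2 h3
  refine hc v hv v' hv' x x' h1 h2 ?_
  rw [Sym2.map_congr fun y hy => h v hv y (h1.2 y hy),
    Sym2.map_congr fun y hy => h v' hv' y (h2.2 y hy)]
  exact h3

theorem consistent_comp {G : SimpleGraph V} {S : Set V} {φ : V → V → V} {σ : V → V}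
    (hσ : Function.Injective σ) (h : Consistent G S φ) :
    Consistent G S (fun v y => σ (φ v y)) := by
  intro v hv v' hv' x x' h1 h2 h3
  have hm : ∀ (v : V) (x : Sym2 V), x.map (fun y => σ (φ v y)) = (x.map (φ v)).map σ := by
    intro v x; rw [Sym2.map_map]; rfl
  rw [hm, hm, (Sym2.map.injective hσ).eq_iff] at h3
  exact h v hv v' hv' x x' h1 h2 h3

theorem sees_edgeGraph_congr {E E' : Finset (Sym2 V)} {v : V} (h : ∀ y, s(v, y) ∈ E ↔ s(v, y) ∈ E')
    (x : Sym2 V) : Sees (edgeGraph E) v x ↔ Sees (edgeGraph E') v x := by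
  simp only [Sees, edgeGraph_adj, h]

theorem collide_edgeGraph_congr {E E' : Finset (Sym2 V)} {S : Finset V}
    (h : ∀ v ∈ S, ∀ y, s(v, y) ∈ E ↔ s(v, y) ∈ E') (φ : V → V → V) :
    Collide (edgeGraph E) S φ = Collide (edgeGraph E') S φ := by
  funext x x'
  apply propext
  refine and_congr_right fun _ => ?_
  constructor
  · rintro ⟨v, hv, v', hv', h1, h2, h3⟩
    exact ⟨v, hv, v', hv', (sees_edgeGraph_congr (h v hv) x).1 h1,
      (sees_edgeGraph_congr (h v' hv') x').1 h2, h3⟩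
  · rintro ⟨v, hv, v', hv', h1, h2, h3⟩
    exact ⟨v, hv, v', hv', (sees_edgeGraph_congr (h v hv) x).2 h1,
      (sees_edgeGraph_congr (h v' hv') x').2 h2, h3⟩

/-- A set of elements each of which is related to some other element contains at least half of its
elements that are related to an element outside the chosen half: take a maximal independent set
or its complement. -/
theorem exists_half_with_outside_partner {α : Type*} [DecidableEq α] (N : Finset α)
    (R : α → α → Prop) (hsymm : ∀ x y, R x y → R y x) (hirr : ∀ x, ¬R x x)
    (hN : ∀ x ∈ N, ∃ y, R x y) :
    ∃ X ⊆ N, N.card ≤ 2 * X.card ∧ ∀ x ∈ X, ∃ y, y ∉ X ∧ R x y := by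
  classical
  obtain ⟨I, hI⟩ : ∃ I : Finset (Finset α), ∀ D, D ∈ I ↔ D ⊆ N ∧ ∀ x ∈ D, ∀ y ∈ D, ¬R x y :=
    ⟨N.powerset.filter fun D => ∀ x ∈ D, ∀ y ∈ D, ¬R x y, fun D => by
      rw [Finset.mem_filter, Finset.mem_powerset]⟩
  have hne : I.Nonempty := ⟨∅, (hI _).2 (by simp)⟩
  obtain ⟨D, hD, hmax⟩ := Finset.exists_max_image I Finset.card hne
  obtain ⟨hDN, hind⟩ := (hI _).1 hD
  by_cases hc : N.card ≤ 2 * D.card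
  · refine ⟨D, hDN, hc, fun x hx => ?_⟩
    obtain ⟨y, hy⟩ := hN x (hDN hx)
    exact ⟨y, fun h => hind x hx y h hy, hy⟩
  · refine ⟨N \ D, Finset.sdiff_subset, ?_, fun x hx => ?_⟩
    · have := Finset.card_sdiff_add_card_eq_card hDN
      omega
    · obtain ⟨hxN, hxD⟩ := Finset.mem_sdiff.1 hx
      by_contra hcon
      push Not at hcon
      have hnew : insert x D ∈ I := by
        refine (hI _).2 ⟨Finset.insert_subset hxN hDN, ?_⟩
        have hxy : ∀ y ∈ D, ¬R x y := fun y hy =>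
          hcon y (fun h => (Finset.mem_sdiff.1 h).2 hy)
        intro a ha b hb
        rcases Finset.mem_insert.1 ha with ha' | ha' <;>
          rcases Finset.mem_insert.1 hb with hb' | hb'
        · rw [ha', hb']; exact hirr _
        · rw [ha']; exact hxy b hb'
        · rw [hb']; exact fun h => hxy a ha' (hsymm _ _ h)
        · exact hind a ha' b hb'
      have := hmax _ hnew
      rw [Finset.card_insert_of_notMem hxD] at this
      omega

open Classical in
/-- The pairs `(v, y)` of a vertex `v` and a neighbor `y` whose name at `v` is not `ψ y`. -/
noncomputable def badDarts [Fintype V] (G : SimpleGraph V) (φ : V → V → V) (ψ : V → V) :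
    Finset (V × V) :=
  Finset.univ.filter fun q => G.Adj q.1 q.2 ∧ φ q.1 q.2 ≠ ψ q.2

theorem mem_badDarts [Fintype V] {G : SimpleGraph V} {φ : V → V → V} {ψ : V → V} {q : V × V} :
    q ∈ badDarts G φ ψ ↔ G.Adj q.1 q.2 ∧ φ q.1 q.2 ≠ ψ q.2 := by simp [badDarts]

variable [Fintype V] [DecidableEq V]

open Classical in
/-- The pairs disjoint from `S` that collide on `S` with some other pair. -/
noncomputable def collidingPairs (G : SimpleGraph V) (S : Finset V) (φ : V → V → V) :
    Finset (Sym2 V) :=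
  (allPairs V).filter fun x => (∀ v ∈ S, v ∉ x) ∧ ∃ x', Collide G S φ x x'

/-- The event that the vertices of `S` have a consistent system of namings with few bad darts and
many colliding pairs. -/
def CollisionFailure (G : SimpleGraph V) (S : Finset V) (B : ℝ) : Prop :=
  ∃ φ : V → V → V, Consistent G S φ ∧
    B * (((badDarts G φ id).filter fun q => q.1 ∈ S).card : ℝ) < (collidingPairs G S φ).card

open Classical in
/-- The system of namings in which `y` gets from `v` the name `a` if `(v, y, a)` is in the list `β`
of exceptions, and its own name otherwise. -/
noncomputable def namingOf (β : Finset (V × V × V)) (v y : V) : V :=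
  if h : ∃ a, (v, y, a) ∈ β then h.choose else y

theorem exists_namingOf (G : SimpleGraph V) (S : Finset V) (φ : V → V → V) :
    ∃ β : Finset (V × V × V), β.card = ((badDarts G φ id).filter fun q => q.1 ∈ S).card ∧
      ∀ v ∈ S, ∀ y, G.Adj v y → φ v y = namingOf β v y := by
  classical
  refine ⟨((badDarts G φ id).filter fun q => q.1 ∈ S).image fun q => (q.1, q.2, φ q.1 q.2),
    Finset.card_image_of_injective _ ?_, fun v hv y hvy => ?_⟩
  · rintro ⟨a, b⟩ ⟨c, d⟩ h
    simp only [Prod.mk.injEq] at h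
    simp [h.1, h.2.1]
  · have hmem : ∀ a, (v, y, a) ∈ ((badDarts G φ id).filter fun q => q.1 ∈ S).image
        (fun q => (q.1, q.2, φ q.1 q.2)) ↔ φ v y ≠ y ∧ a = φ v y := by
      intro a
      simp only [Finset.mem_image, Finset.mem_filter, mem_badDarts, Prod.mk.injEq, id]
      constructor
      · rintro ⟨⟨b, c⟩, ⟨⟨h1, h2⟩, h3⟩, rfl, rfl, rfl⟩
        exact ⟨h2, rfl⟩
      · rintro ⟨h1, rfl⟩
        exact ⟨(v, y), ⟨⟨hvy, h1⟩, hv⟩, rfl, rfl, rfl⟩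
    unfold namingOf
    split_ifs with h
    · exact ((hmem _).1 h.choose_spec).2.symm
    · by_contra hne
      exact h ⟨φ v y, (hmem _).2 ⟨hne, rfl⟩⟩

/-- For a fixed system of namings, consistency with many colliding pairs is unlikely: after
exposing the edges that meet `S`, each colliding pair in a suitable half must copy the state
of a pair outside that half. -/
theorem consistent_prob_le {p : ℝ} (h0 : 0 ≤ p) (h1 : p ≤ 1 / 2) (S : Finset V)
    (φ : V → V → V) (m : ℝ) :
    subsetExp p (allPairs V) (fun E => ind (Consistent (edgeGraph E) S φ ∧
      m < (collidingPairs (edgeGraph E) S φ).card)) ≤ Real.exp (-(p * m / 2)) := by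
  classical
  set N : (Sym2 V → Sym2 V → Prop) → Finset (Sym2 V) := fun R =>
    (allPairs V).filter fun x => (∀ v ∈ S, v ∉ x) ∧ ∃ x', R x x' with hN
  -- The chosen half of the colliding pairs depends only on the collision relation.
  have hex : ∀ R : Sym2 V → Sym2 V → Prop, ∃ X ⊆ N R, (∀ x y, R x y → R y x) → (∀ x, ¬R x x) →
      (N R).card ≤ 2 * X.card ∧ ∀ x ∈ X, ∃ y, y ∉ X ∧ R x y := by
    intro R
    by_cases h : (∀ x y, R x y → R y x) ∧ (∀ x, ¬R x x)
    · obtain ⟨X, hX, h2, h3⟩ := exists_half_with_outside_partner (N R) R h.1 h.2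
        (fun x hx => (Finset.mem_filter.1 hx).2.2)
      exact ⟨X, hX, fun _ _ => ⟨h2, h3⟩⟩
    · exact ⟨∅, Finset.empty_subset _, fun h2 h3 => absurd ⟨h2, h3⟩ h⟩
  choose half hsub hhalf using hex
  set X : Finset (Sym2 V) → Finset (Sym2 V) := fun E => half (Collide (edgeGraph E) S φ) with hX
  have hXS : ∀ E, ∀ v ∈ S, ∀ y, s(v, y) ∉ X E := by
    intro E v hv y h
    exact (Finset.mem_filter.1 (hsub _ h)).2.1 v hv (by simp)
  have hprop : ∀ E, (collidingPairs (edgeGraph E) S φ).card ≤ 2 * (X E).card ∧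
      ∀ x ∈ X E, ∃ y, y ∉ X E ∧ Collide (edgeGraph E) S φ x y := fun E =>
    hhalf _ (fun x y h => h.symm) (fun x h => h.1 rfl)
  have hcongr : ∀ E E', E \ X E = E' \ X E →
      Collide (edgeGraph E') S φ = Collide (edgeGraph E) S φ := by
    intro E E' h
    refine (collide_edgeGraph_congr (fun v hv y => ?_) φ).symm
    have := Finset.ext_iff.1 h s(v, y)
    simpa [hXS E v hv y] using this
  have hcongr' : ∀ E, Collide (edgeGraph (E \ X E)) S φ = Collide (edgeGraph E) S φ := fun E =>
    hcongr E (E \ X E) (by ext a; simp)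
  refine (subsetExp_forced_le_pow h0 h1 _ X
    (fun Y T e => ∃ y, y ∉ Y ∧ Collide (edgeGraph T) S φ e y ∧ y ∈ T) ⌈m / 2⌉₊
    ?_ ?_ ?_ ?_).trans ?_
  · intro E _
    exact (hsub _).trans (Finset.filter_subset _ _)
  · rintro E _ ⟨-, h⟩
    have h2 : ((collidingPairs (edgeGraph E) S φ).card : ℝ) ≤ 2 * (X E).card := by
      exact_mod_cast (hprop E).1
    exact Nat.ceil_le.2 (by linarith)
  · rintro E hE ⟨hcons, -⟩ e he
    have hkey : ∀ y, Collide (edgeGraph E) S φ e y → (e ∈ E ↔ y ∈ E) := by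
      rintro y ⟨-, v, hv, v', hv', hs, hs', hm⟩
      have := hcons v hv v' hv' e y hs hs' hm
      rwa [mem_edgeSet_edgeGraph hE, mem_edgeSet_edgeGraph hE] at this
    simp only [hcongr']
    constructor
    · intro heE
      obtain ⟨y, hy, hc⟩ := (hprop E).2 e he
      exact ⟨y, hy, hc, Finset.mem_sdiff.2 ⟨(hkey y hc).1 heE, hy⟩⟩
    · rintro ⟨y, -, hc, hyE⟩
      exact (hkey y hc).2 (Finset.mem_sdiff.1 hyE).1
  · intro E _ E' _ h
    simp only [hX]
    rw [hcongr E E' h]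
  · have h2 : (1 - p) ^ ⌈m / 2⌉₊ ≤ Real.exp (-p) ^ ⌈m / 2⌉₊ :=
      pow_le_pow_left₀ (by linarith) (by have := Real.add_one_le_exp (-p); linarith) _
    refine h2.trans ?_
    rw [← Real.exp_nat_mul]
    refine Real.exp_le_exp.2 ?_
    have := Nat.le_ceil (m / 2)
    nlinarith

/-- Union bound over the lists of exceptions. -/
theorem collisionFailure_prob_le {p : ℝ} (h0 : 0 ≤ p) (h1 : p ≤ 1 / 2) (S : Finset V) {B : ℝ}
    (hB : 0 ≤ B) (hBn : (Fintype.card V : ℝ) ^ 3 * Real.exp (-(p * B / 2)) ≤ 1) :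
    subsetExp p (allPairs V) (fun E => ind (CollisionFailure (edgeGraph E) S B)) ≤
      2 * ((Fintype.card V : ℝ) ^ 3 * Real.exp (-(p * B / 2))) := by
  classical
  set t := Real.exp (-(p * B / 2)) with ht
  have hcard : Fintype.card (V × V × V) = Fintype.card V ^ 3 := by
    simp only [Fintype.card_prod]; ring
  calc _ ≤ subsetExp p (allPairs V) (fun E =>
        ∑ β ∈ (Finset.univ : Finset (Finset (V × V × V))).erase ∅,
          ind (Consistent (edgeGraph E) S (namingOf β) ∧
            B * β.card < (collidingPairs (edgeGraph E) S (namingOf β)).card)) := by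
        refine subsetExp_mono h0 (by linarith) fun E _ => ?_
        refine le_trans (ind_mono ?_) (ind_exists_le _ _)
        rintro ⟨φ, hcons, hlt⟩
        obtain ⟨β, hβ, hφ⟩ := exists_namingOf (edgeGraph E) S φ
        have hsub : (collidingPairs (edgeGraph E) S φ).card ≤
            (collidingPairs (edgeGraph E) S (namingOf β)).card := by
          refine Finset.card_le_card fun x hx => ?_
          obtain ⟨hx1, hx2, x', hx'⟩ := Finset.mem_filter.1 hx
          exact Finset.mem_filter.2 ⟨hx1, hx2, x', collide_congr hφ hx'⟩
        have hsub' : ((collidingPairs (edgeGraph E) S φ).card : ℝ) ≤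
            (collidingPairs (edgeGraph E) S (namingOf β)).card := by exact_mod_cast hsub
        rw [← hβ] at hlt
        refine ⟨β, Finset.mem_erase.2 ⟨?_, Finset.mem_univ _⟩, consistent_congr hφ hcons,
          hlt.trans_le hsub'⟩
        rintro rfl
        have hpos : (0 : ℝ) < (collidingPairs (edgeGraph E) S (namingOf ∅)).card := by
          refine lt_of_le_of_lt ?_ (hlt.trans_le hsub')
          positivity
        obtain ⟨x, hx⟩ := Finset.card_pos.1 (by exact_mod_cast hpos)
        obtain ⟨-, -, x', hne, v, -, v', -, -, -, hm⟩ := Finset.mem_filter.1 hx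
        have hid : ∀ v, namingOf (∅ : Finset (V × V × V)) v = id := by
          intro v; funext y; simp [namingOf]
        rw [hid, hid, Sym2.map_id] at hm
        exact hne hm.symm
    _ ≤ ∑ β ∈ (Finset.univ : Finset (Finset (V × V × V))).erase ∅, t ^ β.card := by
        rw [subsetExp_sum]
        refine Finset.sum_le_sum fun β _ => ?_
        refine (consistent_prob_le h0 h1 S _ _).trans (le_of_eq ?_)
        rw [ht, ← Real.exp_nat_mul]
        ring_nf
    _ = (1 + t) ^ (Fintype.card V ^ 3) - 1 := by
        rw [← hcard, ← sum_pow_card_eq,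
          ← Finset.add_sum_erase Finset.univ _ (Finset.mem_univ (∅ : Finset (V × V × V)))]
        simp
    _ ≤ 2 * ((Fintype.card V ^ 3 : ℕ) * t) :=
        one_add_pow_sub_one_le (Real.exp_pos _).le _ (by push_cast; exact hBn)
    _ = _ := by push_cast; ring

end Names

/-! ### Impure names -/

section Impure

theorem div_le_one_sub_pow {q : ℝ} (h0 : 0 ≤ q) (h1 : q ≤ 1) (k : ℕ) :
    q * k / (1 + q * k) ≤ 1 - (1 - q) ^ k := by
  have hk : 0 ≤ q * k := by positivity
  have h2 : (1 - q) ^ k ≤ Real.exp (-(q * k)) := by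
    rw [mul_comm, ← mul_neg, Real.exp_nat_mul]
    exact pow_le_pow_left₀ (by linarith) (by have := Real.add_one_le_exp (-q); linarith) _
  have h3 : Real.exp (-(q * k)) ≤ 1 / (1 + q * k) := by
    rw [Real.exp_neg, ← one_div]
    refine one_div_le_one_div_of_le (by linarith) ?_
    have := Real.add_one_le_exp (q * k)
    linarith
  have h4 : q * k / (1 + q * k) = 1 - 1 / (1 + q * k) := by
    field_simp; ring
  linarith

variable {V : Type*} [Fintype V]

open Classical in
/-- The vertices at which the name that the pair `x` has at `v` is given to another pair. -/
noncomputable def impure (G : SimpleGraph V) (φ : V → V → V) (v : V) (x : Sym2 V) : Finset V :=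
  Finset.univ.filter fun v' => ∃ x', x' ≠ x ∧ Sees G v' x' ∧ x'.map (φ v') = x.map (φ v)

theorem mem_impure {G : SimpleGraph V} {φ : V → V → V} {v : V} {x : Sym2 V} {v' : V} :
    v' ∈ impure G φ v x ↔ ∃ x', x' ≠ x ∧ Sees G v' x' ∧ x'.map (φ v') = x.map (φ v) := by
  simp [impure]

open Classical in
/-- The vertices that see `x` and give it a name used for other pairs at `m` or more vertices. -/
noncomputable def impureSeers (G : SimpleGraph V) (φ : V → V → V) (m : ℝ) (x : Sym2 V) :
    Finset V :=
  Finset.univ.filter fun v => Sees G v x ∧ m ≤ (impure G φ v x).card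

theorem mem_impureSeers {G : SimpleGraph V} {φ : V → V → V} {m : ℝ} {x : Sym2 V} {v : V} :
    v ∈ impureSeers G φ m x ↔ Sees G v x ∧ m ≤ (impure G φ v x).card := by
  simp [impureSeers]

theorem impure_comp {G : SimpleGraph V} {φ : V → V → V} {σ : V → V} (hσ : Function.Injective σ)
    (v : V) (x : Sym2 V) : impure G (fun v y => σ (φ v y)) v x = impure G φ v x := by
  ext v'
  rw [mem_impure, mem_impure]
  have hm : ∀ (v : V) (x : Sym2 V), x.map (fun y => σ (φ v y)) = (x.map (φ v)).map σ := by
    intro v x; rw [Sym2.map_map]; rfl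
  simp only [hm, (Sym2.map.injective hσ).eq_iff]

variable [DecidableEq V]

/-- An impurely named pair is likely to collide on a random set of vertices. The random set is the
union of two independent random sets, of which the first provides a vertex that names the pair
impurely, and the second provides a vertex that uses this name for another pair. -/
theorem le_collision_prob (G : SimpleGraph V) (φ : V → V → V) {q m : ℝ} (hq0 : 0 ≤ q)
    (hq1 : q ≤ 1 / 4) (hm : 4 ≤ m) (hqm : q * m ≤ 1) {x : Sym2 V}
    (hx : q * (impureSeers G φ m x).card ≤ 2) :
    q * m * (q * (impureSeers G φ m x).card) / 64 ≤
      subsetExp q Finset.univ (fun S₁ => subsetExp q Finset.univ (fun S₂ =>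
        ind (x ∈ collidingPairs G (S₁ ∪ S₂) φ))) := by
  classical
  set I := impureSeers G φ m x with hI
  set B : Finset V := x.toFinset with hB
  have hBc : B.card ≤ 2 := by
    rw [hB]; by_cases h : x.IsDiag
    · rw [Sym2.card_toFinset_of_isDiag _ h]; norm_num
    · rw [Sym2.card_toFinset_of_not_isDiag _ h]
  have hsq : 1 / 2 ≤ (1 - q) ^ B.card := by
    have : (1 - q) ^ 2 ≤ (1 - q) ^ B.card :=
      pow_le_pow_of_le_one (by linarith) (by linarith) hBc
    nlinarith
  have hq1' : q ≤ 1 := by linarith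
  have hqm0 : 0 ≤ q * m := by positivity
  have hsecond : ∀ S₁ : Finset V, Disjoint B S₁ ∧ ¬Disjoint I S₁ →
      q * m / 8 ≤ subsetExp q Finset.univ (fun S₂ =>
        ind (x ∈ collidingPairs G (S₁ ∪ S₂) φ)) := by
    rintro S₁ ⟨hB1, hI1⟩
    obtain ⟨v, hv, hvS⟩ := Finset.not_disjoint_iff.1 hI1
    obtain ⟨hsees, hmv⟩ := mem_impureSeers.1 hv
    set U := impure G φ v x \ B with hU
    have hUc : m / 2 ≤ U.card := by
      have h1 : (impure G φ v x).card ≤ U.card + B.card := by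
        rw [hU]; exact Finset.card_le_card_sdiff_add_card
      have h2 : ((impure G φ v x).card : ℝ) ≤ U.card + 2 := by
        have : (impure G φ v x).card ≤ U.card + 2 := by omega
        exact_mod_cast this
      linarith
    have h1 := subsetExp_avoid_meet q (Finset.subset_univ U) (Finset.subset_univ B)
      (Finset.sdiff_disjoint)
    have h2 := div_le_one_sub_pow hq0 hq1' U.card
    have h3 : q * m / 4 ≤ q * U.card / (1 + q * U.card) := by
      have hqU : q * m / 2 ≤ q * U.card := by nlinarith [mul_le_mul_of_nonneg_left hUc hq0]
      rw [le_div_iff₀ (by positivity)]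
      have : 0 ≤ q * U.card := by positivity
      nlinarith
    have h4 : q * m / 8 ≤ (1 - q) ^ B.card * (1 - (1 - q) ^ U.card) := by
      nlinarith [mul_le_mul_of_nonneg_right hsq (show 0 ≤ 1 - (1 - q) ^ U.card by linarith)]
    refine h4.trans (h1.symm.le.trans (subsetExp_mono hq0 hq1' fun S₂ _ => ind_mono ?_))
    rintro ⟨hB2, hU2⟩
    obtain ⟨v', hv', hvS'⟩ := Finset.not_disjoint_iff.1 hU2
    obtain ⟨x', hne, hs', hmap⟩ := mem_impure.1 (Finset.mem_sdiff.1 hv').1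
    refine Finset.mem_filter.2 ⟨mem_allPairs.2 hsees.1, fun w hw hwx => ?_, x', hne, v, ?_, v', ?_,
      hsees, hs', hmap.symm⟩
    · have hwB : w ∈ B := Sym2.mem_toFinset.2 hwx
      rcases Finset.mem_union.1 hw with h | h
      · exact Finset.disjoint_left.1 hB1 hwB h
      · exact Finset.disjoint_left.1 hB2 hwB h
    · exact_mod_cast Finset.mem_union_left _ hvS
    · exact_mod_cast Finset.mem_union_right _ hvS'
  have hIB : Disjoint I B := by
    refine Finset.disjoint_left.2 fun v hv hvB => ?_
    exact ((mem_impureSeers.1 hv).1.2 v (Sym2.mem_toFinset.1 hvB)).ne rfl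
  have h1 := subsetExp_avoid_meet q (Finset.subset_univ I) (Finset.subset_univ B) hIB
  have h2 := div_le_one_sub_pow hq0 hq1' I.card
  have h3 : q * I.card / 4 ≤ q * I.card / (1 + q * I.card) :=
    div_le_div_of_nonneg_left (by positivity) (by positivity) (by linarith)
  have hqI : 0 ≤ q * I.card := by positivity
  have h4 : q * I.card / 8 ≤ (1 - q) ^ B.card * (1 - (1 - q) ^ I.card) := by
    nlinarith [mul_le_mul_of_nonneg_right hsq (show 0 ≤ 1 - (1 - q) ^ I.card by linarith)]
  calc _ = q * m / 8 * (q * I.card / 8) := by ring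
    _ ≤ q * m / 8 * ((1 - q) ^ B.card * (1 - (1 - q) ^ I.card)) :=
        mul_le_mul_of_nonneg_left h4 (by linarith)
    _ = subsetExp q Finset.univ (fun S₁ => q * m / 8 * ind (Disjoint B S₁ ∧ ¬Disjoint I S₁)) := by
        rw [subsetExp_const_mul, h1]
    _ ≤ _ := by
        refine subsetExp_mono hq0 hq1' fun S₁ _ => ?_
        by_cases h : Disjoint B S₁ ∧ ¬Disjoint I S₁
        · rw [ind_true h, mul_one]; exact hsecond S₁ h
        · rw [ind_false h, mul_zero]
          exact subsetExp_nonneg hq0 hq1' fun S₂ _ => ind_nonneg _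

/-- The proportion of pairs of random sets on whose union a collision failure occurs. -/
noncomputable def failureRate (G : SimpleGraph V) (q B : ℝ) : ℝ :=
  subsetExp q Finset.univ fun S₁ => subsetExp q Finset.univ fun S₂ =>
    ind (CollisionFailure G (S₁ ∪ S₂) B)

theorem card_allPairs_le : ((allPairs V).card : ℝ) ≤ (Fintype.card V : ℝ) ^ 2 := by
  have h : (allPairs V).card ≤ Fintype.card (V × V) :=
    (Finset.card_le_univ _).trans
      (Fintype.card_le_of_surjective (fun q : V × V => s(q.1, q.2)) fun x => by
        induction x using Sym2.ind with
        | _ a b => exact ⟨(a, b), rfl⟩)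
  rw [Fintype.card_prod, ← sq] at h
  exact_mod_cast h

theorem sum_impureSeers_le_id (G : SimpleGraph V) (φ : V → V → V) {q m B : ℝ} (hq0 : 0 < q)
    (hq1 : q ≤ 1 / 4) (hm : 4 ≤ m) (hqm : q * m ≤ 1)
    (hG : ∀ v w, v ≠ w → q * ((nbr G v ∩ nbr G w).card : ℝ) ≤ 2) (hB : 0 ≤ B)
    (hcons : Consistent G Set.univ φ)
    (hrate : (Fintype.card V : ℝ) ^ 2 * failureRate G q B ≤ q * B) :
    ∑ x ∈ allPairs V, ((impureSeers G φ m x).card : ℝ) ≤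
      192 * B / (q * m) * (badDarts G φ id).card := by
  classical
  have hq0' := hq0.le
  have hq1' : q ≤ 1 := by linarith
  have hlow : q * m * (q * ∑ x ∈ allPairs V, ((impureSeers G φ m x).card : ℝ)) / 64 ≤
      subsetExp q Finset.univ (fun S₁ => subsetExp q Finset.univ (fun S₂ =>
        ((collidingPairs G (S₁ ∪ S₂) φ).card : ℝ))) := by
    have hle : ∀ x ∈ allPairs V, q * m * (q * (impureSeers G φ m x).card) / 64 ≤
        subsetExp q Finset.univ (fun S₁ => subsetExp q Finset.univ (fun S₂ =>
          ind (x ∈ collidingPairs G (S₁ ∪ S₂) φ))) := by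
      intro x hx
      refine le_collision_prob G φ hq0' hq1 hm hqm ?_
      induction x using Sym2.ind with
      | _ a b =>
        have hab : a ≠ b := by simpa using hx
        refine le_trans (mul_le_mul_of_nonneg_left ?_ hq0') (hG a b hab)
        exact_mod_cast Finset.card_le_card fun v hv => by
          have := (mem_impureSeers.1 hv).1.2
          rw [Finset.mem_inter, mem_nbr, mem_nbr]
          exact ⟨(this a (by simp)).symm, (this b (by simp)).symm⟩
    have hsum := Finset.sum_le_sum hle
    rw [← subsetExp_sum] at hsum
    simp_rw [← subsetExp_sum] at hsum
    refine le_trans (le_of_eq ?_) (hsum.trans (le_of_eq ?_))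
    · rw [← Finset.sum_div, ← Finset.mul_sum, ← Finset.mul_sum]
    · refine subsetExp_congr fun S₁ _ => subsetExp_congr fun S₂ _ => ?_
      rw [sum_ind]
      congr 1
      congr 1
      ext x
      rw [Finset.mem_filter]
      exact ⟨fun h => h.2, fun h => ⟨(Finset.mem_filter.1 h).1, h⟩⟩
  have hup : subsetExp q Finset.univ (fun S₁ => subsetExp q Finset.univ (fun S₂ =>
        ((collidingPairs G (S₁ ∪ S₂) φ).card : ℝ))) ≤
      B * (2 * q * (badDarts G φ id).card) + (Fintype.card V : ℝ) ^ 2 * failureRate G q B := by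
    have hpt : ∀ S₁ S₂ : Finset V, ((collidingPairs G (S₁ ∪ S₂) φ).card : ℝ) ≤
        B * ∑ e ∈ badDarts G φ id, (ind (e.1 ∈ S₁) + ind (e.1 ∈ S₂)) +
          (Fintype.card V : ℝ) ^ 2 * ind (CollisionFailure G (S₁ ∪ S₂) B) := by
      intro S₁ S₂
      by_cases hf : CollisionFailure G (S₁ ∪ S₂) B
      · rw [ind_true hf, mul_one]
        have h1 : ((collidingPairs G (S₁ ∪ S₂) φ).card : ℝ) ≤ (Fintype.card V : ℝ) ^ 2 := by
          refine le_trans ?_ (card_allPairs_le (V := V))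
          exact_mod_cast Finset.card_le_card (Finset.filter_subset _ _)
        have h2 : 0 ≤ B * ∑ e ∈ badDarts G φ id, (ind (e.1 ∈ S₁) + ind (e.1 ∈ S₂)) :=
          mul_nonneg hB (Finset.sum_nonneg fun e _ => add_nonneg (ind_nonneg _) (ind_nonneg _))
        linarith
      · rw [ind_false hf, mul_zero, add_zero]
        have h1 : ((collidingPairs G (S₁ ∪ S₂) φ).card : ℝ) ≤
            B * (((badDarts G φ id).filter fun e => e.1 ∈ S₁ ∪ S₂).card : ℝ) := by
          by_contra hcon
          refine hf ⟨φ, ?_, not_le.1 hcon⟩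
          intro v _ v' _
          exact hcons v (Set.mem_univ _) v' (Set.mem_univ _)
        refine h1.trans (mul_le_mul_of_nonneg_left ?_ hB)
        rw [← sum_ind]
        refine Finset.sum_le_sum fun e _ => ?_
        simp only [Finset.mem_union]
        exact ind_or_le _ _
    refine (subsetExp_mono hq0' hq1' fun S₁ _ => subsetExp_mono hq0' hq1' fun S₂ _ =>
      hpt S₁ S₂).trans (le_of_eq ?_)
    have hin : ∀ S₁ : Finset V, subsetExp q Finset.univ (fun S₂ =>
        B * ∑ e ∈ badDarts G φ id, (ind (e.1 ∈ S₁) + ind (e.1 ∈ S₂)) +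
          (Fintype.card V : ℝ) ^ 2 * ind (CollisionFailure G (S₁ ∪ S₂) B)) =
        B * ∑ e ∈ badDarts G φ id, (ind (e.1 ∈ S₁) + q) +
          (Fintype.card V : ℝ) ^ 2 * subsetExp q Finset.univ (fun S₂ =>
            ind (CollisionFailure G (S₁ ∪ S₂) B)) := by
      intro S₁
      rw [subsetExp_add, subsetExp_const_mul, subsetExp_const_mul, subsetExp_sum]
      simp only [subsetExp_add, subsetExp_const, subsetExp_mem q (Finset.mem_univ _)]
    simp only [hin]
    rw [subsetExp_add, subsetExp_const_mul, subsetExp_const_mul, subsetExp_sum]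
    simp only [subsetExp_add, subsetExp_const, subsetExp_mem q (Finset.mem_univ _)]
    rw [Finset.sum_const, nsmul_eq_mul, failureRate]
    ring
  set M : ℝ := ((badDarts G φ id).card : ℝ) with hM
  set T : ℝ := ∑ x ∈ allPairs V, ((impureSeers G φ m x).card : ℝ) with hT
  have hqm0 : 0 < q * m := by positivity
  by_cases hM0 : (badDarts G φ id).card = 0
  · -- Without bad darts every pair has its own name, and nothing is impure.
    have hid : ∀ v y, G.Adj v y → φ v y = y := by
      intro v y hvy
      by_contra hne
      have : (v, y) ∈ badDarts G φ id := mem_badDarts.2 ⟨hvy, hne⟩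
      rw [Finset.card_eq_zero.1 hM0] at this
      simp at this
    have hempty : ∀ v x, Sees G v x → impure G φ v x = ∅ := by
      intro v x hx
      refine Finset.eq_empty_of_forall_notMem fun v' hv' => ?_
      obtain ⟨x', hne, hs', hmap⟩ := mem_impure.1 hv'
      rw [Sym2.map_congr (g := id) fun y hy => hid v' y (hs'.2 y hy),
        Sym2.map_congr (g := id) fun y hy => hid v y (hx.2 y hy), Sym2.map_id] at hmap
      exact hne hmap
    have hz : T = 0 := by
      refine Finset.sum_eq_zero fun x _ => ?_
      norm_cast
      refine Finset.card_eq_zero.2 (Finset.eq_empty_of_forall_notMem fun v hv => ?_)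
      obtain ⟨hs, hmv⟩ := mem_impureSeers.1 hv
      rw [hempty v x hs] at hmv
      simp at hmv
      linarith
    rw [hz, hM, hM0]; simp
  · have hM1 : 1 ≤ M := by
      rw [hM]; exact_mod_cast Nat.one_le_iff_ne_zero.2 hM0
    have hall := hlow.trans hup
    rw [div_mul_eq_mul_div, le_div_iff₀ hqm0]
    have h1 : q * (T * (q * m)) ≤ q * (192 * B * M) := by
      nlinarith [mul_le_mul_of_nonneg_left hM1 (mul_nonneg hq0' hB)]
    exact le_of_mul_le_mul_left h1 hq0

/-- Few pairs are named impurely, compared to the number of darts that are bad with respect to an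
arbitrary permutation `ψ`. -/
theorem sum_impureSeers_le (G : SimpleGraph V) (φ : V → V → V) {q m B : ℝ} (hq0 : 0 < q)
    (hq1 : q ≤ 1 / 4) (hm : 4 ≤ m) (hqm : q * m ≤ 1)
    (hG : ∀ v w, v ≠ w → q * ((nbr G v ∩ nbr G w).card : ℝ) ≤ 2) (hB : 0 ≤ B)
    (hcons : Consistent G Set.univ φ)
    (hrate : (Fintype.card V : ℝ) ^ 2 * failureRate G q B ≤ q * B) (ψ : Equiv.Perm V) :
    ∑ x ∈ allPairs V, ((impureSeers G φ m x).card : ℝ) ≤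
      192 * B / (q * m) * (badDarts G φ ψ).card := by
  have h := sum_impureSeers_le_id G (fun v y => ψ.symm (φ v y)) hq0 hq1 hm hqm hG hB
    (consistent_comp ψ.symm.injective hcons) hrate
  have h1 : ∀ x, impureSeers G (fun v y => ψ.symm (φ v y)) m x = impureSeers G φ m x := by
    intro x; ext v
    rw [mem_impureSeers, mem_impureSeers, impure_comp ψ.symm.injective]
  have h2 : badDarts G (fun v y => ψ.symm (φ v y)) id = badDarts G φ ψ := by
    ext e
    rw [mem_badDarts, mem_badDarts]
    simp [Equiv.symm_apply_eq]
  simp only [h1, h2] at h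
  exact h

/-- For a random graph, collision failures occur on few random sets. -/
theorem failureRate_tail {p q B : ℝ} (h0 : 0 ≤ p) (h1 : p ≤ 1 / 2) (hq0 : 0 ≤ q) (hq1 : q ≤ 1)
    (hB : 0 ≤ B) (hBn : (Fintype.card V : ℝ) ^ 3 * Real.exp (-(p * B / 2)) ≤ 1) {c : ℝ}
    (hc : 0 < c) :
    subsetExp p (allPairs V) (fun E => ind (c < failureRate (edgeGraph E) q B)) ≤
      2 * ((Fintype.card V : ℝ) ^ 3 * Real.exp (-(p * B / 2))) / c := by
  refine (subsetExp_markov h0 (by linarith) _ _ (fun E _ => ?_) hc).trans ?_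
  · exact subsetExp_nonneg hq0 hq1 fun _ _ => subsetExp_nonneg hq0 hq1 fun _ _ => ind_nonneg _
  · refine div_le_div_of_nonneg_right ?_ hc.le
    unfold failureRate
    rw [subsetExp_comm]
    conv_rhs => rw [← subsetExp_const q (Finset.univ : Finset V)
      (2 * ((Fintype.card V : ℝ) ^ 3 * Real.exp (-(p * B / 2))))]
    refine subsetExp_mono hq0 hq1 fun S₁ _ => ?_
    rw [subsetExp_comm]
    conv_rhs => rw [← subsetExp_const q (Finset.univ : Finset V)
      (2 * ((Fintype.card V : ℝ) ^ 3 * Real.exp (-(p * B / 2))))]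
    exact subsetExp_mono hq0 hq1 fun S₂ _ => collisionFailure_prob_le h0 h1 _ hB hBn

end Impure

/-! ### Counting names of pairs -/

section NamingSystem

variable {V : Type*} [Fintype V]

open Classical in
/-- The vertices that see the pair `x`. -/
noncomputable def seers (G : SimpleGraph V) (x : Sym2 V) : Finset V :=
  Finset.univ.filter fun v => Sees G v x

open Classical in
/-- The vertices that see the pair `x` and give it the name `h`. -/
noncomputable def namers (G : SimpleGraph V) (φ : V → V → V) (x h : Sym2 V) : Finset V :=
  Finset.univ.filter fun v => Sees G v x ∧ x.map (φ v) = h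

open Classical in
/-- The vertices that give the name `h` to some pair. -/
noncomputable def users (G : SimpleGraph V) (φ : V → V → V) (h : Sym2 V) : Finset V :=
  Finset.univ.filter fun v => ∃ x, Sees G v x ∧ x.map (φ v) = h

open Classical in
/-- The neighbors of `y` that give `y` the name `a`. -/
noncomputable def voters (G : SimpleGraph V) (φ : V → V → V) (y a : V) : Finset V :=
  Finset.univ.filter fun v => G.Adj v y ∧ φ v y = a

variable {G : SimpleGraph V} {φ : V → V → V}

theorem mem_seers {x : Sym2 V} {v : V} : v ∈ seers G x ↔ Sees G v x := by simp [seers]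

theorem mem_namers {x h : Sym2 V} {v : V} :
    v ∈ namers G φ x h ↔ Sees G v x ∧ x.map (φ v) = h := by simp [namers]

theorem mem_users {h : Sym2 V} {v : V} :
    v ∈ users G φ h ↔ ∃ x, Sees G v x ∧ x.map (φ v) = h := by simp [users]

theorem mem_voters {y a v : V} : v ∈ voters G φ y a ↔ G.Adj v y ∧ φ v y = a := by simp [voters]

theorem namers_subset_seers (x h : Sym2 V) : namers G φ x h ⊆ seers G x := fun _ hv =>
  mem_seers.2 (mem_namers.1 hv).1

variable [DecidableEq V]

/-- The properties of a graph `G` and a system of namings `φ` of its neighborhoods from which it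
follows that the names are global: `D` and `d` are the typical degree and codegree, and the last
field bounds the number of impure names in terms of the number of bad darts. The numerical
constants leave ample room in the counting arguments. -/
structure NamingSystem (G : SimpleGraph V) (φ : V → V → V) (p D d : ℝ) : Prop where
  p_pos : 0 < p
  p_le : p ≤ 1
  D_eq : D = Fintype.card V * p
  d_eq : d = Fintype.card V * p ^ 2
  d_large : 1000 ≤ d
  typical : Typical G p (1 / 10 ^ 9) (1 / 10 ^ 5 * d)
  inj : ∀ v y z, G.Adj v y → G.Adj v z → φ v y = φ v z → y = z
  name_le : ∀ (a : V) (T : Finset V), (∀ v ∈ T, ∃ y, G.Adj v y ∧ φ v y = a) →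
    (T.card : ℝ) ≤ (1 + 1 / 10 ^ 9) * D
  impure_le : ∀ ψ : Equiv.Perm V,
    ∑ x ∈ allPairs V, ((impureSeers G φ (1 / 10 ^ 9 * d) x).card : ℝ) ≤
      1 / 10 ^ 9 * D * (badDarts G φ ψ).card

variable {p D d : ℝ}

theorem seers_mk {y z : V} (h : y ≠ z) : seers G s(y, z) = nbr G y ∩ nbr G z := by
  ext v
  rw [mem_seers, sees_mk, Finset.mem_inter, mem_nbr, mem_nbr, G.adj_comm y, G.adj_comm z]
  tauto

theorem users_subset (v : V) (x : Sym2 V) :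
    users G φ (x.map (φ v)) ⊆ namers G φ x (x.map (φ v)) ∪ impure G φ v x := by
  intro v' hv'
  obtain ⟨x', hs, hm⟩ := mem_users.1 hv'
  rw [Finset.mem_union, mem_namers, mem_impure]
  by_cases h : x' = x
  · subst h; exact Or.inl ⟨hs, hm⟩
  · exact Or.inr ⟨x', h, hs, hm⟩

theorem card_users_le (v : V) (x : Sym2 V) :
    ((users G φ (x.map (φ v))).card : ℝ) ≤
      (namers G φ x (x.map (φ v))).card + (impure G φ v x).card := by
  exact_mod_cast (Finset.card_le_card (users_subset v x)).trans (Finset.card_union_le _ _)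

theorem sum_offDiag_eq {R : Type*} [CommSemiring R] (f : Sym2 V → R) :
    ∑ q ∈ (Finset.univ : Finset V).offDiag, f s(q.1, q.2) = 2 * ∑ x ∈ allPairs V, f x := by
  rw [← Finset.sum_fiberwise_of_maps_to (t := allPairs V) (g := fun q : V × V => s(q.1, q.2)),
    Finset.mul_sum]
  · refine Finset.sum_congr rfl fun x hx => ?_
    induction x using Sym2.ind with
    | _ a b =>
      have hab : a ≠ b := by simpa using hx
      have : ((Finset.univ : Finset V).offDiag.filter fun q => s(q.1, q.2) = s(a, b)) =
          {(a, b), (b, a)} := by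
        ext ⟨c, e⟩
        simp only [Finset.mem_filter, Finset.mem_offDiag, Finset.mem_univ, true_and, Sym2.eq_iff,
          Finset.mem_insert, Finset.mem_singleton, Prod.mk.injEq]
        constructor
        · exact fun h => h.2
        · rintro (⟨rfl, rfl⟩ | ⟨rfl, rfl⟩)
          · exact ⟨hab, Or.inl ⟨rfl, rfl⟩⟩
          · exact ⟨hab.symm, Or.inr ⟨rfl, rfl⟩⟩
      rw [this, Finset.sum_pair (by simp [hab]), Sym2.eq_swap (a := b), two_mul]
  · intro q hq
    simpa using hq

theorem card_offDiag_filter (P : Sym2 V → Prop) [DecidablePred P] :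
    ((Finset.univ : Finset V).offDiag.filter fun q => P s(q.1, q.2)).card =
      2 * ((allPairs V).filter P).card := by
  have := sum_offDiag_eq (V := V) (fun x => if P x then 1 else 0)
  rw [Finset.card_filter, Finset.card_filter]
  exact this

namespace NamingSystem

theorem n_pos (h : NamingSystem G φ p D d) : (0 : ℝ) < Fintype.card V := by
  have := h.d_large
  rw [h.d_eq] at this
  by_contra hc
  nlinarith [sq_nonneg p]

theorem d_eq_mul (h : NamingSystem G φ p D d) : d = D * p := by rw [h.d_eq, h.D_eq]; ring

theorem D_sq (h : NamingSystem G φ p D d) : D * D = Fintype.card V * d := by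
  rw [h.d_eq, h.D_eq]; ring

theorem d_le_D (h : NamingSystem G φ p D d) : d ≤ D := by
  have := h.n_pos
  have h1 := h.p_pos
  have h2 := h.p_le
  rw [h.d_eq, h.D_eq]
  nlinarith [mul_pos this h1]

theorem d_pos (h : NamingSystem G φ p D d) : 0 < d := by linarith [h.d_large]

theorem D_pos (h : NamingSystem G φ p D d) : 0 < D := h.d_pos.trans_le h.d_le_D

theorem deg_le (h : NamingSystem G φ p D d) (v : V) :
    ((nbr G v).card : ℝ) ≤ (1 + 1 / 10 ^ 9) * D := by
  rw [h.D_eq]; exact h.typical.deg_le v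

theorem le_deg (h : NamingSystem G φ p D d) (v : V) :
    (1 - 1 / 10 ^ 9) * D ≤ (nbr G v).card := by
  rw [h.D_eq]; exact h.typical.le_deg v

theorem card_seers_le (h : NamingSystem G φ p D d) {x : Sym2 V} (hx : ¬x.IsDiag) :
    ((seers G x).card : ℝ) ≤ (1 + 1 / 10 ^ 9) * d := by
  induction x using Sym2.ind with
  | _ a b =>
    have hab : a ≠ b := by simpa using hx
    rw [seers_mk hab, h.d_eq]
    exact h.typical.codeg_le a b hab

theorem le_card_seers (h : NamingSystem G φ p D d) {x : Sym2 V} (hx : ¬x.IsDiag) :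
    (1 - 1 / 10 ^ 9) * d ≤ (seers G x).card := by
  induction x using Sym2.ind with
  | _ a b =>
    have hab : a ≠ b := by simpa using hx
    rw [seers_mk hab, h.d_eq]
    exact h.typical.le_codeg a b hab

theorem map_inj (h : NamingSystem G φ p D d) {v : V} {x x' : Sym2 V} (hx : Sees G v x)
    (hx' : Sees G v x') (he : x.map (φ v) = x'.map (φ v)) : x = x' := by
  induction x using Sym2.ind with
  | _ a b =>
    induction x' using Sym2.ind with
    | _ a' b' =>
      rw [sees_mk] at hx hx'
      rw [Sym2.map_mk, Sym2.map_mk, Sym2.eq_iff] at he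
      rw [Sym2.eq_iff]
      rcases he with ⟨h1, h2⟩ | ⟨h1, h2⟩
      · exact Or.inl ⟨h.inj v _ _ hx.2.1 hx'.2.1 h1, h.inj v _ _ hx.2.2 hx'.2.2 h2⟩
      · exact Or.inr ⟨h.inj v _ _ hx.2.1 hx'.2.2 h1, h.inj v _ _ hx.2.2 hx'.2.1 h2⟩

theorem map_not_isDiag (h : NamingSystem G φ p D d) {v : V} {x : Sym2 V} (hx : Sees G v x) :
    ¬(x.map (φ v)).IsDiag := by
  induction x using Sym2.ind with
  | _ a b =>
    rw [sees_mk] at hx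
    rw [Sym2.map_mk, Sym2.mk_isDiag_iff]
    exact fun he => hx.1 (h.inj v _ _ hx.2.1 hx.2.2 he)

/-- If every name in `𝓗` has about `d` users or fewer, and the names of the pairs in the family
`F` exhaust the users of the names in `𝓗` almost completely, then names with few users are rare
in `F`. -/
theorem few_small_names (h : NamingSystem G φ p D d) (F : Sym2 V → Finset V)
    (hF : ∀ x, ∀ v ∈ F x, Sees G v x) (𝓗 : Finset (Sym2 V))
    (hF𝓗 : ∀ x, ∀ v ∈ F x, x.map (φ v) ∈ 𝓗)
    (h𝓗 : ∀ g ∈ 𝓗, ((users G φ g).card : ℝ) ≤ (1 + 2 / 10 ^ 9) * d) {α : ℝ} (hα0 : 0 ≤ α) :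
    (1 + 2 / 10 ^ 9 - α) * ∑ x ∈ allPairs V,
      (((F x).filter fun v => ((users G φ (x.map (φ v))).card : ℝ) ≤ α * d).card : ℝ) ≤
      α * ((1 + 2 / 10 ^ 9) * d * 𝓗.card - ∑ x ∈ allPairs V, ((F x).card : ℝ)) := by
  classical
  set E : Finset (Σ _ : Sym2 V, V) := (allPairs V).sigma F with hE
  set nm : (Σ _ : Sym2 V, V) → Sym2 V := fun e => e.1.map (φ e.2) with hnm
  have hmaps : ∀ e ∈ E, nm e ∈ 𝓗 := fun e he => hF𝓗 e.1 e.2 (Finset.mem_sigma.1 he).2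
  have hfib : ∀ g, (E.filter fun e => nm e = g).card ≤ (users G φ g).card := by
    intro g
    refine Finset.card_le_card_of_injOn (fun e => e.2) ?_ ?_
    · intro e he
      obtain ⟨he1, he2⟩ := Finset.mem_filter.1 he
      exact mem_users.2 ⟨e.1, hF e.1 e.2 (Finset.mem_sigma.1 he1).2, he2⟩
    · rintro ⟨x, v⟩ he ⟨x', v'⟩ he' hvv
      obtain ⟨he1, he2⟩ := Finset.mem_filter.1 he
      obtain ⟨he1', he2'⟩ := Finset.mem_filter.1 he'
      simp only at hvv
      subst hvv
      have := h.map_inj (hF x v (Finset.mem_sigma.1 he1).2)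
        (hF x' v (Finset.mem_sigma.1 he1').2) (he2.trans he2'.symm)
      rw [this]
  have hcardE : ∑ x ∈ allPairs V, ((F x).card : ℝ) =
      ∑ g ∈ 𝓗, ((E.filter fun e => nm e = g).card : ℝ) := by
    have h1 : E.card = ∑ g ∈ 𝓗, (E.filter fun e => nm e = g).card :=
      Finset.card_eq_sum_card_fiberwise hmaps
    rw [hE, Finset.card_sigma] at h1
    exact_mod_cast h1
  have hsmall : ∑ x ∈ allPairs V,
      (((F x).filter fun v => ((users G φ (x.map (φ v))).card : ℝ) ≤ α * d).card : ℝ) =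
      ∑ g ∈ 𝓗, if ((users G φ g).card : ℝ) ≤ α * d then
        ((E.filter fun e => nm e = g).card : ℝ) else 0 := by
    set E' : Finset (Σ _ : Sym2 V, V) := (allPairs V).sigma fun x =>
      (F x).filter fun v => ((users G φ (x.map (φ v))).card : ℝ) ≤ α * d with hE'
    have h1 : E'.card = ∑ g ∈ 𝓗, (E'.filter fun e => nm e = g).card :=
      Finset.card_eq_sum_card_fiberwise fun e he =>
        hF𝓗 e.1 e.2 (Finset.mem_filter.1 (Finset.mem_sigma.1 he).2).1
    have h2 : ∀ g ∈ 𝓗, ((E'.filter fun e => nm e = g).card : ℝ) =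
        if ((users G φ g).card : ℝ) ≤ α * d then
          ((E.filter fun e => nm e = g).card : ℝ) else 0 := by
      intro g _
      split_ifs with hg
      · congr 2
        ext e
        simp only [hE, hE', Finset.mem_filter, Finset.mem_sigma]
        constructor
        · rintro ⟨⟨h1, h2, -⟩, h3⟩; exact ⟨⟨h1, h2⟩, h3⟩
        · rintro ⟨⟨h1, h2⟩, h3⟩
          refine ⟨⟨h1, h2, ?_⟩, h3⟩
          have h4 : e.1.map (φ e.2) = g := h3
          rw [h4]; exact hg
      · rw [Nat.cast_eq_zero, Finset.card_eq_zero]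
        refine Finset.eq_empty_of_forall_notMem fun e he => hg ?_
        obtain ⟨he1, he2⟩ := Finset.mem_filter.1 he
        have h4 : e.1.map (φ e.2) = g := he2
        rw [← h4]
        exact (Finset.mem_filter.1 (Finset.mem_sigma.1 he1).2).2
    have h1' : (E'.card : ℝ) = ∑ g ∈ 𝓗, ((E'.filter fun e => nm e = g).card : ℝ) := by
      exact_mod_cast h1
    rw [← Finset.sum_congr rfl h2, ← h1', hE', Finset.card_sigma, Nat.cast_sum]
  have hd := h.d_pos
  rw [hcardE, hsmall, Finset.mul_sum]
  have hcon : (1 + 2 / 10 ^ 9) * d * (𝓗.card : ℝ) = ∑ g ∈ 𝓗, (1 + 2 / 10 ^ 9) * d := by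
    rw [Finset.sum_const, nsmul_eq_mul]; ring
  rw [hcon, ← Finset.sum_sub_distrib, Finset.mul_sum]
  refine Finset.sum_le_sum fun g hg => ?_
  have h1 : ((E.filter fun e => nm e = g).card : ℝ) ≤ (users G φ g).card := by
    exact_mod_cast hfib g
  have h2 := h𝓗 g hg
  split_ifs with hs
  · nlinarith
  · rw [mul_zero]
    exact mul_nonneg hα0 (by linarith)

theorem card_users_le_of_pure (h : NamingSystem G φ p D d) {v : V} {x : Sym2 V}
    (hs : Sees G v x) (hv : v ∉ impureSeers G φ (1 / 10 ^ 9 * d) x) :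
    ((users G φ (x.map (φ v))).card : ℝ) ≤ (1 + 2 / 10 ^ 9) * d := by
  have h1 := card_users_le (G := G) (φ := φ) v x
  have h2 : ((namers G φ x (x.map (φ v))).card : ℝ) ≤ (1 + 1 / 10 ^ 9) * d := by
    refine le_trans ?_ (h.card_seers_le hs.1)
    exact_mod_cast Finset.card_le_card (namers_subset_seers _ _)
  have h3 : ((impure G φ v x).card : ℝ) < 1 / 10 ^ 9 * d := by
    by_contra hc
    exact hv (mem_impureSeers.2 ⟨hs, not_lt.1 hc⟩)
  linarith

end NamingSystem

end NamingSystem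

/-! ### An approximate global naming -/

section ApproximateNaming

variable {V : Type*} [Fintype V] [DecidableEq V] {G : SimpleGraph V} {φ : V → V → V} {p D d : ℝ}

open Classical in
/-- The vertices at which the name of `x` is not the name of `x` at a clear majority of the vertices
that see `x`. -/
noncomputable def minoritySeers (G : SimpleGraph V) (φ : V → V → V) (d : ℝ) (x : Sym2 V) :
    Finset V :=
  (seers G x).filter fun v => ((namers G φ x (x.map (φ v))).card : ℝ) ≤ 0.55 * d

open Classical in
/-- The pairs of neighbors of `y` that give `y` different names. -/
noncomputable def disagreements (G : SimpleGraph V) (φ : V → V → V) (y : V) : Finset (V × V) :=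
  (nbr G y ×ˢ nbr G y).filter fun q => φ q.1 y ≠ φ q.2 y

namespace NamingSystem

theorem card_badDarts_le_all (h : NamingSystem G φ p D d) (ψ : V → V) :
    ((badDarts G φ ψ).card : ℝ) ≤ (1 + 1 / 10 ^ 9) * (Fintype.card V * D) := by
  have h1 : badDarts G φ ψ ⊆ Finset.univ.biUnion fun v => (nbr G v).image fun y => (v, y) := by
    rintro ⟨v, y⟩ hq
    have := (mem_badDarts.1 hq).1
    simp only [Finset.mem_biUnion, Finset.mem_image, mem_nbr]
    exact ⟨v, Finset.mem_univ _, y, this, rfl⟩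
  have h2 : (badDarts G φ ψ).card ≤ ∑ v : V, (nbr G v).card :=
    (Finset.card_le_card h1).trans (Finset.card_biUnion_le.trans
      (Finset.sum_le_sum fun v _ => Finset.card_image_le))
  calc ((badDarts G φ ψ).card : ℝ) ≤ ∑ v : V, ((nbr G v).card : ℝ) := by exact_mod_cast h2
    _ ≤ ∑ _v : V, (1 + 1 / 10 ^ 9) * D := Finset.sum_le_sum fun v _ => h.deg_le v
    _ = _ := by rw [Finset.sum_const, nsmul_eq_mul, Finset.card_univ]; ring

/-- The names with pure use have at most about `d` users each, and there are no more names than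
pairs; as the pairs have about `d` seers each, nearly all names have nearly `d` users. -/
theorem sum_minoritySeers_le (h : NamingSystem G φ p D d) :
    ∑ x ∈ allPairs V, ((minoritySeers G φ d x).card : ℝ) ≤
      1 / 10 ^ 8 * (d * (Fintype.card V : ℝ) ^ 2) := by
  classical
  set n : ℝ := (Fintype.card V : ℝ) with hn
  have hd := h.d_pos
  set N : ℝ := ((allPairs V).card : ℝ) with hN
  have hNn : N ≤ n ^ 2 := card_allPairs_le
  set I : ℝ := ∑ x ∈ allPairs V, ((impureSeers G φ (1 / 10 ^ 9 * d) x).card : ℝ) with hI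
  have hIle : I ≤ 2 / 10 ^ 9 * (d * n ^ 2) := by
    have h1 := h.impure_le (Equiv.refl V)
    have h2 := h.card_badDarts_le_all (Equiv.refl V)
    have hDD := h.D_sq
    have hD := h.D_pos
    have h3 : 1 / 10 ^ 9 * D * ((badDarts G φ (Equiv.refl V)).card : ℝ) ≤
        1 / 10 ^ 9 * D * ((1 + 1 / 10 ^ 9) * (n * D)) :=
      mul_le_mul_of_nonneg_left h2 (by positivity)
    have h4 : 1 / 10 ^ 9 * D * ((1 + 1 / 10 ^ 9) * (n * D)) =
        1 / 10 ^ 9 * (1 + 1 / 10 ^ 9) * (d * n ^ 2) := by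
      calc _ = 1 / 10 ^ 9 * (1 + 1 / 10 ^ 9) * (n * (D * D)) := by ring
        _ = _ := by rw [hDD]; ring
    have h5 : 0 ≤ d * n ^ 2 := by positivity
    nlinarith
  set F : Sym2 V → Finset V := fun x =>
    if x ∈ allPairs V then seers G x \ impureSeers G φ (1 / 10 ^ 9 * d) x else ∅ with hF
  have hFm : ∀ x, ∀ v ∈ F x, Sees G v x ∧ v ∉ impureSeers G φ (1 / 10 ^ 9 * d) x := by
    intro x v hv
    simp only [hF] at hv
    split_ifs at hv with hx
    · exact ⟨mem_seers.1 (Finset.mem_sdiff.1 hv).1, (Finset.mem_sdiff.1 hv).2⟩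
    · simp at hv
  set 𝓗 := (allPairs V).filter fun g => ((users G φ g).card : ℝ) ≤ (1 + 2 / 10 ^ 9) * d with h𝓗
  have hsmall := h.few_small_names F (fun x v hv => (hFm x v hv).1) 𝓗
    (fun x v hv => Finset.mem_filter.2 ⟨mem_allPairs.2 (h.map_not_isDiag (hFm x v hv).1),
      h.card_users_le_of_pure (hFm x v hv).1 (hFm x v hv).2⟩)
    (fun g hg => (Finset.mem_filter.1 hg).2) (α := 0.6) (by norm_num)
  have h𝓗c : (𝓗.card : ℝ) ≤ N := by
    exact Nat.cast_le.2 (Finset.card_le_card (Finset.filter_subset _ _))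
  have hFsum : (1 - 1 / 10 ^ 9) * d * N - I ≤ ∑ x ∈ allPairs V, ((F x).card : ℝ) := by
    have h1 : (1 - 1 / 10 ^ 9) * d * N = ∑ x ∈ allPairs V, (1 - 1 / 10 ^ 9) * d := by
      rw [Finset.sum_const, nsmul_eq_mul]; ring
    rw [h1, hI, ← Finset.sum_sub_distrib]
    refine Finset.sum_le_sum fun x hx => ?_
    have h2 := h.le_card_seers (mem_allPairs.1 hx)
    have h3 : (seers G x).card ≤ (F x).card + (impureSeers G φ (1 / 10 ^ 9 * d) x).card := by
      simp only [hF, if_pos hx]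
      exact Finset.card_le_card_sdiff_add_card
    have h4 : ((seers G x).card : ℝ) ≤
        (F x).card + (impureSeers G φ (1 / 10 ^ 9 * d) x).card := by exact_mod_cast h3
    linarith
  have hmin : ∑ x ∈ allPairs V, ((minoritySeers G φ d x).card : ℝ) ≤ I + ∑ x ∈ allPairs V,
      (((F x).filter fun v => ((users G φ (x.map (φ v))).card : ℝ) ≤ 0.6 * d).card : ℝ) := by
    rw [hI, ← Finset.sum_add_distrib]
    refine Finset.sum_le_sum fun x hx => ?_
    rw [← Nat.cast_add, Nat.cast_le]
    refine le_trans (Finset.card_le_card ?_) (Finset.card_union_le _ _)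
    intro v hv
    obtain ⟨hv1, hv2⟩ := Finset.mem_filter.1 hv
    rw [Finset.mem_union]
    by_cases himp : v ∈ impureSeers G φ (1 / 10 ^ 9 * d) x
    · exact Or.inl himp
    · right
      refine Finset.mem_filter.2 ⟨?_, ?_⟩
      · simp only [hF, if_pos hx]
        exact Finset.mem_sdiff.2 ⟨hv1, himp⟩
      · have h1 := card_users_le (G := G) (φ := φ) v x
        have h3 : ((impure G φ v x).card : ℝ) < 1 / 10 ^ 9 * d := by
          by_contra hc
          exact himp (mem_impureSeers.2 ⟨mem_seers.1 hv1, not_lt.1 hc⟩)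
        linarith
  have h𝓗d : (1 + 2 / 10 ^ 9) * d * (𝓗.card : ℝ) ≤ (1 + 2 / 10 ^ 9) * d * N :=
    mul_le_mul_of_nonneg_left h𝓗c (by positivity)
  have hdN : d * N ≤ d * n ^ 2 := mul_le_mul_of_nonneg_left hNn hd.le
  set S := ∑ x ∈ allPairs V,
    (((F x).filter fun v => ((users G φ (x.map (φ v))).card : ℝ) ≤ 0.6 * d).card : ℝ)
  have hS : 0.4 * S ≤ 0.6 * (3 / 10 ^ 9 * (d * n ^ 2) + 2 / 10 ^ 9 * (d * n ^ 2)) := by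
    have hS0 : 0 ≤ S := Finset.sum_nonneg fun x _ => Nat.cast_nonneg _
    linarith
  have hdn : 0 ≤ d * n ^ 2 := by positivity
  linarith

/-- Two neighbors `v`, `v'` of `y` that disagree about `y` see many pairs `s(y, z)` in common, which
cannot have a clear majority both for their name at `v` and for their name at `v'`. -/
theorem sum_disagreements_le (h : NamingSystem G φ p D d) :
    ∑ y, ((disagreements G φ y).card : ℝ) ≤ 1 / 10 ^ 7 * (d * (Fintype.card V : ℝ) ^ 2) := by
  classical
  set n : ℝ := (Fintype.card V : ℝ) with hn
  have hd := h.d_pos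
  have hdl := h.d_large
  -- For a disagreement `(v, v')` about `y`, all common neighbors `z` of `v` and `v'` but one give a
  -- pair `s(y, z)` that is in the minority at `v` or at `v'`.
  set Z : V → V × V → Finset V := fun y q => Finset.univ.filter fun z => z ≠ y ∧
    q.1 ∈ seers G s(y, z) ∧ q.2 ∈ seers G s(y, z) ∧
      (q.1 ∈ minoritySeers G φ d s(y, z) ∨ q.2 ∈ minoritySeers G φ d s(y, z)) with hZ
  have hlow : ∀ y, ∀ q ∈ disagreements G φ y, d / 2 ≤ ((Z y q).card : ℝ) := by
    rintro y ⟨v, v'⟩ hq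
    obtain ⟨hq1, hne⟩ := Finset.mem_filter.1 hq
    obtain ⟨hv, hv'⟩ := Finset.mem_product.1 hq1
    simp only [mem_nbr] at hv hv' hne
    have hvv : v ≠ v' := fun e => hne (by rw [e])
    set W := (nbr G v ∩ nbr G v').filter fun z => φ v' z ≠ φ v y ∧ z ≠ y with hW
    have hWc : (nbr G v ∩ nbr G v').card ≤ W.card + 2 := by
      have hsub : nbr G v ∩ nbr G v' ⊆
          W ∪ ({y} ∪ (nbr G v').filter fun z => φ v' z = φ v y) := by
        intro z hz
        simp only [hW, Finset.mem_union, Finset.mem_filter, Finset.mem_singleton]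
        have := (Finset.mem_inter.1 hz).2
        tauto
      have h1 : ((nbr G v').filter fun z => φ v' z = φ v y).card ≤ 1 := by
        refine Finset.card_le_one.2 fun a ha b hb => ?_
        simp only [Finset.mem_filter, mem_nbr] at ha hb
        exact h.inj v' a b ha.1 hb.1 (ha.2.trans hb.2.symm)
      have h2 := (Finset.card_le_card hsub).trans (Finset.card_union_le _ _)
      have h3 := Finset.card_union_le {y} ((nbr G v').filter fun z => φ v' z = φ v y)
      rw [Finset.card_singleton] at h3
      omega
    have hWZ : W ⊆ Z y (v, v') := by
      intro z hz
      simp only [hW, Finset.mem_filter, Finset.mem_inter, mem_nbr] at hz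
      obtain ⟨⟨hz1, hz2⟩, hz3, hz4⟩ := hz
      have hs : Sees G v s(y, z) := sees_mk.2 ⟨hz4.symm, hv.symm, hz1⟩
      have hs' : Sees G v' s(y, z) := sees_mk.2 ⟨hz4.symm, hv'.symm, hz2⟩
      simp only [hZ, Finset.mem_filter, Finset.mem_univ, true_and]
      refine ⟨hz4, mem_seers.2 hs, mem_seers.2 hs', ?_⟩
      by_contra hcon
      push Not at hcon
      obtain ⟨hc1, hc2⟩ := hcon
      have hm1 : 0.55 * d < ((namers G φ s(y, z) (s(y, z).map (φ v))).card : ℝ) := by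
        by_contra hc
        exact hc1 (Finset.mem_filter.2 ⟨mem_seers.2 hs, not_lt.1 hc⟩)
      have hm2 : 0.55 * d < ((namers G φ s(y, z) (s(y, z).map (φ v'))).card : ℝ) := by
        by_contra hc
        exact hc2 (Finset.mem_filter.2 ⟨mem_seers.2 hs', not_lt.1 hc⟩)
      have heq : s(y, z).map (φ v) = s(y, z).map (φ v') := by
        by_contra hne'
        have hdis : Disjoint (namers G φ s(y, z) (s(y, z).map (φ v)))
            (namers G φ s(y, z) (s(y, z).map (φ v'))) := by
          refine Finset.disjoint_left.2 fun w hw hw' => hne' ?_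
          rw [← (mem_namers.1 hw).2, ← (mem_namers.1 hw').2]
        have hun := Finset.card_le_card (Finset.union_subset
          (namers_subset_seers (G := G) (φ := φ) s(y, z) (s(y, z).map (φ v)))
          (namers_subset_seers (G := G) (φ := φ) s(y, z) (s(y, z).map (φ v'))))
        rw [Finset.card_union_of_disjoint hdis] at hun
        have hun' : ((namers G φ s(y, z) (s(y, z).map (φ v))).card : ℝ) +
            (namers G φ s(y, z) (s(y, z).map (φ v'))).card ≤ (seers G s(y, z)).card := by
          exact_mod_cast hun
        have := h.card_seers_le hs.1
        linarith
      rw [Sym2.map_mk, Sym2.map_mk, Sym2.eq_iff] at heq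
      rcases heq with ⟨e1, -⟩ | ⟨e1, -⟩
      · exact hne e1
      · exact hz3 e1.symm
    have h1 : (1 - 1 / 10 ^ 9) * d ≤ ((nbr G v ∩ nbr G v').card : ℝ) := by
      rw [h.d_eq]; exact h.typical.le_codeg v v' hvv
    have h2 : ((nbr G v ∩ nbr G v').card : ℝ) ≤ (Z y (v, v')).card + 2 := by
      have := Finset.card_le_card hWZ
      have h4 : (nbr G v ∩ nbr G v').card ≤ (Z y (v, v')).card + 2 := by omega
      exact_mod_cast h4
    linarith
  have hup : ∀ y, ∑ q ∈ disagreements G φ y, ((Z y q).card : ℝ) ≤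
      ∑ z ∈ Finset.univ.erase y,
        2 * ((minoritySeers G φ d s(y, z)).card : ℝ) * (seers G s(y, z)).card := by
    intro y
    have h1 : ∑ q ∈ disagreements G φ y, (Z y q).card ≤ ∑ z ∈ Finset.univ.erase y,
        ((minoritySeers G φ d s(y, z) ×ˢ seers G s(y, z)) ∪
          (seers G s(y, z) ×ˢ minoritySeers G φ d s(y, z))).card := by
      rw [← Finset.card_sigma, ← Finset.card_sigma]
      refine Finset.card_le_card_of_injOn (fun e => ⟨e.2, e.1⟩) ?_ ?_
      · rintro ⟨⟨v, v'⟩, z⟩ he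
        obtain ⟨-, he2⟩ := Finset.mem_sigma.1 he
        simp only [hZ, Finset.mem_filter, Finset.mem_univ, true_and] at he2
        simp only [Finset.coe_sigma, Set.mem_sigma_iff, Finset.mem_coe, Finset.mem_erase,
          Finset.mem_univ, Finset.mem_union, Finset.mem_product]
        tauto
      · rintro ⟨q, z⟩ - ⟨q', z'⟩ - he
        simp only [Sigma.mk.injEq, heq_eq_eq] at he
        rw [he.1, he.2]
    have h2 : ∀ z, (((minoritySeers G φ d s(y, z) ×ˢ seers G s(y, z)) ∪
          (seers G s(y, z) ×ˢ minoritySeers G φ d s(y, z))).card : ℝ) ≤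
        2 * ((minoritySeers G φ d s(y, z)).card : ℝ) * (seers G s(y, z)).card := by
      intro z
      have := Finset.card_union_le (minoritySeers G φ d s(y, z) ×ˢ seers G s(y, z))
        (seers G s(y, z) ×ˢ minoritySeers G φ d s(y, z))
      rw [Finset.card_product, Finset.card_product] at this
      have h3 : (((minoritySeers G φ d s(y, z) ×ˢ seers G s(y, z)) ∪
          (seers G s(y, z) ×ˢ minoritySeers G φ d s(y, z))).card : ℝ) ≤
          (minoritySeers G φ d s(y, z)).card * (seers G s(y, z)).card +
          (seers G s(y, z)).card * (minoritySeers G φ d s(y, z)).card := by exact_mod_cast this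
      linarith
    refine le_trans ?_ (Finset.sum_le_sum fun z _ => h2 z)
    exact_mod_cast h1
  have htot : d / 2 * ∑ y, ((disagreements G φ y).card : ℝ) ≤
      4 * (1 + 1 / 10 ^ 9) * d * ∑ x ∈ allPairs V, ((minoritySeers G φ d x).card : ℝ) := by
    calc d / 2 * ∑ y, ((disagreements G φ y).card : ℝ)
        ≤ ∑ y, ∑ q ∈ disagreements G φ y, ((Z y q).card : ℝ) := by
          rw [Finset.mul_sum]
          refine Finset.sum_le_sum fun y _ => ?_
          rw [mul_comm, ← nsmul_eq_mul, ← Finset.sum_const]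
          exact Finset.sum_le_sum (hlow y)
      _ ≤ ∑ y, ∑ z ∈ Finset.univ.erase y,
          2 * ((minoritySeers G φ d s(y, z)).card : ℝ) * (seers G s(y, z)).card :=
          Finset.sum_le_sum fun y _ => hup y
      _ = ∑ q ∈ (Finset.univ : Finset V).offDiag,
          2 * ((minoritySeers G φ d s(q.1, q.2)).card : ℝ) * (seers G s(q.1, q.2)).card := by
          rw [← Finset.sum_finset_product']
          rintro ⟨a, b⟩
          simp [ne_comm]
      _ = 2 * ∑ x ∈ allPairs V, 2 * ((minoritySeers G φ d x).card : ℝ) * (seers G x).card :=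
          sum_offDiag_eq fun x => 2 * ((minoritySeers G φ d x).card : ℝ) * (seers G x).card
      _ ≤ _ := by
          rw [Finset.mul_sum, Finset.mul_sum]
          refine Finset.sum_le_sum fun x hx => ?_
          have := h.card_seers_le (mem_allPairs.1 hx)
          nlinarith [mul_le_mul_of_nonneg_left this
            (Nat.cast_nonneg (α := ℝ) (minoritySeers G φ d x).card)]
  have hmin := h.sum_minoritySeers_le
  have h5 : d * ∑ y, ((disagreements G φ y).card : ℝ) ≤
      d * (1 / 10 ^ 7 * (d * n ^ 2)) := by
    have h6 := mul_le_mul_of_nonneg_left hmin (show 0 ≤ 4 * (1 + 1 / 10 ^ 9) * d by positivity)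
    have h7 : 0 ≤ d * (d * n ^ 2) := by positivity
    linarith
  exact le_of_mul_le_mul_left h5 hd

end NamingSystem

end ApproximateNaming

/-! ### The popular names form a permutation -/

section PopularNames

variable {V : Type*} [Fintype V] [DecidableEq V] {G : SimpleGraph V} {φ : V → V → V} {p D d : ℝ}

namespace NamingSystem

theorem sum_card_voters (y : V) : ∑ a, (voters G φ y a).card = (nbr G y).card := by
  rw [Finset.card_eq_sum_card_fiberwise (f := fun v => φ v y) (t := Finset.univ)
    (fun _ _ => Finset.mem_coe.2 (Finset.mem_univ _))]
  refine Finset.sum_congr rfl fun a _ => ?_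
  congr 1
  ext v
  rw [mem_voters, Finset.mem_filter, mem_nbr, G.adj_comm]

theorem card_voters_add_le {y a b : V} (hab : a ≠ b) :
    (voters G φ y a).card + (voters G φ y b).card ≤ (nbr G y).card := by
  rw [← sum_card_voters (φ := φ), ← Finset.sum_pair (f := fun a => (voters G φ y a).card) hab]
  exact Finset.sum_le_sum_of_subset (Finset.subset_univ _)

theorem card_badDarts_eq (ψ : V → V) :
    (badDarts G φ ψ).card = ∑ y, ((nbr G y).filter fun v => φ v y ≠ ψ y).card := by
  rw [← Finset.card_sigma]
  refine Finset.card_bij' (fun q _ => ⟨q.2, q.1⟩) (fun e _ => (e.2, e.1)) ?_ ?_ ?_ ?_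
  · intro q hq
    obtain ⟨h1, h2⟩ := mem_badDarts.1 hq
    exact Finset.mem_sigma.2 ⟨Finset.mem_univ _, Finset.mem_filter.2 ⟨mem_nbr.2 h1.symm, h2⟩⟩
  · intro e he
    obtain ⟨h1, h2⟩ := Finset.mem_filter.1 (Finset.mem_sigma.1 he).2
    exact mem_badDarts.2 ⟨(mem_nbr.1 h1).symm, h2⟩
  · intros; rfl
  · intros; rfl

theorem card_filter_ne_add_voters (y a : V) :
    ((nbr G y).filter fun v => φ v y ≠ a).card + (voters G φ y a).card = (nbr G y).card := by
  have h1 : voters G φ y a = (nbr G y).filter fun v => ¬(φ v y ≠ a) := by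
    ext v
    rw [mem_voters, Finset.mem_filter, mem_nbr, G.adj_comm, not_not]
  rw [h1, Finset.card_filter_add_card_filter_not]

theorem card_voters_le (h : NamingSystem G φ p D d) {y y' : V} (hy : y ≠ y') (a : V) :
    ((voters G φ y a).card : ℝ) + (voters G φ y' a).card ≤ (1 + 1 / 10 ^ 9) * D := by
  have hdis : Disjoint (voters G φ y a) (voters G φ y' a) := by
    refine Finset.disjoint_left.2 fun v hv hv' => hy ?_
    rw [mem_voters] at hv hv'
    exact h.inj v y y' hv.1 hv'.1 (hv.2.trans hv'.2.symm)
  have := h.name_le a (voters G φ y a ∪ voters G φ y' a) fun v hv => by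
    rcases Finset.mem_union.1 hv with hv | hv
    · exact ⟨y, mem_voters.1 hv⟩
    · exact ⟨y', mem_voters.1 hv⟩
  rwa [Finset.card_union_of_disjoint hdis, Nat.cast_add] at this

/-- There is a permutation `ψ` that extends the partial map taking a vertex to the name that a
majority of its neighbors give it, and that has few bad darts. -/
theorem exists_perm (h : NamingSystem G φ p D d) : ∃ ψ : Equiv.Perm V,
    (∀ y a, (1 + 1 / 10 ^ 9) / 2 * D < (voters G φ y a).card → ψ y = a) ∧
    ((badDarts G φ ψ).card : ℝ) ≤ 24 / 10 ^ 8 * (Fintype.card V * D) := by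
  classical
  set n : ℝ := (Fintype.card V : ℝ) with hn
  have hD := h.D_pos
  have hd := h.d_pos
  have hnpos := h.n_pos
  have hV : Nonempty V := Fintype.card_pos_iff.1 (by exact_mod_cast hnpos)
  have hmax : ∀ y, ∃ a, ∀ b, (voters G φ y b).card ≤ (voters G φ y a).card := fun y => by
    obtain ⟨a, -, ha⟩ := Finset.exists_max_image Finset.univ (fun b => (voters G φ y b).card)
      Finset.univ_nonempty
    exact ⟨a, fun b => ha b (Finset.mem_univ _)⟩
  choose top htop using hmax
  have hdis : ∀ y, (1 - 1 / 10 ^ 9) * D * ((nbr G y).card - (voters G φ y (top y)).card : ℝ) ≤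
      (disagreements G φ y).card := by
    intro y
    have h1 : (disagreements G φ y).card =
        ∑ v ∈ nbr G y, ((nbr G y).filter fun v' => φ v' y ≠ φ v y).card := by
      rw [← Finset.card_sigma]
      refine Finset.card_bij' (fun q _ => ⟨q.1, q.2⟩) (fun e _ => (e.1, e.2)) ?_ ?_ ?_ ?_
      · intro q hq
        obtain ⟨h1, h2⟩ := Finset.mem_filter.1 hq
        obtain ⟨h3, h4⟩ := Finset.mem_product.1 h1
        exact Finset.mem_sigma.2 ⟨h3, Finset.mem_filter.2 ⟨h4, fun e => h2 e.symm⟩⟩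
      · intro e he
        obtain ⟨h3, h4⟩ := Finset.mem_sigma.1 he
        obtain ⟨h4, h5⟩ := Finset.mem_filter.1 h4
        exact Finset.mem_filter.2 ⟨Finset.mem_product.2 ⟨h3, h4⟩, fun e => h5 e.symm⟩
      · intros; rfl
      · intros; rfl
    have h2 : ∀ v ∈ nbr G y, ((nbr G y).card - (voters G φ y (top y)).card : ℝ) ≤
        ((nbr G y).filter fun v' => φ v' y ≠ φ v y).card := by
      intro v _
      have h3 := card_filter_ne_add_voters (G := G) (φ := φ) y (φ v y)
      have h4 := htop y (φ v y)
      have h5 : ((nbr G y).card : ℝ) ≤ ((nbr G y).filter fun v' => φ v' y ≠ φ v y).card +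
          (voters G φ y (top y)).card := by
        rw [← h3]; push_cast; gcongr
      linarith
    have h3 : ((disagreements G φ y).card : ℝ) = ∑ v ∈ nbr G y,
        (((nbr G y).filter fun v' => φ v' y ≠ φ v y).card : ℝ) := by exact_mod_cast h1
    have h4 := Finset.sum_le_sum h2
    rw [Finset.sum_const, nsmul_eq_mul] at h4
    have h5 : (0 : ℝ) ≤ (nbr G y).card - (voters G φ y (top y)).card := by
      have := card_filter_ne_add_voters (G := G) (φ := φ) y (top y)
      have h6 : (voters G φ y (top y)).card ≤ (nbr G y).card := by omega
      have : ((voters G φ y (top y)).card : ℝ) ≤ (nbr G y).card := by exact_mod_cast h6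
      linarith
    have h6 := mul_le_mul_of_nonneg_right (h.le_deg y) h5
    linarith
  have hsum : ∑ y, ((nbr G y).card - (voters G φ y (top y)).card : ℝ) ≤
      11 / 10 ^ 8 * (n * D) := by
    have h1 := Finset.sum_le_sum fun y (_ : y ∈ Finset.univ) => hdis y
    rw [← Finset.mul_sum] at h1
    have h2 := h1.trans h.sum_disagreements_le
    have h3 : d * n ^ 2 = D * (n * D) := by
      have := h.D_sq
      calc d * n ^ 2 = n * (n * d) := by ring
        _ = n * (D * D) := by rw [this]
        _ = _ := by ring
    rw [← hn, h3] at h2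
    have h4 : D * ((1 - 1 / 10 ^ 9) *
        ∑ y, ((nbr G y).card - (voters G φ y (top y)).card : ℝ)) ≤
        D * (1 / 10 ^ 7 * (n * D)) := by linarith
    have h5 := le_of_mul_le_mul_left h4 hD
    have h6 : 0 ≤ n * D := by positivity
    linarith
  set P : Finset V := Finset.univ.filter fun y =>
    (1 + 1 / 10 ^ 9) / 2 * D < (voters G φ y (top y)).card with hP
  have hinj : Set.InjOn top (P : Set V) := by
    intro y hy y' hy' he
    by_contra hne
    have h1 := (Finset.mem_filter.1 (Finset.mem_coe.1 hy)).2
    have h2 := (Finset.mem_filter.1 (Finset.mem_coe.1 hy')).2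
    have h3 := h.card_voters_le hne (top y)
    rw [← he] at h2
    linarith
  obtain ⟨g, hg⟩ := Finset.exists_equiv_extend_of_card_eq (t := (Finset.univ : Finset V))
    (by simp) (Finset.subset_univ (P.image top)) hinj
  set ψ : Equiv.Perm V := g.trans ((Equiv.subtypeUnivEquiv fun x => Finset.mem_univ x)) with hψ
  have hψP : ∀ y ∈ P, ψ y = top y := fun y hy => hg y hy
  refine ⟨ψ, fun y a ha => ?_, ?_⟩
  · have h1 : ((voters G φ y a).card : ℝ) ≤ (voters G φ y (top y)).card := by
      exact_mod_cast htop y a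
    have hyP : y ∈ P := Finset.mem_filter.2 ⟨Finset.mem_univ _, ha.trans_le h1⟩
    rw [hψP y hyP]
    by_contra hne
    have h2 : ((voters G φ y (top y)).card : ℝ) + (voters G φ y a).card ≤ (nbr G y).card := by
      exact_mod_cast card_voters_add_le hne
    have := h.deg_le y
    linarith
  · have hpt : ∀ y, (((nbr G y).filter fun v => φ v y ≠ ψ y).card : ℝ) ≤
        2.1 * ((nbr G y).card - (voters G φ y (top y)).card) := by
      intro y
      have h1 : (((nbr G y).filter fun v => φ v y ≠ ψ y).card : ℝ) + (voters G φ y (ψ y)).card =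
          (nbr G y).card := by exact_mod_cast card_filter_ne_add_voters y (ψ y)
      have h0 : (((nbr G y).filter fun v => φ v y ≠ top y).card : ℝ) +
          (voters G φ y (top y)).card = (nbr G y).card := by
        exact_mod_cast card_filter_ne_add_voters y (top y)
      have h00 : (0 : ℝ) ≤ ((nbr G y).filter fun v => φ v y ≠ top y).card := Nat.cast_nonneg _
      have h01 : (0 : ℝ) ≤ (voters G φ y (ψ y)).card := Nat.cast_nonneg _
      by_cases hy : y ∈ P
      · rw [hψP y hy] at h1 ⊢
        linarith
      · have h2 : ((voters G φ y (top y)).card : ℝ) ≤ (1 + 1 / 10 ^ 9) / 2 * D := by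
          by_contra hc
          exact hy (Finset.mem_filter.2 ⟨Finset.mem_univ _, not_le.1 hc⟩)
        have h3 := h.le_deg y
        linarith
    rw [card_badDarts_eq]
    push_cast
    refine (Finset.sum_le_sum fun y _ => hpt y).trans ?_
    rw [← Finset.mul_sum]
    have h6 : 0 ≤ n * D := by positivity
    linarith

end NamingSystem

end PopularNames

/-! ### The popular names are the only names -/

section GlobalNaming

variable {V : Type*} [Fintype V] [DecidableEq V] {G : SimpleGraph V} {φ : V → V → V} {p D d : ℝ}

open Classical in
/-- The vertices that see the pair `x` and do not give it its name according to `ψ`. -/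
noncomputable def renamers (G : SimpleGraph V) (φ : V → V → V) (ψ : V → V) (x : Sym2 V) :
    Finset V :=
  (seers G x).filter fun v => x.map (φ v) ≠ x.map ψ

open Classical in
/-- The pairs of distinct vertices to which most vertices that see them give one and the same name
other than the name according to `ψ`. -/
noncomputable def shiftedPairs (G : SimpleGraph V) (φ : V → V → V) (ψ : V → V) (d : ℝ) :
    Finset (Sym2 V) :=
  (allPairs V).filter fun x => ∃ g, g ≠ x.map ψ ∧ 0.85 * d ≤ (namers G φ x g).card

/-- The neighbors of `y` that give it a name other than `ψ y`. -/
noncomputable def dissenters (G : SimpleGraph V) (φ : V → V → V) (ψ : V → V) (y : V) : Finset V :=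
  (nbr G y).filter fun v => φ v y ≠ ψ y

theorem mem_renamers {ψ : V → V} {x : Sym2 V} {v : V} :
    v ∈ renamers G φ ψ x ↔ Sees G v x ∧ x.map (φ v) ≠ x.map ψ := by
  simp [renamers, mem_seers]

theorem mem_shiftedPairs {ψ : V → V} {x : Sym2 V} : x ∈ shiftedPairs G φ ψ d ↔
    ¬x.IsDiag ∧ ∃ g, g ≠ x.map ψ ∧ 0.85 * d ≤ (namers G φ x g).card := by
  simp [shiftedPairs]

namespace NamingSystem

/-- A bad dart `(v, y)` spoils the name of `s(y, z)` at `v` for all but at most two of the neighbors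
`z` of `v`. -/
theorem card_badDarts_le_renamers (h : NamingSystem G φ p D d) (ψ : Equiv.Perm V) :
    0.45 * D * (badDarts G φ ψ).card ≤ ∑ x ∈ allPairs V, ((renamers G φ ψ x).card : ℝ) := by
  classical
  set Z : V × V → Finset V := fun q => (nbr G q.1).filter fun z => z ≠ q.2 ∧ φ q.1 z ≠ ψ q.2
    with hZ
  have hlow : ∀ q ∈ badDarts G φ ψ, 0.9 * D ≤ ((Z q).card : ℝ) := by
    rintro ⟨v, y⟩ _
    have hsub : nbr G v ⊆ Z (v, y) ∪ ({y} ∪ (nbr G v).filter fun z => φ v z = ψ y) := by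
      intro z hz
      simp only [hZ, Finset.mem_union, Finset.mem_filter, Finset.mem_singleton]
      tauto
    have h1 : ((nbr G v).filter fun z => φ v z = ψ y).card ≤ 1 := by
      refine Finset.card_le_one.2 fun a ha b hb => ?_
      simp only [Finset.mem_filter, mem_nbr] at ha hb
      exact h.inj v a b ha.1 hb.1 (ha.2.trans hb.2.symm)
    have h2 := (Finset.card_le_card hsub).trans (Finset.card_union_le _ _)
    have h3 := Finset.card_union_le {y} ((nbr G v).filter fun z => φ v z = ψ y)
    rw [Finset.card_singleton] at h3
    have h4 : (nbr G v).card ≤ (Z (v, y)).card + 2 := by omega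
    have h5 : ((nbr G v).card : ℝ) ≤ (Z (v, y)).card + 2 := by exact_mod_cast h4
    have := h.le_deg v
    have := h.d_large
    have := h.d_le_D
    linarith
  have h1 : ∑ q ∈ badDarts G φ ψ, (Z q).card ≤
      ∑ q ∈ (Finset.univ : Finset V).offDiag, (renamers G φ ψ s(q.1, q.2)).card := by
    rw [← Finset.card_sigma, ← Finset.card_sigma]
    refine Finset.card_le_card_of_injOn (fun e => ⟨(e.1.2, e.2), e.1.1⟩) ?_ ?_
    · rintro ⟨⟨v, y⟩, z⟩ he
      obtain ⟨he1, he2⟩ := Finset.mem_sigma.1 he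
      obtain ⟨hadj, hbad⟩ := mem_badDarts.1 he1
      simp only [hZ, Finset.mem_filter, mem_nbr] at he2 hadj hbad
      obtain ⟨hz1, hz2, hz3⟩ := he2
      refine Finset.mem_coe.2 (Finset.mem_sigma.2 ⟨by simpa using hz2.symm, ?_⟩)
      refine mem_renamers.2 ⟨sees_mk.2 ⟨hz2.symm, hadj, hz1⟩, ?_⟩
      rw [Sym2.map_mk, Sym2.map_mk, Ne, Sym2.eq_iff]
      rintro (⟨e1, -⟩ | ⟨-, e2⟩)
      · exact hbad e1
      · exact hz3 e2
    · rintro ⟨⟨v, y⟩, z⟩ - ⟨⟨v', y'⟩, z'⟩ - he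
      simp only [Sigma.mk.injEq, heq_eq_eq, Prod.mk.injEq] at he
      obtain ⟨⟨rfl, rfl⟩, rfl⟩ := he
      rfl
  have h2 := sum_offDiag_eq (V := V) (fun x => (renamers G φ ψ x).card)
  rw [h2] at h1
  have h3 := Finset.sum_le_sum hlow
  rw [Finset.sum_const, nsmul_eq_mul] at h3
  have h4 : ∑ q ∈ badDarts G φ ψ, ((Z q).card : ℝ) ≤
      2 * ∑ x ∈ allPairs V, ((renamers G φ ψ x).card : ℝ) := by exact_mod_cast h1
  linarith

/-- Nearly all bad names are dominated: if a pair `x` has a pure bad name `g` at some vertex, then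
the pair that should have the name `g` is renamed by nearly all vertices that see it. Counting
then shows that the name `g` has nearly `d` users for most bad names, nearly all of which use it
for the same pair. -/
theorem le_card_shiftedPairs (h : NamingSystem G φ p D d) (ψ : Equiv.Perm V) :
    0.36 * (badDarts G φ ψ).card ≤ (shiftedPairs G φ ψ d).card * p := by
  classical
  have hd := h.d_pos
  have hD := h.D_pos
  set M : ℝ := ((badDarts G φ ψ).card : ℝ) with hM
  set E : ℝ := ∑ x ∈ allPairs V, ((renamers G φ ψ x).card : ℝ) with hE
  have hEM : 0.45 * D * M ≤ E := h.card_badDarts_le_renamers ψ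
  have hE0 : 0 ≤ E := Finset.sum_nonneg fun _ _ => Nat.cast_nonneg _
  set I : ℝ := ∑ x ∈ allPairs V, ((impureSeers G φ (1 / 10 ^ 9 * d) x).card : ℝ) with hI
  have hIE : I ≤ 3 / 10 ^ 9 * E := by
    have := h.impure_le ψ
    linarith
  set F : Sym2 V → Finset V := fun x =>
    if x ∈ allPairs V then renamers G φ ψ x \ impureSeers G φ (1 / 10 ^ 9 * d) x else ∅ with hF
  have hFm : ∀ x, ∀ v ∈ F x, Sees G v x ∧ x.map (φ v) ≠ x.map ψ ∧
      v ∉ impureSeers G φ (1 / 10 ^ 9 * d) x := by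
    intro x v hv
    simp only [hF] at hv
    split_ifs at hv with hx
    · have h1 := mem_renamers.1 (Finset.mem_sdiff.1 hv).1
      exact ⟨h1.1, h1.2, (Finset.mem_sdiff.1 hv).2⟩
    · simp at hv
  have hFimp : ∀ x, ∀ v ∈ F x, ((impure G φ v x).card : ℝ) < 1 / 10 ^ 9 * d := by
    intro x v hv
    by_contra hc
    exact (hFm x v hv).2.2 (mem_impureSeers.2 ⟨(hFm x v hv).1, not_lt.1 hc⟩)
  set 𝓗 := (allPairs V).filter fun g => ∃ x, ∃ v ∈ F x, x.map (φ v) = g with h𝓗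
  have hsmall := h.few_small_names F (fun x v hv => (hFm x v hv).1) 𝓗
    (fun x v hv => Finset.mem_filter.2 ⟨mem_allPairs.2 (h.map_not_isDiag (hFm x v hv).1),
      x, v, hv, rfl⟩)
    (fun g hg => by
      obtain ⟨-, x, v, hv, rfl⟩ := Finset.mem_filter.1 hg
      exact h.card_users_le_of_pure (hFm x v hv).1 (hFm x v hv).2.2) (α := 0.9) (by norm_num)
  set S := ∑ x ∈ allPairs V,
    (((F x).filter fun v => ((users G φ (x.map (φ v))).card : ℝ) ≤ 0.9 * d).card : ℝ) with hS
  set FS := ∑ x ∈ allPairs V, ((F x).card : ℝ) with hFS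
  have hFsum : E - I ≤ FS := by
    rw [hE, hI, hFS, ← Finset.sum_sub_distrib]
    refine Finset.sum_le_sum fun x hx => ?_
    have h3 : (renamers G φ ψ x).card ≤ (F x).card + (impureSeers G φ (1 / 10 ^ 9 * d) x).card := by
      simp only [hF, if_pos hx]
      exact Finset.card_le_card_sdiff_add_card
    have h4 : ((renamers G φ ψ x).card : ℝ) ≤
        (F x).card + (impureSeers G φ (1 / 10 ^ 9 * d) x).card := by exact_mod_cast h3
    linarith
  have hinjψ : Function.Injective (Sym2.map ψ.symm) := Sym2.map.injective ψ.symm.injective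
  have hmapψ : ∀ g : Sym2 V, (g.map ψ.symm).map ψ = g := by
    intro g; rw [Sym2.map_map, Equiv.self_comp_symm, Sym2.map_id]; rfl
  have h𝓗E : (𝓗.card : ℝ) * ((1 - 2 / 10 ^ 9) * d) ≤ E := by
    calc (𝓗.card : ℝ) * ((1 - 2 / 10 ^ 9) * d)
        ≤ ∑ g ∈ 𝓗, ((renamers G φ ψ (g.map ψ.symm)).card : ℝ) := by
          rw [← nsmul_eq_mul, ← Finset.sum_const]
          refine Finset.sum_le_sum fun g hg => ?_
          obtain ⟨hgd, x, v, hv, hxg⟩ := Finset.mem_filter.1 hg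
          have hgd' : ¬(g.map ψ.symm).IsDiag := by
            rw [mem_allPairs] at hgd
            rwa [Sym2.isDiag_map ψ.symm.injective]
          have hne : g.map ψ.symm ≠ x := by
            rintro rfl
            exact (hFm _ v hv).2.1 (by rw [hxg, hmapψ])
          have hsub : seers G (g.map ψ.symm) ⊆
              renamers G φ ψ (g.map ψ.symm) ∪ impure G φ v x := by
            intro w hw
            rw [Finset.mem_union, mem_renamers, mem_impure]
            by_cases he : (g.map ψ.symm).map (φ w) = (g.map ψ.symm).map ψ
            · refine Or.inr ⟨_, hne, mem_seers.1 hw, ?_⟩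
              rw [he, hmapψ, hxg]
            · exact Or.inl ⟨mem_seers.1 hw, he⟩
          have h1 : ((seers G (g.map ψ.symm)).card : ℝ) ≤
              (renamers G φ ψ (g.map ψ.symm)).card + (impure G φ v x).card := by
            exact_mod_cast (Finset.card_le_card hsub).trans (Finset.card_union_le _ _)
          have h2 := h.le_card_seers hgd'
          have h3 := hFimp x v hv
          linarith
      _ = ∑ x ∈ 𝓗.image (Sym2.map ψ.symm), ((renamers G φ ψ x).card : ℝ) := by
          rw [Finset.sum_image fun a _ b _ hab => hinjψ hab]
      _ ≤ E := by
          refine Finset.sum_le_sum_of_subset_of_nonneg (fun x hx => ?_)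
            fun _ _ _ => Nat.cast_nonneg _
          obtain ⟨g, hg, rfl⟩ := Finset.mem_image.1 hx
          have := (Finset.mem_filter.1 hg).1
          rw [mem_allPairs] at this ⊢
          rwa [Sym2.isDiag_map ψ.symm.injective]
  have hSE : S ≤ 73 / 10 ^ 9 * E := by
    have hS0 : 0 ≤ S := Finset.sum_nonneg fun _ _ => Nat.cast_nonneg _
    have h1 : (1 + 2 / 10 ^ 9) * d * (𝓗.card : ℝ) ≤ (1 + 2 / 10 ^ 9) / (1 - 2 / 10 ^ 9) * E := by
      rw [div_mul_eq_mul_div, le_div_iff₀ (by norm_num)]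
      linarith
    have h2 : (1 + 2 / 10 ^ 9 : ℝ) / (1 - 2 / 10 ^ 9) ≤ 1 + 5 / 10 ^ 9 := by norm_num
    have h3 := mul_le_mul_of_nonneg_right h2 hE0
    linarith
  have hbig : FS - S ≤ (shiftedPairs G φ ψ d).card * ((1 + 1 / 10 ^ 9) * d) := by
    have h1 : ∀ x ∈ allPairs V, ((F x).card : ℝ) -
        ((F x).filter fun v => ((users G φ (x.map (φ v))).card : ℝ) ≤ 0.9 * d).card ≤
        if x ∈ shiftedPairs G φ ψ d then (1 + 1 / 10 ^ 9) * d else 0 := by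
      intro x hx
      split_ifs with hxs
      · have h2 : (F x).card ≤ (seers G x).card := Finset.card_le_card fun v hv =>
          mem_seers.2 (hFm x v hv).1
        have h3 : ((F x).card : ℝ) ≤ (seers G x).card := by exact_mod_cast h2
        have h4 := h.card_seers_le (mem_allPairs.1 hx)
        have h5 : (0 : ℝ) ≤ ((F x).filter fun v =>
          ((users G φ (x.map (φ v))).card : ℝ) ≤ 0.9 * d).card := Nat.cast_nonneg _
        linarith
      · rw [Finset.filter_true_of_mem, sub_self]
        intro v hv
        by_contra hc
        rw [not_le] at hc
        refine hxs (mem_shiftedPairs.2 ⟨mem_allPairs.1 hx, x.map (φ v), (hFm x v hv).2.1, ?_⟩)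
        have h2 := card_users_le (G := G) (φ := φ) v x
        have h3 := hFimp x v hv
        linarith
    have h2 := Finset.sum_le_sum h1
    rw [Finset.sum_sub_distrib, ← Finset.sum_filter, Finset.sum_const, nsmul_eq_mul] at h2
    refine h2.trans (mul_le_mul_of_nonneg_right ?_ (by positivity))
    refine Nat.cast_le.2 (Finset.card_le_card fun x hx => (Finset.mem_filter.1 hx).2)
  have hfin : D * (0.36 * M) ≤ D * ((shiftedPairs G φ ψ d).card * p) := by
    have h1 : (shiftedPairs G φ ψ d).card * ((1 + 1 / 10 ^ 9) * d) =
        (1 + 1 / 10 ^ 9) * (D * ((shiftedPairs G φ ψ d).card * p)) := by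
      rw [h.d_eq_mul]; ring
    have h2 : 0 ≤ D * ((shiftedPairs G φ ψ d).card * p) := by
      have := h.p_pos
      positivity
    rw [h1] at hbig
    linarith
  exact le_of_mul_le_mul_left hfin hD

end NamingSystem

end GlobalNaming

/-! ### There are no bad darts -/

section NoBadDarts

variable {V : Type*} [Fintype V] [DecidableEq V] {G : SimpleGraph V} {φ : V → V → V} {p D d : ℝ}

open Classical in
/-- The vertices that are adjacent to an unusual number of dissenters about `y`. -/
noncomputable def dissenterHubs (G : SimpleGraph V) (φ : V → V → V) (ψ : V → V) (d : ℝ) (y : V) :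
    Finset V :=
  Finset.univ.filter fun z => 0.02 * d ≤ (nbr G z ∩ dissenters G φ ψ y).card

open Classical in
/-- The vertices that are adjacent to an unusual number of voters for one unpopular name of `y`. -/
noncomputable def voterHubs (G : SimpleGraph V) (φ : V → V → V) (ψ : V → V) (d : ℝ) (y : V) :
    Finset V :=
  Finset.univ.filter fun z => ∃ a, a ≠ ψ y ∧ 0.83 * d ≤ (nbr G z ∩ voters G φ y a).card

theorem mem_dissenters {ψ : V → V} {y v : V} :
    v ∈ dissenters G φ ψ y ↔ G.Adj y v ∧ φ v y ≠ ψ y := by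
  rw [dissenters, Finset.mem_filter, mem_nbr]

theorem mem_dissenterHubs {ψ : V → V} {y z : V} : z ∈ dissenterHubs G φ ψ d y ↔
    0.02 * d ≤ (nbr G z ∩ dissenters G φ ψ y).card := by
  simp [dissenterHubs]

theorem mem_voterHubs {ψ : V → V} {y z : V} : z ∈ voterHubs G φ ψ d y ↔
    ∃ a, a ≠ ψ y ∧ 0.83 * d ≤ (nbr G z ∩ voters G φ y a).card := by
  simp [voterHubs]

namespace NamingSystem

/-- If every vertex of `B` has `β * d` neighbors in `A`, which is more than expected, then
`B` is small compared with `A`. -/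
theorem card_hubs_le (h : NamingSystem G φ p D d) {A B : Finset V} {α β : ℝ}
    (hA : (A.card : ℝ) ≤ α * D) (hB : ∀ z ∈ B, β * d ≤ ((nbr G z ∩ A).card : ℝ)) :
    (β - 1.2 * α - 1 / 10 ^ 5) * B.card ≤ 1 / 10 ^ 5 * A.card := by
  have hd := h.d_pos
  have h1 := h.typical.edges_le A B
  have h2 : (B.card : ℝ) * (β * d) ≤ ((∑ b ∈ B, (nbr G b ∩ A).card : ℕ) : ℝ) := by
    push_cast
    rw [← nsmul_eq_mul, ← Finset.sum_const]
    exact Finset.sum_le_sum hB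
  have h3 : 1.2 * p * A.card * B.card ≤ 1.2 * α * d * B.card := by
    have h4 := mul_le_mul_of_nonneg_left hA h.p_pos.le
    have h5 : p * (α * D) = α * d := by rw [h.d_eq_mul]; ring
    rw [h5] at h4
    have h6 := mul_le_mul_of_nonneg_right h4 (Nat.cast_nonneg (α := ℝ) B.card)
    linarith
  refine le_of_mul_le_mul_left ?_ hd
  linarith

theorem card_dissenterHubs_le (h : NamingSystem G φ p D d) (ψ : V → V) {y : V}
    (hy : ((dissenters G φ ψ y).card : ℝ) ≤ 0.01 * D) :
    ((dissenterHubs G φ ψ d y).card : ℝ) ≤ 0.002 * (dissenters G φ ψ y).card := by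
  have h1 := h.card_hubs_le (B := dissenterHubs G φ ψ d y) hy fun z hz => mem_dissenterHubs.1 hz
  have h2 : (0 : ℝ) ≤ (dissenterHubs G φ ψ d y).card := Nat.cast_nonneg _
  have h3 : (0 : ℝ) ≤ (dissenters G φ ψ y).card := Nat.cast_nonneg _
  linarith

theorem card_voterHubs_le (h : NamingSystem G φ p D d) (ψ : V → V) {y : V}
    (hψ : ∀ a, (1 + 1 / 10 ^ 9) / 2 * D < (voters G φ y a).card → ψ y = a) :
    ((voterHubs G φ ψ d y).card : ℝ) ≤ 0.0002 * D := by
  classical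
  set B : V → Finset V := fun a => if a = ψ y then ∅ else
    Finset.univ.filter fun z => 0.83 * d ≤ ((nbr G z ∩ voters G φ y a).card : ℝ) with hB
  have h1 : voterHubs G φ ψ d y ⊆ Finset.univ.biUnion B := by
    intro z hz
    obtain ⟨a, ha, hza⟩ := mem_voterHubs.1 hz
    refine Finset.mem_biUnion.2 ⟨a, Finset.mem_univ _, ?_⟩
    simp only [hB, if_neg ha]
    simpa using hza
  have h2 : ∀ a, ((B a).card : ℝ) ≤ 0.0001 * (voters G φ y a).card := by
    intro a
    by_cases ha : a = ψ y
    · simp only [hB, if_pos ha, Finset.card_empty, Nat.cast_zero]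
      positivity
    · have h3 : ((voters G φ y a).card : ℝ) ≤ (1 + 1 / 10 ^ 9) / 2 * D := by
        by_contra hc
        exact ha (hψ a (not_le.1 hc)).symm
      have h4 := h.card_hubs_le (B := B a) (β := 0.83) h3 fun z hz => by
        simp only [hB, if_neg ha] at hz
        exact (Finset.mem_filter.1 hz).2
      have h5 : (0 : ℝ) ≤ (B a).card := Nat.cast_nonneg _
      have h6 : (0 : ℝ) ≤ (voters G φ y a).card := Nat.cast_nonneg _
      linarith
  have h3 : ((voterHubs G φ ψ d y).card : ℝ) ≤ ∑ a, ((B a).card : ℝ) := by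
    exact_mod_cast (Finset.card_le_card h1).trans Finset.card_biUnion_le
  have h4 := Finset.sum_le_sum fun a (_ : a ∈ Finset.univ) => h2 a
  rw [← Finset.mul_sum] at h4
  have h5 : ∑ a, ((voters G φ y a).card : ℝ) = (nbr G y).card := by
    exact_mod_cast sum_card_voters (G := G) (φ := φ) y
  have h6 := h.deg_le y
  have h7 := h.D_pos
  rw [h5] at h4
  linarith

/-- If `s(y, z)` is shifted and few of its seers give `z` a wrong name, then the remaining ones give
`y` the same wrong name. -/
theorem mem_voterHubs_of_shifted (h : NamingSystem G φ p D d) (ψ : V → V) {y z : V}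
    (hx : s(y, z) ∈ shiftedPairs G φ ψ d) (hz : y ∉ dissenterHubs G φ ψ d z) :
    z ∈ voterHubs G φ ψ d y := by
  classical
  have hd := h.d_pos
  obtain ⟨-, g, hg, hcard⟩ := mem_shiftedPairs.1 hx
  rw [mem_dissenterHubs, not_le] at hz
  set N := namers G φ s(y, z) g \ (nbr G y ∩ dissenters G φ ψ z) with hN
  have hNc : 0.83 * d ≤ (N.card : ℝ) := by
    have h1 : (namers G φ s(y, z) g).card ≤ N.card + (nbr G y ∩ dissenters G φ ψ z).card :=
      Finset.card_le_card_sdiff_add_card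
    have h2 : ((namers G φ s(y, z) g).card : ℝ) ≤
        N.card + (nbr G y ∩ dissenters G φ ψ z).card := by exact_mod_cast h1
    linarith
  have hNm : ∀ v ∈ N, G.Adj v y ∧ G.Adj v z ∧ s(φ v y, ψ z) = g := by
    intro v hv
    obtain ⟨hv1, hv2⟩ := Finset.mem_sdiff.1 hv
    obtain ⟨hs, hvg⟩ := mem_namers.1 hv1
    rw [sees_mk] at hs
    have hvz : φ v z = ψ z := by
      by_contra hne
      exact hv2 (Finset.mem_inter.2 ⟨mem_nbr.2 hs.2.1.symm, mem_dissenters.2 ⟨hs.2.2.symm, hne⟩⟩)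
    rw [Sym2.map_mk, hvz] at hvg
    exact ⟨hs.2.1, hs.2.2, hvg⟩
  have hne : N.Nonempty := by
    rw [← Finset.card_pos, ← Nat.cast_pos (α := ℝ)]
    exact lt_of_lt_of_le (by positivity) hNc
  obtain ⟨w, hw⟩ := hne
  refine mem_voterHubs.2 ⟨φ w y, fun he => hg ?_, hNc.trans ?_⟩
  · rw [← (hNm w hw).2.2, he, Sym2.map_mk]
  · refine Nat.cast_le.2 (Finset.card_le_card fun v hv => Finset.mem_inter.2 ⟨?_, ?_⟩)
    · exact mem_nbr.2 (hNm v hv).2.1.symm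
    · refine mem_voters.2 ⟨(hNm v hv).1, ?_⟩
      have := (hNm v hv).2.2.trans (hNm w hw).2.2.symm
      rcases Sym2.eq_iff.1 this with h1 | ⟨h1, h2⟩
      · exact h1.1
      · exact h1.trans h2

theorem mem_dissenterHubs_of_shifted (h : NamingSystem G φ p D d) (ψ : V → V) {y z : V}
    (hx : s(y, z) ∈ shiftedPairs G φ ψ d) :
    z ∈ dissenterHubs G φ ψ d y ∨ y ∈ dissenterHubs G φ ψ d z := by
  by_contra hcon
  rw [not_or, mem_dissenterHubs, mem_dissenterHubs, not_le, not_le] at hcon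
  have hd := h.d_pos
  obtain ⟨-, g, hg, hcard⟩ := mem_shiftedPairs.1 hx
  have hsub : namers G φ s(y, z) g ⊆
      (nbr G z ∩ dissenters G φ ψ y) ∪ (nbr G y ∩ dissenters G φ ψ z) := by
    intro v hv
    obtain ⟨hs, hvg⟩ := mem_namers.1 hv
    rw [sees_mk] at hs
    simp only [Finset.mem_union, Finset.mem_inter, mem_nbr, mem_dissenters]
    by_contra hc
    refine hg ?_
    have h1 : φ v y = ψ y := by
      by_contra hne
      exact hc (Or.inl ⟨hs.2.2.symm, hs.2.1.symm, hne⟩)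
    have h2 : φ v z = ψ z := by
      by_contra hne
      exact hc (Or.inr ⟨hs.2.1.symm, hs.2.2.symm, hne⟩)
    rw [← hvg, Sym2.map_mk, Sym2.map_mk, h1, h2]
  have h1 := (Finset.card_le_card hsub).trans (Finset.card_union_le _ _)
  have h2 : ((namers G φ s(y, z) g).card : ℝ) ≤ (nbr G z ∩ dissenters G φ ψ y).card +
      (nbr G y ∩ dissenters G φ ψ z).card := by exact_mod_cast h1
  linarith

/-- The names in a naming system come from one permutation of the vertices. Each shifted pair has
both elements in the small set `Y` of vertices with many dissenters, or contains a vertex that is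
a hub with respect to the other one; there are too few such pairs unless there are no bad darts. -/
theorem exists_global_name (h : NamingSystem G φ p D d) :
    ∃ ψ : Equiv.Perm V, ∀ v y, G.Adj v y → φ v y = ψ y := by
  classical
  obtain ⟨ψ, hψ, hbad⟩ := h.exists_perm
  refine ⟨ψ, ?_⟩
  suffices hM0 : (badDarts G φ ψ).card = 0 by
    intro v y hvy
    by_contra hne
    rw [Finset.card_eq_zero] at hM0
    have := mem_badDarts.2 (show G.Adj (v, y).1 (v, y).2 ∧ φ (v, y).1 (v, y).2 ≠ ψ (v, y).2 from
      ⟨hvy, hne⟩)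
    rw [hM0] at this
    simp at this
  set M : ℝ := ((badDarts G φ ψ).card : ℝ) with hM
  set n : ℝ := (Fintype.card V : ℝ) with hn
  have hD := h.D_pos
  have hp := h.p_pos
  have hp1 := h.p_le
  have hMsum : M = ∑ y, ((dissenters G φ ψ y).card : ℝ) := by
    rw [hM, card_badDarts_eq]; push_cast; rfl
  -- The vertices with many dissenters.
  set Y : Finset V := Finset.univ.filter fun y => 0.01 * D ≤ ((dissenters G φ ψ y).card : ℝ) with hY
  have hYM : Y.card * (0.01 * D) ≤ M := by
    rw [hMsum, ← nsmul_eq_mul, ← Finset.sum_const]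
    refine (Finset.sum_le_sum fun y hy => (Finset.mem_filter.1 hy).2).trans ?_
    exact Finset.sum_le_sum_of_subset_of_nonneg (Finset.subset_univ _)
      fun _ _ _ => Nat.cast_nonneg _
  set R := (Finset.univ : Finset V).offDiag.filter fun q => s(q.1, q.2) ∈ shiftedPairs G φ ψ d
    with hR
  have hRcard : R.card = 2 * (shiftedPairs G φ ψ d).card := by
    rw [hR, card_offDiag_filter fun x => x ∈ shiftedPairs G φ ψ d]
    congr 2
    ext x
    rw [Finset.mem_filter, mem_allPairs]
    exact ⟨fun hx => hx.2, fun hx => ⟨(mem_shiftedPairs.1 hx).1, hx⟩⟩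
  set T : Finset (V × V) := (Finset.univ.sigma fun y =>
    if y ∈ Y then voterHubs G φ ψ d y else dissenterHubs G φ ψ d y).image (fun e => (e.1, e.2))
    with hT
  have hcover : R ⊆ (Y ×ˢ Y) ∪ (T ∪ T.image Prod.swap) := by
    rintro ⟨y, z⟩ hq
    have hx : s(y, z) ∈ shiftedPairs G φ ψ d := (Finset.mem_filter.1 hq).2
    have hx' : s(z, y) ∈ shiftedPairs G φ ψ d := by rwa [Sym2.eq_swap]
    have hTm : ∀ a b, (a ∈ Y → b ∈ voterHubs G φ ψ d a) →
        (a ∉ Y → b ∈ dissenterHubs G φ ψ d a) → (a, b) ∈ T := by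
      intro a b h1 h2
      refine Finset.mem_image.2 ⟨⟨a, b⟩, Finset.mem_sigma.2 ⟨Finset.mem_univ _, ?_⟩, rfl⟩
      by_cases ha : a ∈ Y
      · simpa only [if_pos ha] using h1 ha
      · simpa only [if_neg ha] using h2 ha
    have hTs : (z, y) ∈ T → (y, z) ∈ T.image Prod.swap := fun ht =>
      Finset.mem_image.2 ⟨(z, y), ht, rfl⟩
    rw [Finset.mem_union, Finset.mem_union, Finset.mem_product]
    by_cases hy : y ∈ Y <;> by_cases hz : z ∈ Y
    · exact Or.inl ⟨hy, hz⟩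
    · by_cases hub : y ∈ dissenterHubs G φ ψ d z
      · exact Or.inr (Or.inr (hTs (hTm z y (fun e => absurd e hz) fun _ => hub)))
      · exact Or.inr (Or.inl (hTm y z (fun _ => h.mem_voterHubs_of_shifted ψ hx hub)
          fun e => absurd hy e))
    · by_cases hub : z ∈ dissenterHubs G φ ψ d y
      · exact Or.inr (Or.inl (hTm y z (fun e => absurd e hy) fun _ => hub))
      · exact Or.inr (Or.inr (hTs (hTm z y (fun _ => h.mem_voterHubs_of_shifted ψ hx' hub)
          fun e => absurd hz e)))
    · rcases h.mem_dissenterHubs_of_shifted ψ hx with hub | hub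
      · exact Or.inr (Or.inl (hTm y z (fun e => absurd e hy) fun _ => hub))
      · exact Or.inr (Or.inr (hTs (hTm z y (fun e => absurd e hz) fun _ => hub)))
  have hTcard : (T.card : ℝ) ≤ 0.03 * M := by
    have h1 : T.card ≤ ∑ y, (if y ∈ Y then voterHubs G φ ψ d y else
        dissenterHubs G φ ψ d y).card := by
      rw [← Finset.card_sigma]
      exact Finset.card_image_le
    have h2 : ∀ y, (((if y ∈ Y then voterHubs G φ ψ d y else
        dissenterHubs G φ ψ d y).card : ℕ) : ℝ) ≤ 0.02 * (dissenters G φ ψ y).card := by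
      intro y
      by_cases hy : y ∈ Y
      · rw [if_pos hy]
        have h3 := h.card_voterHubs_le ψ (hψ y)
        have h4 := (Finset.mem_filter.1 hy).2
        linarith
      · rw [if_neg hy]
        have h4 : ((dissenters G φ ψ y).card : ℝ) ≤ 0.01 * D := by
          by_contra hc
          exact hy (Finset.mem_filter.2 ⟨Finset.mem_univ _, (not_le.1 hc).le⟩)
        have h3 := h.card_dissenterHubs_le ψ h4
        have h5 : (0 : ℝ) ≤ (dissenters G φ ψ y).card := Nat.cast_nonneg _
        linarith
    have h3 := Finset.sum_le_sum fun y (_ : y ∈ Finset.univ) => h2 y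
    rw [← Finset.mul_sum, ← hMsum] at h3
    have h4 : (T.card : ℝ) ≤ ∑ y, (((if y ∈ Y then voterHubs G φ ψ d y else
        dissenterHubs G φ ψ d y).card : ℕ) : ℝ) := by exact_mod_cast h1
    have h5 : 0 ≤ M := Nat.cast_nonneg _
    linarith
  have hRle : (R.card : ℝ) ≤ Y.card * Y.card + 2 * (0.03 * M) := by
    have h1 := (Finset.card_le_card hcover).trans (Finset.card_union_le _ _)
    have h2 := Finset.card_union_le T (T.image Prod.swap)
    have h3 := Finset.card_image_le (s := T) (f := Prod.swap)
    rw [Finset.card_product] at h1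
    have h4 : R.card ≤ Y.card * Y.card + 2 * T.card := by omega
    have h5 : (R.card : ℝ) ≤ Y.card * Y.card + 2 * T.card := by exact_mod_cast h4
    linarith
  have hYY : Y.card * Y.card * p ≤ 0.01 * M := by
    have h1 : (Y.card : ℝ) * (0.01 * D) ≤ 24 / 10 ^ 8 * n * D := by linarith
    have h2 : (Y.card : ℝ) ≤ 24 / 10 ^ 6 * n := by
      refine le_of_mul_le_mul_right ?_ hD
      linarith
    have h3 : Y.card * p ≤ 24 / 10 ^ 6 * D := by
      rw [h.D_eq]
      have := mul_le_mul_of_nonneg_right h2 hp.le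
      linarith
    have h4 := mul_le_mul_of_nonneg_left h3 (Nat.cast_nonneg (α := ℝ) Y.card)
    have h5 : 0 ≤ M := Nat.cast_nonneg _
    linarith
  have hkey := h.le_card_shiftedPairs ψ
  have hRr : (R.card : ℝ) = 2 * (shiftedPairs G φ ψ d).card := by exact_mod_cast hRcard
  have hM0 : 0 ≤ M := Nat.cast_nonneg _
  have h1 := mul_le_mul_of_nonneg_right hRle hp.le
  have h2 : 2 * (0.03 * M) * p ≤ 2 * (0.03 * M) := by nlinarith
  have h3 : M ≤ 0 := by
    rw [hRr] at h1
    linarith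
  exact Nat.cast_eq_zero.1 (hM ▸ le_antisymm h3 hM0)

end NamingSystem

end NoBadDarts

/-! ### Graphs with the same neighborhoods -/

section Reconstruction

theorem exists_perm_of_map_eq {V α : Type*} [Fintype V] (f g : V → α)
    (h : (Finset.univ : Finset V).val.map f = (Finset.univ : Finset V).val.map g) :
    ∃ π : Equiv.Perm V, ∀ v, g (π v) = f v := by
  classical
  have hc : ∀ a, Nonempty ({v // f v = a} ≃ {v // g v = a}) := by
    intro a
    refine Fintype.card_eq.1 ?_
    have := congrArg (Multiset.count a) h
    rw [Multiset.count_map, Multiset.count_map] at this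
    rw [Fintype.card_subtype, Fintype.card_subtype]
    simpa only [Finset.card_def, Finset.filter_val, eq_comm] using this
  have e := fun a => (hc a).some
  refine ⟨((Equiv.sigmaFiberEquiv f).symm.trans (Equiv.sigmaCongrRight e)).trans
    (Equiv.sigmaFiberEquiv g), fun v => ?_⟩
  exact (e (f v) ⟨v, rfl⟩).2

/-- The map `f` embeds the graph on the neighbors of `v` into the graph on the neighbors of `w`. -/
structure NbrEmbedding {V : Type*} (G H : SimpleGraph V) (v w : V) (f : V → V) : Prop where
  adj : ∀ y, G.Adj v y → H.Adj w (f y)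
  inj : ∀ y z, G.Adj v y → G.Adj v z → f y = f z → y = z
  map_adj : ∀ y z, G.Adj v y → G.Adj v z → (G.Adj y z ↔ H.Adj (f y) (f z))

theorem mem_nbhdSet_one {V : Type*} {G : SimpleGraph V} {v y : V} :
    y ∈ nbhdSet G 1 v ↔ G.Adj v y ∨ v = y := by
  rw [nbhdSet, Set.mem_ofPred_eq, Nat.cast_one, SimpleGraph.edist_le_one_iff_adj_or_eq]

/-- Isomorphic unmarked `1`-neighborhoods are isomorphic with marked centers too, since the image of
the center is adjacent to everything and may be exchanged with the other center. -/
theorem exists_nbrEmbedding {V : Type*} {G H : SimpleGraph V} {v w : V}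
    (e : nbhdGraph G 1 v ≃g nbhdGraph H 1 w) : ∃ f : V → V, NbrEmbedding G H v w f := by
  classical
  set v' : nbhdSet G 1 v := ⟨v, mem_nbhdSet_one.2 (Or.inr rfl)⟩
  set w' : nbhdSet H 1 w := ⟨w, mem_nbhdSet_one.2 (Or.inr rfl)⟩
  set f : V → V := fun y => if hy : G.Adj v y then
    (if e ⟨y, mem_nbhdSet_one.2 (Or.inl hy)⟩ = w' then (e v' : V)
      else e ⟨y, mem_nbhdSet_one.2 (Or.inl hy)⟩) else y
  have hf : ∀ y (hy : G.Adj v y), f y = if e ⟨y, mem_nbhdSet_one.2 (Or.inl hy)⟩ = w' then (e v' : V)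
      else e ⟨y, mem_nbhdSet_one.2 (Or.inl hy)⟩ := fun y hy => by simp only [f, dif_pos hy]
  have hadj : ∀ a b : nbhdSet G 1 v, G.Adj a b ↔ H.Adj (e a) (e b) := fun a b =>
    (e.map_adj_iff (v := a) (w := b)).symm
  have hw : ∀ b : nbhdSet H 1 w, b ≠ w' → H.Adj w b := by
    intro b hb
    rcases mem_nbhdSet_one.1 b.2 with h | h
    · exact h
    · exact absurd (Subtype.ext h.symm) hb
  have hval : ∀ a b : nbhdSet G 1 v, (e a : V) = e b → a = b := fun a b h =>
    e.injective (Subtype.ext h)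
  refine ⟨f, ⟨fun y hy => ?_, fun y z hy hz hyz => ?_, fun y z hy hz => ?_⟩⟩
  · rw [hf y hy]
    split_ifs with h
    · refine hw _ fun h' => hy.ne ?_
      exact congrArg Subtype.val (e.injective (h'.trans h.symm))
    · exact hw _ h
  · rw [hf y hy, hf z hz] at hyz
    split_ifs at hyz with h1 h2 h2
    · exact congrArg Subtype.val (e.injective (h1.trans h2.symm))
    · exact absurd (congrArg Subtype.val (hval _ _ hyz)) hz.ne
    · exact absurd (congrArg Subtype.val (hval _ _ hyz)).symm hy.ne
    · exact congrArg Subtype.val (hval _ _ hyz)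
  · have hG := hadj ⟨y, mem_nbhdSet_one.2 (Or.inl hy)⟩ ⟨z, mem_nbhdSet_one.2 (Or.inl hz)⟩
    have hvy := (hadj v' ⟨y, mem_nbhdSet_one.2 (Or.inl hy)⟩).1 hy
    have hvz := (hadj v' ⟨z, mem_nbhdSet_one.2 (Or.inl hz)⟩).1 hz
    rw [hf y hy, hf z hz]
    simp only at hG
    rw [hG]
    split_ifs with h1 h2 h2
    · rw [h1, h2]; simp
    · rw [h1]
      exact ⟨fun _ => hvz, fun _ => hw _ h2⟩
    · rw [h2]
      exact ⟨fun _ => hvy.symm, fun _ => (hw _ h1).symm⟩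
    · exact Iff.rfl

variable {n : ℕ}

theorem card_nbr_le_of_nbrEmbedding {V : Type*} [Fintype V] {G H : SimpleGraph V} {v w : V}
    {f : V → V} (hf : NbrEmbedding G H v w f) : (nbr G v).card ≤ (nbr H w).card :=
  Finset.card_le_card_of_injOn f (fun y hy => by
    rw [Finset.mem_coe, mem_nbr] at hy ⊢
    exact hf.adj y hy) fun y hy z hz h => hf.inj y z (mem_nbr.1 hy) (mem_nbr.1 hz) h

/-- A graph with random-like degrees, codegrees and edge distribution and with a small rate of
collision failures is determined by its `1`-neighborhoods. -/
theorem isReconstructable_of_typical {G : SimpleGraph (Fin n)} {p B : ℝ} (h0 : 0 < p) (h1 : p ≤ 1)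
    (hd : 4 * 10 ^ 9 ≤ n * p ^ 2) (htyp : Typical G p (1 / 10 ^ 9) (1 / 10 ^ 5 * (n * p ^ 2)))
    (hB : 0 ≤ B) (hBD : 192 * 10 ^ 18 * B ≤ n * p)
    (hrate : (n : ℝ) ^ 2 * failureRate G (1 / (n * p ^ 2)) B ≤ 1 / (n * p ^ 2) * B) :
    (UnlabeledGraph.mk G).IsReconstructable 1 := by
  intro H'
  induction H' using Quotient.inductionOn with
  | _ H =>
  intro hH
  have hnb : labeledNbhds 1 H = labeledNbhds 1 G := hH
  obtain ⟨π, hπ⟩ := exists_perm_of_map_eq _ _ hnb.symm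
  have hiso : ∀ v, Nonempty (nbhdGraph G 1 v ≃g nbhdGraph H 1 (π v)) := fun v =>
    (graphClass_eq_iff _ _).1 (hπ v).symm
  choose φ hφ using fun v => exists_nbrEmbedding (hiso v).some
  set d : ℝ := n * p ^ 2 with hd'
  have hd0 : 0 < d := by linarith
  have hcons : Consistent G Set.univ φ := by
    have key : ∀ v x, Sees G v x → (x ∈ G.edgeSet ↔ x.map (φ v) ∈ H.edgeSet) := by
      intro v x
      induction x using Sym2.ind with
      | _ y z =>
        intro hx
        rw [sees_mk] at hx
        exact (hφ v).map_adj y z hx.2.1 hx.2.2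
    intro v _ v' _ x x' hx hx' he
    rw [key v x hx, key v' x' hx', he]
  have hN : NamingSystem G φ p (n * p) d := by
    refine ⟨h0, h1, by simp, by simp [hd'], by linarith, htyp, fun v => (hφ v).inj, ?_, ?_⟩
    · intro a T hT
      have h2 : T.card ≤ (nbr H a).card := by
        refine Finset.card_le_card_of_injOn π (fun v hv => ?_) π.injective.injOn
        obtain ⟨y, hy, rfl⟩ := hT v hv
        rw [Finset.mem_coe, mem_nbr]
        exact ((hφ v).adj y hy).symm
      obtain ⟨f, hf⟩ := exists_nbrEmbedding (hiso (π.symm a)).some.symm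
      have h3 := card_nbr_le_of_nbrEmbedding hf
      rw [Equiv.apply_symm_apply] at h3
      have h4 := htyp.deg_le (π.symm a)
      rw [Fintype.card_fin] at h4
      refine le_trans ?_ h4
      exact_mod_cast h2.trans h3
    · intro ψ
      have hq : 1 / d ≤ 1 / 4 := one_div_le_one_div_of_le (by norm_num) (by linarith)
      have hqm : 1 / d * (1 / 10 ^ 9 * d) = 1 / 10 ^ 9 := by field_simp
      have h2 := sum_impureSeers_le G φ (q := 1 / d) (m := 1 / 10 ^ 9 * d) (B := B)
        (by positivity) hq (by linarith) (by rw [hqm]; norm_num) (fun v w hvw => by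
          have h3 := htyp.codeg_le v w hvw
          rw [Fintype.card_fin, ← hd'] at h3
          rw [one_div, inv_mul_le_iff₀ hd0]
          linarith) hB hcons (by simpa using hrate) ψ
      refine h2.trans (mul_le_mul_of_nonneg_right ?_ (Nat.cast_nonneg _))
      rw [hqm, div_le_iff₀ (by norm_num)]
      linarith
  obtain ⟨ψ, hψ⟩ := hN.exists_global_name
  have hadj : ∀ y z, y ≠ z → (G.Adj y z ↔ H.Adj (ψ y) (ψ z)) := by
    intro y z hyz
    have h2 := htyp.le_codeg y z hyz
    rw [Fintype.card_fin, ← hd'] at h2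
    have h3 : 0 < (nbr G y ∩ nbr G z).card := by
      rw [← Nat.cast_pos (α := ℝ)]
      linarith
    obtain ⟨v, hv⟩ := Finset.card_pos.1 h3
    rw [Finset.mem_inter, mem_nbr, mem_nbr] at hv
    rw [← hψ v y hv.1.symm, ← hψ v z hv.2.symm]
    exact (hφ v).map_adj y z hv.1.symm hv.2.symm
  refine Quotient.sound ⟨RelIso.symm ⟨ψ, fun {y z} => ?_⟩⟩
  by_cases hyz : y = z
  · subst hyz; simp
  · exact (hadj y z hyz).symm

end Reconstruction

/-! ### The probability of success -/

section Probability

/-- Reconstruction fails only if the graph is not typical or if its failure rate exceeds `c`. -/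
theorem le_reconstructionProb {n : ℕ} (p : unitInterval) {B c : ℝ} (h0 : 0 < (p : ℝ))
    (h1 : (p : ℝ) ≤ 1 / 2) (hn : 8 * 10 ^ 9 ≤ (n : ℝ)) (hd : 4 * 10 ^ 9 ≤ n * (p : ℝ) ^ 2)
    (hκ : 2 * n * Real.exp (-(1 / 10 ^ 5 * (n * (p : ℝ) ^ 2) / 10)) ≤ 1)
    (hB : 0 ≤ B) (hBD : 192 * 10 ^ 18 * B ≤ n * p)
    (hBn : (n : ℝ) ^ 3 * Real.exp (-(p * B / 2)) ≤ 1) (hc : 0 < c)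
    (hcB : (n : ℝ) ^ 2 * c ≤ 1 / (n * (p : ℝ) ^ 2) * B) :
    1 - (4 * (n : ℝ) ^ 2 * Real.exp (-(n * (p : ℝ) ^ 2 * (1 / 10 ^ 9) ^ 2 / 32)) +
      4 * n * Real.exp (-(1 / 10 ^ 5 * (n * (p : ℝ) ^ 2) / 10)) +
      2 * ((n : ℝ) ^ 3 * Real.exp (-(p * B / 2))) / c) ≤ reconstructionProb n 1 p := by
  set d : ℝ := n * (p : ℝ) ^ 2 with hd'
  have hd0 : 0 < d := by linarith
  have hq1 : 1 / d ≤ 1 := by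
    rw [div_le_one hd0]; linarith
  have t1 := typical_fail (V := Fin n) (η := 1 / 10 ^ 9) (κ := 1 / 10 ^ 5 * d) h0.le
    (by linarith : (p : ℝ) ≤ 1) (by norm_num) (by norm_num)
    (by rw [Fintype.card_fin]; linarith) (by rwa [Fintype.card_fin])
  have t2 := failureRate_tail (V := Fin n) h0.le h1 (by positivity : 0 ≤ 1 / d) hq1 hB
    (by rwa [Fintype.card_fin]) hc
  rw [Fintype.card_fin] at t1 t2
  rw [← hd'] at t1
  rw [reconstructionProb, binomialRandom_real_eq]
  have hpt : subsetExp (p : ℝ) (allPairs (Fin n)) (fun _ => 1) ≤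
      subsetExp (p : ℝ) (allPairs (Fin n)) (fun S =>
        ind (edgeGraph S ∈ {G | (UnlabeledGraph.mk G).IsReconstructable 1}) +
        (ind (¬Typical (edgeGraph S) p (1 / 10 ^ 9) (1 / 10 ^ 5 * d)) +
          ind (c < failureRate (edgeGraph S) (1 / d) B))) := by
    refine subsetExp_mono h0.le (by linarith) fun S _ => ?_
    by_cases hT : Typical (edgeGraph S) p (1 / 10 ^ 9) (1 / 10 ^ 5 * d)
    · by_cases hF : c < failureRate (edgeGraph S) (1 / d) B
      · rw [ind_true hF]
        have := ind_nonneg (edgeGraph S ∈ {G | (UnlabeledGraph.mk G).IsReconstructable 1})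
        have := ind_nonneg (¬Typical (edgeGraph S) p (1 / 10 ^ 9) (1 / 10 ^ 5 * d))
        linarith
      · have hrec : (UnlabeledGraph.mk (edgeGraph S)).IsReconstructable 1 := by
          refine isReconstructable_of_typical h0 (by linarith) hd hT hB hBD (le_trans ?_ hcB)
          exact mul_le_mul_of_nonneg_left (not_lt.1 hF) (by positivity)
        rw [ind_true (show edgeGraph S ∈ {G | (UnlabeledGraph.mk G).IsReconstructable 1} from hrec)]
        have := ind_nonneg (c < failureRate (edgeGraph S) (1 / d) B)
        have := ind_nonneg (¬Typical (edgeGraph S) p (1 / 10 ^ 9) (1 / 10 ^ 5 * d))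
        linarith
    · rw [ind_true hT]
      have := ind_nonneg (edgeGraph S ∈ {G | (UnlabeledGraph.mk G).IsReconstructable 1})
      have := ind_nonneg (c < failureRate (edgeGraph S) (1 / d) B)
      linarith
  rw [subsetExp_const, subsetExp_add, subsetExp_add] at hpt
  linarith

theorem le_reconstructionProb_of_log {n : ℕ} (p : unitInterval)
    (hL : 10 ^ 12 ≤ Real.log n) (hd : Real.log n ^ 4 ≤ n * (p : ℝ) ^ 2) (h1 : (p : ℝ) ≤ 1 / 2) :
    1 - (n : ℝ) ^ (-Real.log n) ≤ reconstructionProb n 1 p := by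
  set L := Real.log n with hLdef
  have hL0 : 0 < L := by linarith
  have hn0 : (0 : ℝ) < n := by
    rcases Nat.eq_zero_or_pos n with rfl | h
    · simp [hLdef] at hL0
    · exact_mod_cast h
  have hnL : (n : ℝ) = Real.exp L := (Real.exp_log hn0).symm
  have hLn : L + 1 ≤ n := by rw [hnL]; exact Real.add_one_le_exp L
  set d : ℝ := n * (p : ℝ) ^ 2 with hd'
  have hL2 : 10 ^ 24 ≤ L ^ 2 := by nlinarith
  have hLL : L ≤ L ^ 2 / 10 ^ 12 := by
    rw [le_div_iff₀ (by norm_num)]; nlinarith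
  have hdL : 10 ^ 24 * L ^ 2 ≤ d := by
    refine le_trans ?_ hd
    nlinarith [sq_nonneg L]
  have hp0 : 0 < (p : ℝ) := by
    rcases p.2.1.lt_or_eq with h | h
    · exact h
    · rw [hd', ← h] at hdL
      nlinarith
  -- With this choice, `exp (-p * B / 2)` beats the powers of `n` lost in the union bound and in the
  -- application of Markov's inequality with `c = n ^ (-3)`.
  set B : ℝ := 16 * L ^ 2 / p with hBdef
  have hB0 : 0 ≤ B := by positivity
  have hpB : (p : ℝ) * B / 2 = 8 * L ^ 2 := by
    rw [hBdef]; field_simp; norm_num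
  have hpow : ∀ k : ℕ, (n : ℝ) ^ k = Real.exp (k * L) := fun k => by
    rw [hnL, ← Real.exp_nat_mul]
  have hle1 : ∀ x : ℝ, x ≤ 0 → Real.exp x ≤ 1 := fun x hx => Real.exp_le_one_iff.2 hx
  have h2L : (2 : ℝ) ≤ Real.exp L := by
    have := Real.add_one_le_exp L; linarith
  have hdn : d ≤ n := by
    rw [hd']
    have : (p : ℝ) ^ 2 ≤ 1 := by nlinarith
    nlinarith
  have hdpos : 0 < d := by nlinarith
  have key := le_reconstructionProb (n := n) p (B := B) (c := 1 / (n : ℝ) ^ 3) hp0 h1 (by linarith)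
    (by linarith) (by
      rw [hnL]
      calc 2 * Real.exp L * Real.exp (-(1 / 10 ^ 5 * (Real.exp L * (p : ℝ) ^ 2) / 10))
          ≤ Real.exp L * Real.exp L *
              Real.exp (-(1 / 10 ^ 5 * (Real.exp L * (p : ℝ) ^ 2) / 10)) := by gcongr
        _ = Real.exp (L + L + -(1 / 10 ^ 5 * d / 10)) := by
            rw [Real.exp_add, Real.exp_add, hd', hnL]
        _ ≤ 1 := hle1 _ (by linarith)) hB0
    (by
      rw [hBdef, mul_div_assoc', div_le_iff₀ hp0]
      have : (n : ℝ) * p * p = d := by rw [hd']; ring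
      rw [this]
      linarith)
    (by
      rw [hpB, hpow, ← Real.exp_add]
      refine hle1 _ ?_
      push_cast
      linarith) (by positivity)
    (by
      have e1 : (n : ℝ) ^ 2 * (1 / (n : ℝ) ^ 3) = 1 / n := by field_simp
      have e2 : 1 ≤ B := by
        rw [hBdef, le_div_iff₀ hp0]; nlinarith
      rw [e1, ← hd']
      calc 1 / (n : ℝ) ≤ 1 / d := one_div_le_one_div_of_le hdpos hdn
        _ ≤ 1 / d * B := le_mul_of_one_le_right (by positivity) e2)
  refine le_trans ?_ key
  rw [sub_le_sub_iff_left, ← hd', hpB]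
  have hRHS : (n : ℝ) ^ (-L) = Real.exp (-L ^ 2) := by
    rw [Real.rpow_def_of_pos hn0, ← hLdef]; ring_nf
  have h4 : (10 : ℝ) ≤ Real.exp L := by linarith [Real.add_one_le_exp L]
  have b1 : (n : ℝ) ^ 2 * Real.exp (-(d * (1 / 10 ^ 9) ^ 2 / 32)) ≤ Real.exp (-L - L ^ 2) := by
    rw [hpow, ← Real.exp_add]
    refine Real.exp_le_exp.2 ?_
    push_cast
    linarith
  have b2 : n * Real.exp (-(1 / 10 ^ 5 * d / 10)) ≤ Real.exp (-L - L ^ 2) := by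
    have : (n : ℝ) = Real.exp L := hnL
    rw [this, ← Real.exp_add]
    refine Real.exp_le_exp.2 ?_
    linarith
  have b3 : (n : ℝ) ^ 3 * Real.exp (-(8 * L ^ 2)) * (n : ℝ) ^ 3 ≤ Real.exp (-L - L ^ 2) := by
    rw [hpow, ← Real.exp_add, ← Real.exp_add]
    refine Real.exp_le_exp.2 ?_
    push_cast
    linarith
  have b4 : 2 * ((n : ℝ) ^ 3 * Real.exp (-(8 * L ^ 2))) / (1 / (n : ℝ) ^ 3) =
      2 * ((n : ℝ) ^ 3 * Real.exp (-(8 * L ^ 2)) * (n : ℝ) ^ 3) := by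
    field_simp
  have b5 : 10 * Real.exp (-L - L ^ 2) ≤ Real.exp (-L ^ 2) := by
    calc 10 * Real.exp (-L - L ^ 2) ≤ Real.exp L * Real.exp (-L - L ^ 2) := by gcongr
      _ = Real.exp (-L ^ 2) := by rw [← Real.exp_add]; ring_nf
  rw [hRHS, b4]
  linarith

end Probability

theorem theorem2 :
    ∃ C c : ℝ, 0 < C ∧ 0 < c ∧
      ∀ p : ℕ → unitInterval,
        (∀ᶠ n : ℕ in Filter.atTop,
          (n : ℝ) ^ (-(1 / 2) : ℝ) * Real.log (n : ℝ) ^ C ≤ (p n : ℝ) ∧ (p n : ℝ) ≤ c) →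
        ∃ ω : ℕ → ℝ, Filter.Tendsto ω Filter.atTop Filter.atTop ∧
          ∀ᶠ n : ℕ in Filter.atTop,
            1 - (n : ℝ) ^ (-ω n) ≤ reconstructionProb n 1 (p n) := by
  have hlog : Filter.Tendsto (fun n : ℕ => Real.log n) Filter.atTop Filter.atTop :=
    Real.tendsto_log_atTop.comp tendsto_natCast_atTop_atTop
  -- The error probability is `n ^ (-log n)`.
  refine ⟨2, 1 / 2, by norm_num, by norm_num, fun p hp => ⟨fun n => Real.log n, hlog, ?_⟩⟩
  filter_upwards [hp, hlog.eventually_ge_atTop (10 ^ 12), Filter.eventually_gt_atTop 0]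
    with n hn hL hn0
  refine le_reconstructionProb_of_log (p n) hL ?_ hn.2
  have hn0' : (0 : ℝ) < n := by exact_mod_cast hn0
  have h1 := hn.1
  rw [Real.rpow_two] at h1
  have h2 : ((n : ℝ) ^ (-(1 / 2) : ℝ)) ^ 2 = (n : ℝ)⁻¹ := by
    rw [← Real.rpow_natCast, ← Real.rpow_mul hn0'.le, ← Real.rpow_neg_one]
    norm_num
  have h3 := pow_le_pow_left₀ (by positivity) h1 2
  rw [mul_pow, h2, inv_mul_le_iff₀ hn0'] at h3
  calc Real.log n ^ 4 = (Real.log n ^ 2) ^ 2 := by ring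
    _ ≤ _ := h3
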